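/- The infinite grid has the points $\mathbb Z^2$; its edges join points at distance one on a common row or a common column. A $B_2$-EPG representation of a finite graph $G$ assigns to every vertex $u$ a path $P_u$ of the grid with at most two bends such that two distinct vertices are adjacent in $G$ if and only if their paths share a grid edge. A vertex $u$ is a Z-vertex of the representation if there are exactly two rows and exactly one column that contain at least one edge of $P_u$. Theorem. There is an algorithm that, given a $B_2$-EPG representation of a graph $G$ in which every vertex is a Z-vertex, computes the size of a maximum clique of $G$ in polynomial time. More precisely, there are a program of a random access machine with integer cells, whose elementary operations are indirect memory access, addition, subtraction and comparison, each of unit cost, and a polynomial $p$ such that the following holds. Let $G$ be a graph with vertices $0,\dots,n-1$ and with a $B_2$-EPG representation in which every vertex is a Z-vertex. Given as input the number $n$ and, for each vertex in turn, the coordinates of the two ends and of the bends of its path, in their order along the path, the program halts after at most $p(n)$ steps with the output $\omega(G)$, the maximum size of a clique of $G$. -/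

import Mathlib

namespace EPG

/-! ### Paths on the grid and their intersection graphs -/

/-- The infinite rectangular grid. The point `(x, y)` lies on column `x` and on row `y`; two points
are joined by a grid edge when they are at distance one on a common row or a common column. -/
def grid : SimpleGraph (ℤ × ℤ) where
  Adj p q := (p.1 = q.1 ∧ |p.2 - q.2| = 1) ∨ (p.2 = q.2 ∧ |p.1 - q.1| = 1)
  symm := ⟨fun p q h => by rwa [abs_sub_comm q.2, abs_sub_comm q.1, eq_comm (a := q.1),
    eq_comm (a := q.2)]⟩
  loopless := ⟨fun p h => by simp at h⟩

/-- The points of a list at which the polygonal line through the list turns. -/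
def bendPoints : List (ℤ × ℤ) → List (ℤ × ℤ)
  | p :: q :: r :: l =>
    if (p.1 = q.1 ∧ q.1 = r.1) ∨ (p.2 = q.2 ∧ q.2 = r.2) then bendPoints (q :: r :: l)
    else q :: bendPoints (q :: r :: l)
  | _ => []

/-- A (simple) path on the grid. -/
structure GridPath where
  src : ℤ × ℤ
  tgt : ℤ × ℤ
  walk : grid.Walk src tgt
  isPath : walk.IsPath

namespace GridPath

/-- The number of bends of a grid path. -/
def numBends (P : GridPath) : ℕ := (bendPoints P.walk.support).length

/-- The first end of the path, then its bends in order, then its last end. -/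
def corners (P : GridPath) : List (ℤ × ℤ) :=
  P.src :: (bendPoints P.walk.support ++ [P.tgt])

/-- The rows that contain at least one edge of the path. -/
def rows (P : GridPath) : Set ℤ := {a | ∃ e ∈ P.walk.edges, ∀ p ∈ e, p.2 = a}

/-- The columns that contain at least one edge of the path. -/
def cols (P : GridPath) : Set ℤ := {a | ∃ e ∈ P.walk.edges, ∀ p ∈ e, p.1 = a}

/-- The path intersects exactly two rows and exactly one column. -/
def IsZ (P : GridPath) : Prop := P.rows.ncard = 2 ∧ P.cols.ncard = 1

end GridPath

/-- A `B_k`-EPG representation of `G`: every vertex is a grid path with at most `k` bends, and two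
distinct vertices are adjacent exactly when their paths share a grid edge. -/
structure BendRep {V : Type*} (k : ℕ) (G : SimpleGraph V) where
  path : V → GridPath
  bends_le : ∀ v, (path v).numBends ≤ k
  adj_iff : ∀ u v, G.Adj u v ↔
    u ≠ v ∧ ∃ e, e ∈ (path u).walk.edges ∧ e ∈ (path v).walk.edges

/-- A representation given to an algorithm: the number of vertices, followed, vertex by vertex, by
the two coordinates of each corner of its path. -/
def BendRep.encode {k n : ℕ} {G : SimpleGraph (Fin n)} (R : BendRep k G) : List ℤ :=
  (n : ℤ) :: (List.finRange n).flatMap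
    (fun v => (R.path v).corners.flatMap (fun p => [p.1, p.2]))

/-! ### Random access machines with a step count

Programs work on a memory of integer cells with indirect addressing. The only arithmetic is
addition, subtraction and comparison, each of unit cost, so that in `t` steps the bit length of the
numbers grows by at most `O(t)`, and polynomial time means the same as for Turing machines. -/

/-- A memory: one integer cell for each integer address. -/
abbrev Mem := ℤ → ℤ

/-- The memory that holds the list `l` in the cells `0, 1, 2, …` and zeros elsewhere. -/
def Mem.ofList (l : List ℤ) : Mem := fun a => if 0 ≤ a then l.getD a.toNat 0 else 0

/-- Expressions. `load e` is the content of the cell whose address is the value of `e`. -/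
inductive Expr where
  | const (c : ℤ)
  | load (e : Expr)
  | add (e f : Expr)
  | sub (e f : Expr)
  | lt (e f : Expr)

namespace Expr

/-- The value of an expression. -/
def eval (M : Mem) : Expr → ℤ
  | const c => c
  | load e => M (eval M e)
  | add e f => eval M e + eval M f
  | sub e f => eval M e - eval M f
  | lt e f => if eval M e < eval M f then 1 else 0

/-- The number of elementary operations used to evaluate an expression. -/
def cost : Expr → ℕ
  | const _ => 1
  | load e => cost e + 1
  | add e f => cost e + cost f + 1
  | sub e f => cost e + cost f + 1
  | lt e f => cost e + cost f + 1

end Expr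

/-- Programs. `store e f` writes the value of `f` into the cell whose address is the value of `e`;
a test `e` succeeds when the value of `e` is positive. -/
inductive Program where
  | skip
  | store (e f : Expr)
  | seq (c d : Program)
  | ite (e : Expr) (c d : Program)
  | loop (e : Expr) (c : Program)

/-- `Runs c M t M'`: started on the memory `M`, the program `c` halts after exactly `t` steps with
the memory `M'`. -/
inductive Runs : Program → Mem → ℕ → Mem → Prop where
  | skip (M : Mem) : Runs Program.skip M 1 M
  | store (e f : Expr) (M : Mem) :
      Runs (Program.store e f) M (e.cost + f.cost + 1)
        (Function.update M (e.eval M) (f.eval M))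
  | seq {c d : Program} {M M' M'' : Mem} {s t : ℕ} (hc : Runs c M s M') (hd : Runs d M' t M'') :
      Runs (Program.seq c d) M (s + t) M''
  | ite_pos {e : Expr} {c : Program} (d : Program) {M M' : Mem} {t : ℕ} (he : 0 < e.eval M)
      (hc : Runs c M t M') : Runs (Program.ite e c d) M (e.cost + 1 + t) M'
  | ite_neg {e : Expr} (c : Program) {d : Program} {M M' : Mem} {t : ℕ} (he : ¬ 0 < e.eval M)
      (hd : Runs d M t M') : Runs (Program.ite e c d) M (e.cost + 1 + t) M'
  | loop_pos {e : Expr} {c : Program} {M M' M'' : Mem} {s t : ℕ} (he : 0 < e.eval M)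
      (hc : Runs c M s M') (hl : Runs (Program.loop e c) M' t M'') :
      Runs (Program.loop e c) M (e.cost + 1 + s + t) M''
  | loop_neg {e : Expr} (c : Program) {M : Mem} (he : ¬ 0 < e.eval M) :
      Runs (Program.loop e c) M (e.cost + 1) M

end EPG

/-!
A path of a Z-vertex consists of a horizontal, a vertical and a horizontal segment. If such paths
share grid edges pairwise, then all of them lie in the union of two cliques, each of which is given
by three intervals on rows or columns: every path of the clique contains one of the intervals and
touches the next one. To see this, consider two paths that run along a common row without meeting
there: they share an edge of their second row, and every other path uses one of the two rows. If
this happens in a cycle of three rows, then one clique suffices, with one interval per row.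
Otherwise all paths use one of two columns, or one of two rows on which a Helly theorem for two
lines applies, so that the paths through two suitable columns or positions cover them. All intervals
start and end next to coordinates of the input, so there are only polynomially many pairs of such
cliques, and the program tries all of them.

The graph on the union of two cliques is the complement of a bipartite graph, so it remains to find
a maximum independent set there. In an auction, the vertices on one side bid in unit steps for their
neighbours on the other side, until each of them owns something or finds everything too expensive.
There are at most `n` owned vertices but `n + 1` possible positive prices, so some price does not
occur; the vertices below this price and those on the other side that own none of them are
independent and as many as all vertices without the owned ones, which no independent set exceeds.
-/

namespace EPG

/-! ### Polygonal lines -/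

/-- The grid edge between `(x, y)` and `(x + 1, y)`. -/
def hEdge (x y : ℤ) : Sym2 (ℤ × ℤ) := s((x, y), (x + 1, y))

/-- The grid edge between `(x, y)` and `(x, y + 1)`. -/
def vEdge (x y : ℤ) : Sym2 (ℤ × ℤ) := s((x, y), (x, y + 1))

theorem grid_adj_iff {p q : ℤ × ℤ} : grid.Adj p q ↔
    (p.1 = q.1 ∧ (p.2 = q.2 + 1 ∨ q.2 = p.2 + 1)) ∨
      (p.2 = q.2 ∧ (p.1 = q.1 + 1 ∨ q.1 = p.1 + 1)) := by
  simp only [grid, abs_eq (zero_le_one' ℤ)]; omega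

theorem mem_edgeSet_grid_iff {e : Sym2 (ℤ × ℤ)} :
    e ∈ grid.edgeSet ↔ ∃ x y, e = hEdge x y ∨ e = vEdge x y := by
  constructor
  · induction e with | _ p q
    obtain ⟨x, y⟩ := p
    obtain ⟨x', y'⟩ := q
    simp only [SimpleGraph.mem_edgeSet, grid_adj_iff, hEdge, vEdge, Sym2.eq_iff, Prod.mk.injEq]
    rintro (⟨rfl, rfl | rfl⟩ | ⟨rfl, rfl | rfl⟩)
    · exact ⟨x, y', by simp⟩
    · exact ⟨x, y, by simp⟩
    · exact ⟨x', y, by simp⟩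
    · exact ⟨x, y, by simp⟩
  · rintro ⟨x, y, rfl | rfl⟩ <;>
      simp [hEdge, vEdge, SimpleGraph.mem_edgeSet, grid_adj_iff]

/-- The grid edges inside the bounding box of two points, which for two points on a common row or
column are the edges of the segment between them. -/
def seg (p q : ℤ × ℤ) : Set (Sym2 (ℤ × ℤ)) :=
  {e | e ∈ grid.edgeSet ∧ ∀ r ∈ e, r ∈ Set.uIcc p q}

theorem hEdge_mem_seg {p q : ℤ × ℤ} {x y : ℤ} : hEdge x y ∈ seg p q ↔
    (min p.1 q.1 ≤ x ∧ x < max p.1 q.1) ∧ min p.2 q.2 ≤ y ∧ y ≤ max p.2 q.2 := by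
  have : hEdge x y ∈ grid.edgeSet := mem_edgeSet_grid_iff.2 ⟨x, y, .inl rfl⟩
  simp only [seg, Set.mem_ofPred_eq, this, true_and]
  simp only [hEdge, Sym2.mem_iff, forall_eq_or_imp, forall_eq, Set.uIcc, Set.mem_Icc, Prod.le_def,
    Prod.fst_inf, Prod.snd_inf, Prod.fst_sup, Prod.snd_sup]
  omega

theorem vEdge_mem_seg {p q : ℤ × ℤ} {x y : ℤ} : vEdge x y ∈ seg p q ↔
    (min p.1 q.1 ≤ x ∧ x ≤ max p.1 q.1) ∧ min p.2 q.2 ≤ y ∧ y < max p.2 q.2 := by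
  have : vEdge x y ∈ grid.edgeSet := mem_edgeSet_grid_iff.2 ⟨x, y, .inr rfl⟩
  simp only [seg, Set.mem_ofPred_eq, this, true_and]
  simp only [vEdge, Sym2.mem_iff, forall_eq_or_imp, forall_eq, Set.uIcc, Set.mem_Icc, Prod.le_def,
    Prod.fst_inf, Prod.snd_inf, Prod.fst_sup, Prod.snd_sup]
  omega

theorem seg_self (p : ℤ × ℤ) : seg p p = ∅ := by
  refine Set.eq_empty_of_forall_notMem fun e he => ?_
  obtain ⟨x, y, rfl | rfl⟩ := mem_edgeSet_grid_iff.1 he.1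
  · have := hEdge_mem_seg.1 he
    omega
  · have := vEdge_mem_seg.1 he
    omega

/-- The points lie on a common row or on a common column. -/
def Collinear (p q r : ℤ × ℤ) : Prop :=
  (p.1 = q.1 ∧ q.1 = r.1) ∨ (p.2 = q.2 ∧ q.2 = r.2)

theorem bendPoints_of_collinear {p q r : ℤ × ℤ} (h : Collinear p q r) (l : List (ℤ × ℤ)) :
    bendPoints (p :: q :: r :: l) = bendPoints (q :: r :: l) := by
  rw [bendPoints]
  exact if_pos h

theorem bendPoints_of_not_collinear {p q r : ℤ × ℤ} (h : ¬ Collinear p q r) (l : List (ℤ × ℤ)) :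
    bendPoints (p :: q :: r :: l) = q :: bendPoints (q :: r :: l) := by
  rw [bendPoints]
  exact if_neg h

theorem seg_eq_insert {p q r : ℤ × ℤ} (hpq : grid.Adj p q) (hc : Collinear p q r)
    (hq : q ∈ Set.uIcc p r) : seg p r = insert s(p, q) (seg q r) := by
  obtain ⟨x, y⟩ := p
  obtain ⟨x', y'⟩ := q
  obtain ⟨x'', y''⟩ := r
  ext e
  rw [Set.mem_insert_iff]
  by_cases he : e ∈ grid.edgeSet
  · simp only [Collinear, Set.uIcc, Set.mem_Icc, Prod.le_def, Prod.fst_inf, Prod.snd_inf,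
      Prod.fst_sup, Prod.snd_sup, grid_adj_iff] at hc hq hpq
    obtain ⟨z, w, rfl | rfl⟩ := mem_edgeSet_grid_iff.1 he
    · rw [hEdge_mem_seg, hEdge_mem_seg]
      simp only [hEdge, Sym2.eq_iff, Prod.mk.injEq]
      rcases hpq with ⟨rfl, rfl | rfl⟩ | ⟨rfl, rfl | rfl⟩ <;> omega
    · rw [vEdge_mem_seg, vEdge_mem_seg]
      simp only [vEdge, Sym2.eq_iff, Prod.mk.injEq]
      rcases hpq with ⟨rfl, rfl | rfl⟩ | ⟨rfl, rfl | rfl⟩ <;> omega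
  · have hne : e ≠ s((x, y), (x', y')) := fun h => he (h ▸ hpq)
    simp only [seg, Set.mem_ofPred_eq, he, hne, false_and, or_self]

theorem seg_eq_singleton {p q : ℤ × ℤ} (hpq : grid.Adj p q) : seg p q = {s(p, q)} := by
  have hc : Collinear p q q := by
    rw [grid_adj_iff] at hpq
    exact hpq.imp (fun h => ⟨h.1, rfl⟩) fun h => ⟨h.1, rfl⟩
  rw [seg_eq_insert hpq hc Set.right_mem_uIcc, seg_self, insert_empty_eq]

/-- `Axis true p q`: the points are distinct and on a common row; `Axis false p q`: they are
distinct and on a common column. -/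
def Axis : Bool → ℤ × ℤ → ℤ × ℤ → Prop
  | true, p, q => p.2 = q.2 ∧ p.1 ≠ q.1
  | false, p, q => p.1 = q.1 ∧ p.2 ≠ q.2

/-- The polygonal line through the list runs alternately along rows and columns, starting along a
row exactly when the Boolean is `true`. -/
def Alternates : Bool → List (ℤ × ℤ) → Prop
  | h, p :: q :: l => Axis h p q ∧ Alternates (!h) (q :: l)
  | _, _ => True

/-- The grid edges of the polygonal line through a list of points. -/
def edgesOf : List (ℤ × ℤ) → Set (Sym2 (ℤ × ℤ))
  | p :: q :: l => seg p q ∪ edgesOf (q :: l)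
  | _ => ∅

theorem Alternates.straight {h : Bool} {o p q r : ℤ × ℤ} {l : List (ℤ × ℤ)}
    (hl : Alternates h (p :: r :: l)) (hop : grid.Adj o p) (hpq : grid.Adj p q) (hoq : o ≠ q)
    (hc : Collinear o p q) (hq : q ∈ Set.uIcc p r) :
    Alternates h (o :: r :: l) ∧ p ∈ Set.uIcc o r ∧
      edgesOf (o :: r :: l) = insert s(o, p) (edgesOf (p :: r :: l)) := by
  obtain ⟨hpr, hl⟩ := hl
  obtain ⟨hor, hc', hp⟩ : Axis h o r ∧ Collinear o p r ∧ p ∈ Set.uIcc o r := by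
    obtain ⟨x, y⟩ := o
    simp only [ne_eq, Prod.ext_iff] at hoq
    simp only [Collinear, Set.uIcc, Set.mem_Icc, Prod.le_def, Prod.fst_inf, Prod.snd_inf,
      Prod.fst_sup, Prod.snd_sup, grid_adj_iff] at *
    cases h <;> simp only [Axis] at * <;> omega
  refine ⟨⟨hor, hl⟩, hp, ?_⟩
  rw [edgesOf, edgesOf, seg_eq_insert hop hc' hp, Set.insert_union]

theorem Alternates.turn {h : Bool} {o p q r : ℤ × ℤ} {l : List (ℤ × ℤ)}
    (hl : Alternates h (p :: r :: l)) (hop : grid.Adj o p) (hpq : grid.Adj p q)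
    (hc : ¬ Collinear o p q) (hq : q ∈ Set.uIcc p r) :
    Alternates (!h) (o :: p :: r :: l) ∧
      edgesOf (o :: p :: r :: l) = insert s(o, p) (edgesOf (p :: r :: l)) := by
  refine ⟨⟨?_, by simpa only [Bool.not_not] using hl⟩, ?_⟩
  · obtain ⟨hpr, -⟩ := hl
    simp only [Collinear, Set.uIcc, Set.mem_Icc, Prod.le_def, Prod.fst_inf, Prod.snd_inf,
      Prod.fst_sup, Prod.snd_sup, grid_adj_iff] at *
    cases h <;> simp only [Axis, Bool.not_true, Bool.not_false] at * <;> omega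
  · rw [edgesOf, seg_eq_singleton hop, Set.singleton_union]

theorem exists_alternates {u v : ℤ × ℤ} (w : grid.Walk u v) (hw : w.IsPath) (hn : ¬ w.Nil) :
    ∃ h r l, bendPoints w.support ++ [v] = r :: l ∧ Alternates h (u :: r :: l) ∧
      w.snd ∈ Set.uIcc u r ∧ {e | e ∈ w.edges} = edgesOf (u :: r :: l) := by
  induction w with
  | nil => simp at hn
  | @cons o p v hop w ih =>
    cases w with
    | nil =>
      have hp : ∃ h, Axis h o p := by
        simp only [Bool.exists_bool, Axis]
        have := grid_adj_iff.1 hop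
        omega
      exact hp.imp fun h hp => ⟨p, [], rfl, ⟨hp, trivial⟩, Set.right_mem_uIcc, by
        simp [edgesOf, seg_eq_singleton hop]⟩
    | @cons _ q _ hpq w =>
      obtain ⟨h, r, l, hl, ha, hq, hE⟩ := ih hw.of_cons SimpleGraph.Walk.not_nil_cons
      have hoq : o ≠ q := by
        rintro rfl
        simp [SimpleGraph.Walk.isPath_def] at hw
      obtain ⟨m, hm⟩ : ∃ m, w.support = q :: m := ⟨_, w.cons_tail_support.symm⟩
      have hcons : {e | e ∈ ((w.cons hpq).cons hop).edges} =
          insert s(o, p) {e | e ∈ (w.cons hpq).edges} := by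
        ext e
        simp
      simp only [SimpleGraph.Walk.support_cons, hm] at hl ⊢
      rw [hcons, hE]
      rw [SimpleGraph.Walk.snd_cons] at hq ⊢
      by_cases hc : Collinear o p q
      · obtain ⟨ha, hp, hE⟩ := ha.straight hop hpq hoq hc hq
        exact ⟨h, r, l, by rwa [bendPoints_of_collinear hc], ha, hp, hE.symm⟩
      · obtain ⟨ha, hE⟩ := ha.turn hop hpq hc hq
        exact ⟨!h, p, r :: l, by rw [bendPoints_of_not_collinear hc, List.cons_append, hl], ha,
          Set.right_mem_uIcc, hE.symm⟩

/-- The rows that contain an edge of the set. -/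
def rowsOf (E : Set (Sym2 (ℤ × ℤ))) : Set ℤ := {a | ∃ e ∈ E, ∀ p ∈ e, p.2 = a}

theorem rowsOf_empty : rowsOf ∅ = ∅ := by
  simp [rowsOf]

theorem rowsOf_union (E F : Set (Sym2 (ℤ × ℤ))) : rowsOf (E ∪ F) = rowsOf E ∪ rowsOf F := by
  ext a
  simp only [rowsOf, Set.mem_union, or_and_right, exists_or, Set.mem_ofPred_eq]

theorem rowsOf_seg_of_axis_false {p q : ℤ × ℤ} (h : Axis false p q) :
    rowsOf (seg p q) = ∅ := by
  refine Set.eq_empty_of_forall_notMem ?_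
  rintro a ⟨e, he, ha⟩
  obtain ⟨h, -⟩ := h
  obtain ⟨x, y, rfl | rfl⟩ := mem_edgeSet_grid_iff.1 he.1
  · have := hEdge_mem_seg.1 he
    omega
  · have hl := ha _ (Sym2.mem_mk_left _ _)
    have hr := ha _ (Sym2.mem_mk_right _ _)
    simp only at hl hr
    omega

theorem rowsOf_seg_of_axis_true {p q : ℤ × ℤ} (h : Axis true p q) :
    rowsOf (seg p q) ⊆ {p.2} := by
  rintro a ⟨e, he, ha⟩
  have ha := ha _ e.out_fst_mem
  have he := he.2 _ e.out_fst_mem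
  simp only [Set.uIcc, Set.mem_Icc, Prod.le_def, Prod.snd_inf, Prod.snd_sup, ← h.1,
    min_self, max_self] at he
  exact ha.symm.trans (le_antisymm he.2.2 he.1.2)

theorem Axis.rowsOf_seg_subset_right {h : Bool} {p q : ℤ × ℤ} (hpq : Axis h p q) :
    rowsOf (seg p q) ⊆ {q.2} := by
  cases h
  · exact (rowsOf_seg_of_axis_false hpq).subset.trans (Set.empty_subset _)
  · exact hpq.1 ▸ rowsOf_seg_of_axis_true hpq

theorem Axis.rowsOf_seg_subset_left {h : Bool} {p q : ℤ × ℤ} (hpq : Axis h p q) :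
    rowsOf (seg p q) ⊆ {p.2} := by
  cases h
  · exact (rowsOf_seg_of_axis_false hpq).subset.trans (Set.empty_subset _)
  · exact rowsOf_seg_of_axis_true hpq

/-- The data of a path with three segments, the first and the last of which are horizontal: it runs
from `(e, a)` over `(c, a)` and `(c, b)` to `(f, b)`. -/
structure ZShape where
  e : ℤ
  c : ℤ
  f : ℤ
  a : ℤ
  b : ℤ
  he : e ≠ c
  hf : c ≠ f
  hab : a ≠ b

namespace ZShape

/-- The ends and the bends of the path, in their order along the path. -/
def corners (z : ZShape) : List (ℤ × ℤ) := [(z.e, z.a), (z.c, z.a), (z.c, z.b), (z.f, z.b)]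

/-- The grid edges of the path. -/
def edges (z : ZShape) : Set (Sym2 (ℤ × ℤ)) := edgesOf z.corners

end ZShape

theorem Alternates.exists_zShape {h : Bool} {C : List (ℤ × ℤ)} (hC : Alternates h C)
    (hlen : C.length ≤ 4) (hrows : (rowsOf (edgesOf C)).ncard = 2) :
    ∃ z : ZShape, C = z.corners := by
  have not_subset : ∀ a, ¬ rowsOf (edgesOf C) ⊆ {a} := fun a ha => by
    have := Set.ncard_le_ncard ha
    rw [hrows, Set.ncard_singleton] at this
    omega
  match C, h, hC with
  | [], _, _ | [_], _, _ => exact (not_subset 0 (by simp [edgesOf, rowsOf_empty])).elim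
  | [p, q], _, ⟨hpq, _⟩ =>
    refine (not_subset q.2 ?_).elim
    simpa [edgesOf] using hpq.rowsOf_seg_subset_right
  | [p, q, r], _, ⟨hpq, hqr, _⟩ =>
    refine (not_subset q.2 ?_).elim
    simpa only [edgesOf, Set.union_empty, rowsOf_union] using
      Set.union_subset hpq.rowsOf_seg_subset_right hqr.rowsOf_seg_subset_left
  | [p, q, r, s], false, ⟨hpq, hqr, hrs, _⟩ =>
    refine (not_subset q.2 ?_).elim
    simpa only [edgesOf, Set.union_empty, rowsOf_union, rowsOf_seg_of_axis_false hrs] using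
      Set.union_subset hpq.rowsOf_seg_subset_right hqr.rowsOf_seg_subset_left
  | [p, q, r, s], true, ⟨hpq, hqr, hrs, _⟩ =>
    obtain ⟨e, a⟩ := p
    obtain ⟨c, a'⟩ := q
    obtain ⟨c', b⟩ := r
    obtain ⟨f, b'⟩ := s
    obtain ⟨rfl, he⟩ := hpq
    obtain ⟨rfl, hab⟩ := hqr
    obtain ⟨rfl, hf⟩ := hrs
    exact ⟨⟨e, c, f, a, b, he, hf, hab⟩, rfl⟩
  | _ :: _ :: _ :: _ :: _ :: _, _, _ =>
    simp only [List.length_cons] at hlen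
    omega

theorem GridPath.exists_zShape (P : GridPath) (hb : P.numBends ≤ 2) (hrows : P.rows.ncard = 2) :
    ∃ z : ZShape, P.corners = z.corners ∧ {e | e ∈ P.walk.edges} = z.edges := by
  have hn : ¬ P.walk.Nil := fun hn => by
    have : P.rows = ∅ := by
      simp [GridPath.rows, SimpleGraph.Walk.edges_eq_nil.2 hn]
    simp [this] at hrows
  obtain ⟨h, r, l, hl, hC, -, hE⟩ := exists_alternates P.walk P.isPath hn
  have hlen : (r :: l).length ≤ 3 := by
    rw [← hl]
    simpa [GridPath.numBends] using Nat.succ_le_succ hb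
  have hcorners : P.corners = P.src :: r :: l := by
    rw [GridPath.corners, hl]
  obtain ⟨z, hz⟩ := hC.exists_zShape (Nat.succ_le_succ hlen) (hE ▸ hrows)
  exact ⟨z, hcorners.trans hz, hE.trans (congrArg edgesOf hz)⟩

namespace ZShape

/-- Two nondegenerate segments on a line overlap. -/
def Ov (p q p' q' : ℤ) : Prop := min p q < max p' q' ∧ min p' q' < max p q

/-- Two paths share a grid edge. -/
def Share (u v : ZShape) : Prop := (u.edges ∩ v.edges).Nonempty

/-- The path has its first or its last segment on the row `r`. -/
def Has (z : ZShape) (r : ℤ) : Prop := r = z.a ∨ r = z.b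

instance (z : ZShape) (r : ℤ) : Decidable (z.Has r) := inferInstanceAs (Decidable (_ ∨ _))

/-- The end of the path on a row `r` that the path has. -/
def tip (z : ZShape) (r : ℤ) : ℤ := if r = z.a then z.e else z.f

theorem tip_a (z : ZShape) : z.tip z.a = z.e := if_pos rfl

theorem tip_b (z : ZShape) : z.tip z.b = z.f := if_neg z.hab.symm

theorem tip_ne_c (z : ZShape) (r : ℤ) : z.tip r ≠ z.c := by
  unfold tip
  split_ifs
  exacts [z.he, z.hf.symm]

theorem hEdge_mem_edges {z : ZShape} {x y : ℤ} : hEdge x y ∈ z.edges ↔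
    z.Has y ∧ min (z.tip y) z.c ≤ x ∧ x < max (z.tip y) z.c := by
  have hab := z.hab
  simp only [edges, corners, edgesOf, Set.union_empty, Set.mem_union, hEdge_mem_seg, Has, tip]
  split_ifs <;> omega

theorem vEdge_mem_edges {z : ZShape} {x y : ℤ} : vEdge x y ∈ z.edges ↔
    x = z.c ∧ min z.a z.b ≤ y ∧ y < max z.a z.b := by
  simp only [edges, corners, edgesOf, Set.union_empty, Set.mem_union, vEdge_mem_seg]
  omega

theorem edges_subset (z : ZShape) : z.edges ⊆ grid.edgeSet := by
  simp only [edges, corners, edgesOf, Set.union_empty, Set.union_subset_iff]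
  exact ⟨fun _ h => h.1, fun _ h => h.1, fun _ h => h.1⟩

theorem share_iff {u v : ZShape} : Share u v ↔
    (∃ r, u.Has r ∧ v.Has r ∧ Ov (u.tip r) u.c (v.tip r) v.c) ∨
      (u.c = v.c ∧ Ov u.a u.b v.a v.b) := by
  constructor
  · rintro ⟨e, hu, hv⟩
    obtain ⟨x, y, rfl | rfl⟩ := mem_edgeSet_grid_iff.1 (u.edges_subset hu)
    · rw [hEdge_mem_edges] at hu hv
      exact .inl ⟨y, hu.1, hv.1, by unfold Ov; omega⟩
    · rw [vEdge_mem_edges] at hu hv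
      exact .inr ⟨by omega, by unfold Ov; omega⟩
  · rintro (⟨r, hu, hv, h⟩ | ⟨hc, h⟩)
    · have hu' := u.tip_ne_c r
      have hv' := v.tip_ne_c r
      unfold Ov at h
      exact ⟨hEdge (max (min (u.tip r) u.c) (min (v.tip r) v.c)) r,
        hEdge_mem_edges.2 ⟨hu, by omega⟩, hEdge_mem_edges.2 ⟨hv, by omega⟩⟩
    · have hu' := u.hab
      have hv' := v.hab
      unfold Ov at h
      exact ⟨vEdge u.c (max (min u.a u.b) (min v.a v.b)),
        vEdge_mem_edges.2 (by omega), vEdge_mem_edges.2 (by omega)⟩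

end ZShape

/-! ### A Helly theorem for two lines -/

section Intervals

variable {ι α β : Type*} [LinearOrder α] [LinearOrder β]

/-- The intervals `[l i, h i]` and `[l j, h j]` meet, if both are nonempty. -/
def Meets (l h : ι → α) (i j : ι) : Prop := l i ≤ h j ∧ l j ≤ h i

theorem Meets.symm {l h : ι → α} {i j : ι} (hij : Meets l h i j) : Meets l h j i := And.symm hij

theorem exists_common_point [Nonempty α] {S : Finset ι} {l h : ι → α}
    (hS : ∀ i ∈ S, ∀ j ∈ S, Meets l h i j) : ∃ p, ∀ i ∈ S, p ∈ Set.Icc (l i) (h i) := by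
  rcases S.eq_empty_or_nonempty with rfl | hne
  · simp
  · obtain ⟨m, hm, hmax⟩ := S.exists_max_image l hne
    exact ⟨l m, fun i hi => ⟨hmax i hi, (hS m hm i hi).1⟩⟩

/-- Among the pairs of `X` that do not meet on the second track, take one for which the larger of
the two right ends on the first track is smallest. The point is this right end, or the smallest
right end of a member of `A` if that is smaller: two members of `X` that miss the point and do not
meet on the second track would both lie to the right of the chosen pair on the first track, so each
of them would bridge the gap of the chosen pair on the second track. -/
theorem exists_splitting_point [Nonempty α] {A X : Finset ι} {l h : ι → α} {l' h' : ι → β}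
    (hAA : ∀ i ∈ A, ∀ j ∈ A, Meets l h i j) (hAX : ∀ i ∈ A, ∀ j ∈ X, Meets l h i j)
    (hXX : ∀ i ∈ X, ∀ j ∈ X, Meets l h i j ∨ Meets l' h' i j) :
    ∃ p, (∀ i ∈ A, p ∈ Set.Icc (l i) (h i)) ∧ ∀ i ∈ X, ∀ j ∈ X,
      p ∉ Set.Icc (l i) (h i) → p ∉ Set.Icc (l j) (h j) → Meets l' h' i j := by
  classical
  by_cases hall : ∀ i ∈ X, ∀ j ∈ X, Meets l' h' i j
  · obtain ⟨p, hp⟩ := exists_common_point hAA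
    exact ⟨p, hp, fun i hi j hj _ _ => hall i hi j hj⟩
  obtain ⟨⟨u, v⟩, huv, hmin⟩ := ((X ×ˢ X).filter fun x => ¬ Meets l' h' x.1 x.2).exists_min_image
    (fun x => max (h x.1) (h x.2)) (by
      push Not at hall
      obtain ⟨i, hi, j, hj, hij⟩ := hall
      exact ⟨(i, j), by simp [hi, hj, hij]⟩)
  simp only [Finset.mem_filter, Finset.mem_product, Prod.forall, and_imp] at huv hmin
  obtain ⟨⟨hu, hv⟩, huv⟩ := huv
  simp only [Set.mem_Icc, not_and_or, not_le]
  by_cases hA : ∃ a ∈ A, h a < max (h u) (h v)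
  · obtain ⟨a₀, ha₀, hlt⟩ := hA
    obtain ⟨a, ha, hamin⟩ := A.exists_min_image h ⟨a₀, ha₀⟩
    refine ⟨h a, fun i hi => ⟨(hAA i hi a ha).1, hamin i hi⟩, fun i hi j hj hpi hpj => ?_⟩
    have hi_lt : h i < h a := hpi.resolve_left (hAX a ha i hi).2.not_gt
    have hj_lt : h j < h a := hpj.resolve_left (hAX a ha j hj).2.not_gt
    by_contra hij
    exact ((max_lt hi_lt hj_lt).trans_le (hamin a₀ ha₀)).not_ge
      (hlt.le.trans (hmin i j hi hj hij))
  · push Not at hA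
    refine ⟨max (h u) (h v), fun i hi => ⟨le_max_of_le_left (hAX i hi u hu).1, hA i hi⟩,
      fun i hi j hj hpi hpj => ?_⟩
    by_contra hij
    have hright : max (h u) (h v) < l i ∧ max (h u) (h v) < l j := by
      have := hmin i j hi hj hij
      have := (hXX i hi j hj).resolve_right hij
      unfold Meets at this
      grind
    have hbridge : ∀ k ∈ X, max (h u) (h v) < l k → Meets l' h' k u ∧ Meets l' h' k v :=
      fun k hk hlt => ⟨(hXX k hk u hu).resolve_left fun hku =>
        ((le_max_left _ _).trans_lt hlt).not_ge hku.1,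
        (hXX k hk v hv).resolve_left fun hkv => ((le_max_right _ _).trans_lt hlt).not_ge hkv.1⟩
    have hi_bridge := hbridge i hi hright.1
    have hj_bridge := hbridge j hj hright.2
    unfold Meets at *
    grind

/-- Each `i` stands for an interval on the first track if `P i` and for an interval on the second
track if `Q i`. -/
theorem exists_two_points [Nonempty α] [Nonempty β] {K : Finset ι} {P Q : ι → Prop}
    {l h : ι → α} {l' h' : ι → β}
    (hPQ : ∀ i ∈ K, P i ∨ Q i)
    (hP : ∀ i ∈ K, ∀ j ∈ K, P i → P j → ¬ Q i → Meets l h i j)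
    (hQ : ∀ i ∈ K, ∀ j ∈ K, Q i → Q j → ¬ P i → Meets l' h' i j)
    (hboth : ∀ i ∈ K, ∀ j ∈ K, P i → Q i → P j → Q j → Meets l h i j ∨ Meets l' h' i j) :
    ∃ p q, ∀ i ∈ K, (P i ∧ p ∈ Set.Icc (l i) (h i)) ∨ (Q i ∧ q ∈ Set.Icc (l' i) (h' i)) := by
  classical
  obtain ⟨p, hpA, hpX⟩ := exists_splitting_point (A := K.filter fun i => ¬ Q i)
    (X := K.filter fun i => P i ∧ Q i) (l := l) (h := h) (l' := l')
    (h' := h')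
    (by grind) (by grind) (by grind)
  obtain ⟨q, hq⟩ := exists_common_point
    (S := K.filter fun i => Q i ∧ (P i → p ∉ Set.Icc (l i) (h i))) (l := l') (h := h') (by
      intro i hi j hj
      rw [Finset.mem_filter] at hi hj
      by_cases hPi : P i
      · by_cases hPj : P j
        · exact hpX i (by grind) j (by grind) (hi.2.2 hPi) (hj.2.2 hPj)
        · exact (hQ j hj.1 i hi.1 hj.2.1 hi.2.1 hPj).symm
      · exact hQ i hi.1 j hj.1 hi.2.1 hj.2.1 hPi)
  refine ⟨p, q, fun i hi => ?_⟩
  by_cases hQi : Q i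
  · by_cases hp : P i ∧ p ∈ Set.Icc (l i) (h i)
    · exact .inl hp
    · exact .inr ⟨hQi, hq i (Finset.mem_filter.2 ⟨hi, hQi, not_and.1 hp⟩)⟩
  · exact .inl ⟨(hPQ i hi).resolve_right hQi, hpA i (Finset.mem_filter.2 ⟨hi, hQi⟩)⟩

end Intervals

/-! ### Covering a clique by two cliques -/

namespace ZShape

/-- The first position of the path on the row `r`. The edge from column `x` to column `x + 1` has
position `2 * x + 1`, and the bend in column `c` has position `2 * c`. -/
def lo (z : ZShape) (r : ℤ) : ℤ := min (2 * z.c) (2 * z.tip r + 1)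

/-- The last position of the path on the row `r`, counted as in `lo`. -/
def hi (z : ZShape) (r : ℤ) : ℤ := max (2 * z.c) (2 * z.tip r - 1)

/-- The paths have a common position on the row `r`, which may be a common bend. -/
def MeetOn (r : ℤ) (u v : ZShape) : Prop :=
  u.Has r ∧ v.Has r ∧ Meets (fun z : ZShape => z.lo r) (fun z => z.hi r) u v

theorem meetOn_iff {r : ℤ} {u v : ZShape} : MeetOn r u v ↔
    u.Has r ∧ v.Has r ∧ u.lo r ≤ v.hi r ∧ v.lo r ≤ u.hi r :=
  Iff.rfl

theorem meetOn_iff_ov {r : ℤ} {u v : ZShape} (hc : u.c ≠ v.c) :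
    MeetOn r u v ↔ u.Has r ∧ v.Has r ∧ Ov (u.tip r) u.c (v.tip r) v.c := by
  have hu := u.tip_ne_c r
  have hv := v.tip_ne_c r
  rw [meetOn_iff]
  refine and_congr_right fun _ => and_congr_right fun _ => ?_
  unfold lo hi Ov
  omega

theorem share_iff_meetOn {u v : ZShape} (hc : u.c ≠ v.c) : Share u v ↔ ∃ r, MeetOn r u v := by
  simp only [share_iff, meetOn_iff_ov hc, hc, false_and, or_false]

theorem meetOn_of_c_eq {r : ℤ} {u v : ZShape} (hc : u.c = v.c) (hu : u.Has r) (hv : v.Has r) :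
    MeetOn r u v :=
  meetOn_iff.2 ⟨hu, hv, by unfold lo hi; omega, by unfold lo hi; omega⟩

theorem Share.symm {u v : ZShape} (h : Share u v) : Share v u := by
  rwa [Share, Set.inter_comm]

theorem Share.exists_meetOn {u v : ZShape} (h : Share u v) {r : ℤ} (hu : u.Has r) (hv : v.Has r) :
    ∃ s, MeetOn s u v := by
  by_cases hc : u.c = v.c
  · exact ⟨r, meetOn_of_c_eq hc hu hv⟩
  · exact (share_iff_meetOn hc).1 h

/-- The two rows of the path are `p` and `q`. -/
def HasRows (z : ZShape) (p q : ℤ) : Prop := z.Has p ∧ z.Has q ∧ p ≠ q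

theorem hasRows_a_b (z : ZShape) : z.HasRows z.a z.b := ⟨.inl rfl, .inr rfl, z.hab⟩

theorem HasRows.symm {z : ZShape} {p q : ℤ} (h : z.HasRows p q) : z.HasRows q p :=
  ⟨h.2.1, h.1, h.2.2.symm⟩

theorem HasRows.has_iff {z : ZShape} {p q r : ℤ} (h : z.HasRows p q) :
    z.Has r ↔ r = p ∨ r = q := by
  unfold HasRows Has at *
  omega

theorem HasRows.min_eq {z : ZShape} {p q : ℤ} (h : z.HasRows p q) : min z.a z.b = min p q := by
  unfold HasRows Has at *
  omega

theorem HasRows.max_eq {z : ZShape} {p q : ℤ} (h : z.HasRows p q) : max z.a z.b = max p q := by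
  unfold HasRows Has at *
  omega

theorem HasRows.ov_iff {u v : ZShape} {p q s t : ℤ} (hu : u.HasRows p q) (hv : v.HasRows s t) :
    Ov u.a u.b v.a v.b ↔ Ov p q s t := by
  rw [Ov, hu.min_eq, hu.max_eq, hv.min_eq, hv.max_eq, Ov]

theorem Has.exists_hasRows {z : ZShape} {r : ℤ} (h : z.Has r) : ∃ s, z.HasRows r s := by
  rcases h with rfl | rfl
  exacts [⟨z.b, z.hasRows_a_b⟩, ⟨z.a, z.hasRows_a_b.symm⟩]

theorem Share.meetOn_of_not_has {u v : ZShape} (h : Share u v) {r s : ℤ} (hu : u.Has r)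
    (hv : v.HasRows r s) (hus : ¬ u.Has s) : MeetOn r u v := by
  obtain ⟨t, ht⟩ := h.exists_meetOn hu hv.1
  rcases hv.has_iff.1 ht.2.1 with rfl | rfl
  exacts [ht, (hus ht.1).elim]

/-- A coordinate of an end or of a bend of the path. -/
def IsCoord (z : ZShape) (x : ℤ) : Prop := x = z.e ∨ x = z.c ∨ x = z.f ∨ x = z.a ∨ x = z.b

/-- The coordinates of the ends and bends of the paths of `K`. -/
def coords (K : Finset ZShape) : Set ℤ := {x | ∃ z ∈ K, z.IsCoord x}

theorem c_mem_coords {K : Finset ZShape} {z : ZShape} (hz : z ∈ K) : z.c ∈ coords K :=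
  ⟨z, hz, .inr (.inl rfl)⟩

theorem tip_mem_coords {K : Finset ZShape} {z : ZShape} (hz : z ∈ K) (r : ℤ) : z.tip r ∈ coords K :=
  ⟨z, hz, by unfold IsCoord tip; split_ifs <;> simp⟩

theorem Has.mem_coords {K : Finset ZShape} {z : ZShape} {r : ℤ} (h : z.Has r) (hz : z ∈ K) :
    r ∈ coords K :=
  ⟨z, hz, by unfold IsCoord; unfold Has at h; omega⟩

/-- The path runs along the row (`k = 0`) or the column (`k ≠ 0`) with the number `r / 2`, starts
there at position `α` or before and ends at position `β` or later. -/
def Spans (k r α β : ℤ) (z : ZShape) : Prop :=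
  (k = 0 ∧ ∃ s, 2 * s = r ∧ z.Has s ∧ z.lo s ≤ α ∧ β ≤ z.hi s) ∨
    (k ≠ 0 ∧ 2 * z.c = r ∧ 2 * min z.a z.b ≤ α ∧ β ≤ 2 * max z.a z.b)

end ZShape

open ZShape

/-- An interval `[α, β]` of positions on the row (`k = 0`) or column (`k ≠ 0`) number `r / 2`. -/
structure Track where
  k : ℤ
  r : ℤ
  α : ℤ
  β : ℤ

namespace Track

/-- An interval on the row number `r`. -/
def row (r α β : ℤ) : Track := ⟨0, 2 * r, α, β⟩

/-- An interval on the column number `c`. -/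
def column (c α β : ℤ) : Track := ⟨1, 2 * c, α, β⟩

/-- The path contains the interval. -/
def ContainedIn (T : Track) (z : ZShape) : Prop := z.Spans T.k T.r T.α T.β

/-- The path has a position in the interval, if the interval is nonempty. -/
def Touches (T : Track) (z : ZShape) : Prop := z.Spans T.k T.r T.β T.α

theorem row_containedIn_iff {r α β : ℤ} {z : ZShape} :
    (row r α β).ContainedIn z ↔ z.Has r ∧ z.lo r ≤ α ∧ β ≤ z.hi r := by
  simp [ContainedIn, row, Spans]

theorem row_touches_iff {r α β : ℤ} {z : ZShape} :
    (row r α β).Touches z ↔ z.Has r ∧ z.lo r ≤ β ∧ α ≤ z.hi r := by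
  simp [Touches, row, Spans]

/-- The interval consists of the single grid edge `e`. -/
def Represents (T : Track) (e : Sym2 (ℤ × ℤ)) : Prop :=
  ∀ z : ZShape, (T.ContainedIn z ↔ e ∈ z.edges) ∧ (T.Touches z ↔ e ∈ z.edges)

theorem represents_hEdge (x y : ℤ) : (row y (2 * x + 1) (2 * x + 1)).Represents (hEdge x y) := by
  intro z
  have := z.tip_ne_c y
  rw [row_containedIn_iff, row_touches_iff, and_self_iff, hEdge_mem_edges]
  refine and_congr_right fun _ => ?_
  unfold lo hi
  omega

theorem represents_vEdge (x y : ℤ) :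
    (column x (2 * y + 1) (2 * y + 1)).Represents (vEdge x y) := by
  intro z
  simp only [ContainedIn, Touches, column, Spans, vEdge_mem_edges]
  omega

/-- The paths that contain one of three intervals and touch the next one, in cyclic order. -/
def Cand (T₁ T₂ T₃ : Track) (z : ZShape) : Prop :=
  (T₁.ContainedIn z ∧ T₂.Touches z) ∨ (T₂.ContainedIn z ∧ T₃.Touches z) ∨
    (T₃.ContainedIn z ∧ T₁.Touches z)

variable {K : Finset ZShape} {P Q : ZShape → Prop}

/-- The number is a position next to a coordinate of `K`. -/
def IsVal (K : Finset ZShape) (t : ℤ) : Prop := ∃ x ∈ coords K, 2 * x - 1 ≤ t ∧ t ≤ 2 * x + 1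

theorem isVal_two_mul {x : ℤ} (hx : x ∈ coords K) : IsVal K (2 * x) := ⟨x, hx, by omega⟩

theorem isVal_two_mul_add_one {x : ℤ} (hx : x ∈ coords K ∨ x + 1 ∈ coords K) :
    IsVal K (2 * x + 1) :=
  hx.elim (fun hx => ⟨x, hx, by omega⟩) fun hx => ⟨x + 1, hx, by omega⟩

/-- The data of the interval come from the coordinates of `K`. -/
def Valid (K : Finset ZShape) (T : Track) : Prop :=
  (T.k = 0 ∨ T.k = 1) ∧ IsVal K T.r ∧ IsVal K T.α ∧ IsVal K T.β

/-- The grid edge is an interval whose data come from the coordinates of `K`. -/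
def Representable (K : Finset ZShape) (e : Sym2 (ℤ × ℤ)) : Prop :=
  ∃ T : Track, T.Valid K ∧ T.Represents e

theorem representable_hEdge {x y : ℤ} (hx : x ∈ coords K ∨ x + 1 ∈ coords K)
    (hy : y ∈ coords K) : Representable K (hEdge x y) :=
  ⟨_, ⟨.inl rfl, isVal_two_mul hy, isVal_two_mul_add_one hx, isVal_two_mul_add_one hx⟩,
    represents_hEdge x y⟩

theorem representable_vEdge {x y : ℤ} (hx : x ∈ coords K)
    (hy : y ∈ coords K ∨ y + 1 ∈ coords K) : Representable K (vEdge x y) :=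
  ⟨_, ⟨.inr rfl, isVal_two_mul hx, isVal_two_mul_add_one hy, isVal_two_mul_add_one hy⟩,
    represents_vEdge x y⟩

/-- The paths of `K` with the property `P` belong to a clique of the form `Cand T₁ T₂ T₃`, with
data that come from the coordinates of `K`. -/
def Captured (K : Finset ZShape) (P : ZShape → Prop) : Prop :=
  ∃ T₁ T₂ T₃ : Track, T₁.Valid K ∧ T₂.Valid K ∧ T₃.Valid K ∧
    (∀ z ∈ K, P z → Cand T₁ T₂ T₃ z) ∧ ∀ u v, Cand T₁ T₂ T₃ u → Cand T₁ T₂ T₃ v → Share u v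

theorem Captured.mono (hP : Captured K P) (h : ∀ z ∈ K, Q z → P z) : Captured K Q := by
  obtain ⟨T₁, T₂, T₃, v₁, v₂, v₃, hcand, hshare⟩ := hP
  exact ⟨T₁, T₂, T₃, v₁, v₂, v₃, fun z hz hQ => hcand z hz (h z hz hQ), hshare⟩

theorem captured_of_edges {e₁ e₂ e₃ : Sym2 (ℤ × ℤ)} (h₁ : Representable K e₁)
    (h₂ : Representable K e₂) (h₃ : Representable K e₃)
    (hP : ∀ z ∈ K, P z → (e₁ ∈ z.edges ∧ e₂ ∈ z.edges) ∨ (e₂ ∈ z.edges ∧ e₃ ∈ z.edges) ∨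
      (e₃ ∈ z.edges ∧ e₁ ∈ z.edges)) : Captured K P := by
  obtain ⟨T₁, v₁, r₁⟩ := h₁
  obtain ⟨T₂, v₂, r₂⟩ := h₂
  obtain ⟨T₃, v₃, r₃⟩ := h₃
  have hcand : ∀ z, Cand T₁ T₂ T₃ z ↔ (e₁ ∈ z.edges ∧ e₂ ∈ z.edges) ∨
      (e₂ ∈ z.edges ∧ e₃ ∈ z.edges) ∨ (e₃ ∈ z.edges ∧ e₁ ∈ z.edges) := fun z => by
    rw [Cand, (r₁ z).1, (r₁ z).2, (r₂ z).1, (r₂ z).2, (r₃ z).1, (r₃ z).2]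
  refine ⟨T₁, T₂, T₃, v₁, v₂, v₃, fun z hz hPz => (hcand z).2 (hP z hz hPz), fun u v hu hv => ?_⟩
  have pigeonhole : (e₁ ∈ u.edges ∧ e₁ ∈ v.edges) ∨ (e₂ ∈ u.edges ∧ e₂ ∈ v.edges) ∨
      (e₃ ∈ u.edges ∧ e₃ ∈ v.edges) := by
    rw [hcand] at hu hv
    tauto
  rcases pigeonhole with h | h | h
  exacts [⟨e₁, h⟩, ⟨e₂, h⟩, ⟨e₃, h⟩]

theorem captured_of_edge {e : Sym2 (ℤ × ℤ)} (h : Representable K e)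
    (hP : ∀ z ∈ K, P z → e ∈ z.edges) : Captured K P :=
  captured_of_edges h h h fun z hz hPz => .inl ⟨hP z hz hPz, hP z hz hPz⟩

theorem captured_of_forall_not (hK : K.Nonempty) (hP : ∀ z ∈ K, ¬ P z) : Captured K P := by
  obtain ⟨w, hw⟩ := hK
  exact captured_of_edge
    (representable_hEdge (.inl (c_mem_coords hw)) (Has.mem_coords (.inl rfl) hw))
    fun z hz hPz => (hP z hz hPz).elim

/-- The vertical segment of `u` is above the one of `v`, so they share an edge of row `r` only. -/
theorem share_above_below {u v : ZShape} {r : ℤ} (h : Share u v) (hc : u.c = v.c)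
    (hu : r ≤ min u.a u.b) (hv : max v.a v.b ≤ r) :
    u.Has r ∧ v.Has r ∧ (u.c < u.tip r ↔ v.c < v.tip r) := by
  rcases share_iff.1 h with ⟨s, hus, hvs, hs⟩ | ⟨-, hs⟩
  · obtain rfl : s = r := by
      unfold Has at hus hvs
      omega
    unfold Ov at hs
    exact ⟨hus, hvs, by omega⟩
  · unfold Ov at hs
    omega

/-- Each path on the column uses two of the three grid edges at the bend `(c, r)` that `u` and `v`
have in common. -/
theorem captured_of_column_of_le (hKK : ∀ u ∈ K, ∀ v ∈ K, Share u v) {u v : ZShape} (hu : u ∈ K)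
    (hv : v ∈ K) (hc : u.c = v.c) (hvu : max v.a v.b ≤ min u.a u.b) :
    Captured K fun z => z.c = v.c := by
  have above := fun z hz (hzc : z.c = v.c) hr => share_above_below (hKK z hz v hv) hzc hr le_rfl
  have below := fun z hz (hzc : z.c = v.c) hr =>
    share_above_below (hKK u hu z hz) (hc.trans hzc.symm) hvu hr
  obtain ⟨-, hrv, hside⟩ := above u hu hc hvu
  generalize max v.a v.b = r at *
  have hr := hrv.mem_coords hv
  have hcv := c_mem_coords hv
  refine captured_of_edges (e₁ := vEdge v.c (r - 1)) (e₂ := vEdge v.c r)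
    (e₃ := hEdge (if v.c < v.tip r then v.c else v.c - 1) r)
    (representable_vEdge hcv (.inr (by simpa using hr))) (representable_vEdge hcv (.inl hr))
    (representable_hEdge (by split_ifs <;> simp [hcv]) hr) fun z hz hzc => ?_
  have hz_tip := z.tip_ne_c r
  have hz_ne := z.hab
  simp only [vEdge_mem_edges, hEdge_mem_edges]
  rcases le_or_gt r (min z.a z.b) with hz_above | hz_above
  · have := above z hz hzc hz_above
    unfold Has at this ⊢
    split_ifs <;> omega
  rcases le_or_gt (max z.a z.b) r with hz_below | hz_below
  · have := below z hz hzc hz_below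
    unfold Has at this ⊢
    split_ifs <;> omega
  · omega

theorem captured_of_column (hK : K.Nonempty) (hKK : ∀ u ∈ K, ∀ v ∈ K, Share u v) (c : ℤ) :
    Captured K fun z => z.c = c := by
  by_cases hne : ∃ w ∈ K, w.c = c
  swap
  · exact captured_of_forall_not hK fun z hz hzc => hne ⟨z, hz, hzc⟩
  by_cases hov : ∀ u ∈ K, ∀ v ∈ K, u.c = c → v.c = c → min u.a u.b < max v.a v.b
  · obtain ⟨w, hw, hmax⟩ := (K.filter fun z => z.c = c).exists_max_image (fun z => min z.a z.b) (by
      simpa [Finset.Nonempty] using hne)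
    simp only [Finset.mem_filter, and_imp] at hw hmax
    have hmin : w.Has (min w.a w.b) := by
      unfold Has
      omega
    refine captured_of_edge (e := vEdge c (min w.a w.b)) (representable_vEdge
      (hw.2 ▸ c_mem_coords hw.1) (.inl (hmin.mem_coords hw.1))) fun z hz hzc => ?_
    exact vEdge_mem_edges.2 ⟨hzc.symm, hmax z hz hzc, hov w hw.1 z hz hw.2 hzc⟩
  · push Not at hov
    obtain ⟨u, hu, v, hv, hcu, rfl, hvu⟩ := hov
    exact captured_of_column_of_le hKK hu hv hcu hvu

theorem share_left_right {u v : ZShape} {r : ℤ} (h : Share u v) (hc : u.c = v.c)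
    (hur : u.Has r) (hvr : v.Has r) (hu : u.tip r < u.c) (hv : v.c < v.tip r) :
    r = min u.a u.b ↔ r = min v.a v.b := by
  have hu_ne := u.hab
  have hv_ne := v.hab
  rcases share_iff.1 h with ⟨s, hus, hvs, hs⟩ | ⟨-, hs⟩
  · rcases eq_or_ne r s with rfl | hrs
    · unfold Ov at hs
      omega
    · unfold Has at *
      omega
  · unfold Ov at hs
    unfold Has at *
    omega

theorem hEdge_left_mem_or {z : ZShape} {r c : ℤ} (hr : z.Has r) (hlo : z.lo r ≤ 2 * c)
    (hhi : 2 * c ≤ z.hi r) : hEdge (c - 1) r ∈ z.edges ∨ z.c = c ∧ z.c < z.tip r := by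
  have := z.tip_ne_c r
  simp only [hEdge_mem_edges, hr, true_and]
  unfold lo hi at *
  omega

theorem hEdge_right_mem_or {z : ZShape} {r c : ℤ} (hr : z.Has r) (hlo : z.lo r ≤ 2 * c)
    (hhi : 2 * c ≤ z.hi r) : hEdge c r ∈ z.edges ∨ z.c = c ∧ z.tip r < z.c := by
  have := z.tip_ne_c r
  simp only [hEdge_mem_edges, hr, true_and]
  unfold lo hi at *
  omega

theorem vEdge_mem_of_corner {z : ZShape} {r : ℤ} (hr : z.Has r) {p : Prop} [Decidable p]
    (hp : r = min z.a z.b ↔ p) : vEdge z.c (if p then r else r - 1) ∈ z.edges := by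
  have := z.hab
  rw [vEdge_mem_edges]
  unfold Has at hr
  by_cases h : p
  · have := hp.2 h
    rw [if_pos h]
    omega
  · have := mt hp.1 h
    rw [if_neg h]
    omega

/-- Unless all paths use the same row edge at `(c, r)`, two of them bend there coming from opposite
sides. They share an edge, so they continue in the same vertical direction. -/
theorem captured_of_corner (hKK : ∀ u ∈ K, ∀ v ∈ K, Share u v) {r c : ℤ} (hr : r ∈ coords K)
    (hc : c ∈ coords K) : Captured K fun z => z.Has r ∧ z.lo r ≤ 2 * c ∧ 2 * c ≤ z.hi r := by
  have hL : Representable K (hEdge (c - 1) r) := representable_hEdge (.inr (by simpa using hc)) hr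
  have hR : Representable K (hEdge c r) := representable_hEdge (.inl hc) hr
  have leftmem := fun (z : ZShape) (hz : z.Has r ∧ z.lo r ≤ 2 * c ∧ 2 * c ≤ z.hi r) =>
    hEdge_left_mem_or hz.1 hz.2.1 hz.2.2
  have rightmem := fun (z : ZShape) (hz : z.Has r ∧ z.lo r ≤ 2 * c ∧ 2 * c ≤ z.hi r) =>
    hEdge_right_mem_or hz.1 hz.2.1 hz.2.2
  by_cases hleft : ∃ u ∈ K, u.Has r ∧ u.c = c ∧ u.tip r < u.c
  swap
  · exact captured_of_edge hR fun z hz hPz =>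
      (rightmem z hPz).resolve_right fun h => hleft ⟨z, hz, hPz.1, h⟩
  by_cases hright : ∃ v ∈ K, v.Has r ∧ v.c = c ∧ v.c < v.tip r
  swap
  · exact captured_of_edge hL fun z hz hPz =>
      (leftmem z hPz).resolve_right fun h => hright ⟨z, hz, hPz.1, h⟩
  obtain ⟨u, hu, hur, huc, hu_left⟩ := hleft
  obtain ⟨v, hv, hvr, hvc, hv_right⟩ := hright
  have huv := share_left_right (hKK u hu v hv) (huc.trans hvc.symm) hur hvr hu_left hv_right
  refine captured_of_edges (e₃ := vEdge c (if r = min u.a u.b then r else r - 1)) hL hR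
    (representable_vEdge hc (by split_ifs <;> simp [hr])) fun z hz hPz => ?_
  rcases leftmem z hPz with hzL | ⟨rfl, hz_right⟩
  · rcases rightmem z hPz with hzR | ⟨rfl, hz_left⟩
    · exact .inl ⟨hzL, hzR⟩
    · exact .inr (.inr ⟨vEdge_mem_of_corner hPz.1 ((share_left_right (hKK z hz v hv) hvc.symm hPz.1
        hvr hz_left hv_right).trans huv.symm), hzL⟩)
  · exact .inr (.inl ⟨(rightmem z hPz).resolve_right fun h => h.2.not_gt hz_right,
      vEdge_mem_of_corner hPz.1
        (share_left_right (hKK u hu z hz) huc hur hPz.1 hu_left hz_right).symm⟩)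

theorem captured_of_position (hK : K.Nonempty) (hKK : ∀ u ∈ K, ∀ v ∈ K, Share u v) (r p : ℤ) :
    Captured K fun z => z.Has r ∧ p ∈ Set.Icc (z.lo r) (z.hi r) := by
  by_cases hne : ∃ w ∈ K, w.Has r ∧ p ∈ Set.Icc (w.lo r) (w.hi r)
  swap
  · exact captured_of_forall_not hK fun z hz hPz => hne ⟨z, hz, hPz⟩
  obtain ⟨w, hw, hmax⟩ := Finset.exists_max_image
    (K.filter fun z => z.Has r ∧ p ∈ Set.Icc (z.lo r) (z.hi r)) (fun z => z.lo r)
    (by simpa [Finset.Nonempty] using hne)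
  simp only [Finset.mem_filter, and_imp] at hw hmax
  obtain ⟨hw, hwr, hwp⟩ := hw
  have hr := hwr.mem_coords hw
  rcases le_or_gt (2 * w.c) (2 * w.tip r + 1) with hlo | hlo
  · refine (captured_of_corner hKK hr (c_mem_coords hw)).mono fun z hz ⟨hzr, hzp⟩ => ⟨hzr, ?_⟩
    have := hmax z hz hzr hzp
    rw [← min_eq_left hlo]
    exact ⟨this, hwp.1.trans hzp.2⟩
  · refine captured_of_edge (representable_hEdge (.inl (tip_mem_coords hw r)) hr)
      fun z hz ⟨hzr, hzp⟩ => (represents_hEdge _ _ z).1.1 (row_containedIn_iff.2 ⟨hzr, ?_⟩)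
    have := hmax z hz hzr hzp
    rw [← min_eq_right hlo.le]
    exact ⟨this, hwp.1.trans hzp.2⟩

/-- Every path of `K` belongs to one of two cliques of the form `Cand T₁ T₂ T₃`. -/
def Covered (K : Finset ZShape) : Prop :=
  ∃ P Q : ZShape → Prop, Captured K P ∧ Captured K Q ∧ ∀ z ∈ K, P z ∨ Q z

theorem covered_of_two_rows (hK : K.Nonempty) (hKK : ∀ u ∈ K, ∀ v ∈ K, Share u v) {p q : ℤ}
    (hpq : p ≠ q) (hrows : ∀ z ∈ K, z.Has p ∨ z.Has q)
    (hp : ∀ u ∈ K, ∀ v ∈ K, u.Has p → v.Has p → ¬ u.Has q → ¬ v.Has q → MeetOn p u v)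
    (hq : ∀ u ∈ K, ∀ v ∈ K, u.Has q → v.Has q → ¬ u.Has p → ¬ v.Has p → MeetOn q u v) :
    Covered K := by
  obtain ⟨x, y, hxy⟩ := exists_two_points (K := K) (P := fun z => z.Has p) (Q := fun z => z.Has q)
    (l := fun z => z.lo p) (h := fun z => z.hi p) (l' := fun z => z.lo q) (h' := fun z => z.hi q)
    hrows
    (fun u hu v hv hup hvp huq => by
      by_cases hvq : v.Has q
      · exact ((hKK u hu v hv).meetOn_of_not_has hup ⟨hvp, hvq, hpq⟩ huq).2.2
      · exact (hp u hu v hv hup hvp huq hvq).2.2)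
    (fun u hu v hv huq hvq hup => by
      by_cases hvp : v.Has p
      · exact ((hKK u hu v hv).meetOn_of_not_has huq ⟨hvq, hvp, hpq.symm⟩ hup).2.2
      · exact (hq u hu v hv huq hvq hup hvp).2.2)
    (fun u hu v hv hup huq hvp hvq => by
      obtain ⟨s, hus, -, hs⟩ := (hKK u hu v hv).exists_meetOn hup hvp
      rcases HasRows.has_iff ⟨hup, huq, hpq⟩ |>.1 hus with rfl | rfl
      exacts [.inl hs, .inr hs])
  exact ⟨_, _, captured_of_position hK hKK p x, captured_of_position hK hKK q y, hxy⟩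

end Track

namespace ZShape

/-- The first position of an edge of the path on the row `r`. -/
def loEdge (z : ZShape) (r : ℤ) : ℤ := 2 * min z.c (z.tip r) + 1

/-- The last position of an edge of the path on the row `r`. -/
def hiEdge (z : ZShape) (r : ℤ) : ℤ := 2 * max z.c (z.tip r) - 1

theorem lo_le_hi (z : ZShape) (r : ℤ) : z.lo r ≤ z.hi r := by
  unfold lo hi
  omega

theorem lo_le_loEdge (z : ZShape) (r : ℤ) : z.lo r ≤ z.loEdge r := by
  unfold lo loEdge
  omega

theorem hiEdge_le_hi (z : ZShape) (r : ℤ) : z.hiEdge r ≤ z.hi r := by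
  unfold hi hiEdge
  omega

theorem loEdge_le {z : ZShape} {r o : ℤ} (ho : o % 2 = 1) (h : z.lo r ≤ o) : z.loEdge r ≤ o := by
  unfold lo at h
  unfold loEdge
  omega

theorem le_hiEdge {z : ZShape} {r o : ℤ} (ho : o % 2 = 1) (h : o ≤ z.hi r) : o ≤ z.hiEdge r := by
  unfold hi at h
  unfold hiEdge
  omega

/-- The row `r` is strictly between the rows `s` and `t`. -/
def Between (r s t : ℤ) : Prop := min s t < r ∧ r < max s t

theorem Share.exists_has {u v : ZShape} (h : Share u v) (hc : u.c ≠ v.c) :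
    ∃ r, u.Has r ∧ v.Has r := by
  obtain ⟨r, hu, hv, -⟩ := (share_iff_meetOn hc).1 h
  exact ⟨r, hu, hv⟩

theorem Share.has_or_has {u v : ZShape} (h : Share u v) (hc : u.c ≠ v.c) {p q : ℤ}
    (hv : v.HasRows p q) : u.Has p ∨ u.Has q := by
  obtain ⟨r, hur, hvr⟩ := h.exists_has hc
  rcases hv.has_iff.1 hvr with rfl | rfl
  exacts [.inl hur, .inr hur]

/-- Of two paths with the rows `r`, `s` and `r`, `t`, the vertical segments leave the row `r` in
opposite directions. -/
theorem Share.ov_of_between {u v : ZShape} (h : Share u v) {r s t : ℤ} (hu : u.HasRows r s)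
    (hv : v.HasRows r t) (hb : Between r s t) : Ov (u.tip r) u.c (v.tip r) v.c := by
  unfold Between at hb
  rcases share_iff.1 h with ⟨x, hux, hvx, hov⟩ | ⟨-, hov⟩
  · rw [hu.has_iff] at hux
    rw [hv.has_iff] at hvx
    obtain rfl : x = r := by omega
    exact hov
  · rw [hu.ov_iff hv, Ov] at hov
    omega

theorem Share.ov_of_disjoint {u v : ZShape} (h : Share u v) (huv : ∀ r, u.Has r → ¬ v.Has r) :
    u.c = v.c ∧ Ov u.a u.b v.a v.b :=
  (share_iff.1 h).resolve_left fun ⟨r, hu, hv, _⟩ => huv r hu hv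

/-- The pairing that separates the two smallest numbers from the others does not overlap. -/
theorem not_ov_of_ov_of_ov {p p' q q' : ℤ} (h₁ : Ov p p' q q') (h₂ : Ov p q p' q') :
    ¬ Ov p q' p' q := by
  unfold Ov at *
  omega

theorem Ov.symm {x y z w : ℤ} (h : Ov x y z w) : Ov z w x y := by
  unfold Ov at *
  omega

theorem exists_opposite {K : Finset ZShape} (hKK : ∀ u ∈ K, ∀ v ∈ K, Share u v) {u v w : ZShape}
    (hu : u ∈ K) (hv : v ∈ K) (hw : w ∈ K) {p p' q q' : ℤ} (hur : u.HasRows p p')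
    (hvr : v.HasRows q q') (hwr : w.HasRows p q) (hpq' : p' ≠ q') (huv : u.c = v.c)
    (hwu : w.c ≠ u.c) (hne : ∃ z ∈ K, ¬ z.Has p ∧ ¬ z.Has q) :
    ∃ k ∈ K, k.c = w.c ∧ k.HasRows p' q' ∧ Ov p q p' q' := by
  obtain ⟨k, hk, hkp, hkq⟩ := hne
  obtain ⟨hc, hov⟩ := (hKK w hw k hk).ov_of_disjoint fun r hr hkr =>
    (hwr.has_iff.1 hr).elim (fun h => hkp (h ▸ hkr)) fun h => hkq (h ▸ hkr)
  have hkr : k.HasRows p' q' :=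
    ⟨((hKK k hk u hu).has_or_has (hc ▸ hwu) hur).resolve_left hkp,
      ((hKK k hk v hv).has_or_has (hc ▸ huv ▸ hwu) hvr).resolve_left hkq, hpq'⟩
  exact ⟨k, hk, hc.symm, hkr, (hwr.ov_iff hkr).1 hov⟩

theorem share_of_touches_of_containedIn {u v : ZShape} {r s t α β : ℤ} (hu : u.HasRows r s)
    (hv : v.HasRows r t) (hb : Between r s t → α % 2 = 1 ∧ β % 2 = 1)
    (hut : (Track.row r α β).Touches u) (hvc : (Track.row r α β).ContainedIn v) :
    Share u v := by
  rw [Track.row_touches_iff] at hut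
  rw [Track.row_containedIn_iff] at hvc
  by_cases hc : u.c = v.c
  · rw [share_iff]
    by_cases h : Between r s t
    · have hodd := hb h
      have hu_lo := loEdge_le hodd.2 hut.2.1
      have hu_hi := le_hiEdge hodd.1 hut.2.2
      have hv_lo := loEdge_le hodd.1 hvc.2.1
      have hv_hi := le_hiEdge hodd.2 hvc.2.2
      unfold loEdge hiEdge at *
      exact .inl ⟨r, hu.1, hv.1, by unfold Ov; omega⟩
    · refine .inr ⟨hc, (hu.ov_iff hv).2 ?_⟩
      unfold Between at h
      unfold HasRows at hu hv
      unfold Ov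
      omega
  · exact (share_iff_meetOn hc).2
      ⟨r, meetOn_iff.2 ⟨hu.1, hv.1, hut.2.1.trans hvc.2.2, hvc.2.1.trans hut.2.2⟩⟩

theorem share_of_containedIn {u v : ZShape} {r s α β : ℤ} (hαβ : α ≤ β) (hu : u.HasRows r s)
    (hv : v.HasRows r s) (huc : (Track.row r α β).ContainedIn u)
    (hvc : (Track.row r α β).ContainedIn v) : Share u v := by
  rw [Track.row_containedIn_iff] at huc hvc
  by_cases hc : u.c = v.c
  · have := hu.2.2
    exact share_iff.2 (.inr ⟨hc, (hu.ov_iff hv).2 (by unfold Ov; omega)⟩)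
  · exact (share_iff_meetOn hc).2
      ⟨r, meetOn_iff.2 ⟨hu.1, hv.1, huc.2.1.trans (hαβ.trans hvc.2.2),
        hvc.2.1.trans (hαβ.trans huc.2.2)⟩⟩

end ZShape

namespace Track

variable {K : Finset ZShape} {r s t : ℤ}

/-- Two paths of `K` have the rows `r` and `s` and do not meet on the row `r`. -/
def Apart (K : Finset ZShape) (r s : ℤ) : Prop :=
  ∃ x ∈ K, ∃ y ∈ K, x.HasRows r s ∧ y.HasRows r s ∧ ¬ MeetOn r x y

theorem exists_apart (hKK : ∀ u ∈ K, ∀ v ∈ K, Share u v) {u v : ZShape} (hu : u ∈ K) (hv : v ∈ K)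
    (hur : u.Has r) (hvr : v.Has r) (h : ¬ MeetOn r u v) :
    ∃ s, u.HasRows r s ∧ Apart K r s := by
  obtain ⟨s, hs⟩ := (hKK u hu v hv).exists_meetOn hur hvr
  have hrs : r ≠ s := fun hrs => h (hrs ▸ hs)
  exact ⟨s, ⟨hur, hs.1, hrs⟩, u, hu, v, hv, ⟨hur, hs.1, hrs⟩, ⟨hvr, hs.2.1, hrs⟩, h⟩

theorem Apart.ne (h : Apart K r s) : r ≠ s := by
  obtain ⟨x, -, -, -, hx, -⟩ := h
  exact hx.2.2

theorem Apart.exists_hasRows (h : Apart K r s) : ∃ z ∈ K, z.HasRows s r := by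
  obtain ⟨x, hx, -, -, hxr, -⟩ := h
  exact ⟨x, hx, hxr.symm⟩

theorem Apart.has_or_has (h : Apart K r s) (hKK : ∀ u ∈ K, ∀ v ∈ K, Share u v) {w : ZShape}
    (hw : w ∈ K) : w.Has r ∨ w.Has s := by
  obtain ⟨x, hx, y, hy, hxr, hyr, hxy⟩ := h
  by_cases hwx : w.c = x.c
  · have hwy : w.c ≠ y.c := fun hwy => hxy (meetOn_of_c_eq (hwx.symm.trans hwy) hxr.1 hyr.1)
    exact (hKK w hw y hy).has_or_has hwy hyr
  · exact (hKK w hw x hx).has_or_has hwx hxr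

/-- A path without the row `s` covers the gap between the two paths that do not meet. -/
theorem Apart.exists_odd_mem (h : Apart K r s) (hKK : ∀ u ∈ K, ∀ v ∈ K, Share u v) :
    ∃ o, o % 2 = 1 ∧ ∀ w ∈ K, w.Has r → ¬ w.Has s → w.lo r ≤ o ∧ o ≤ w.hi r := by
  obtain ⟨x, hx, y, hy, hxr, hyr, hxy⟩ := h
  have hgap : ∀ w ∈ K, w.Has r → ¬ w.Has s → w.lo r ≤ min (x.hi r) (y.hi r) ∧
      min (x.hi r) (y.hi r) + 1 ≤ w.hi r := fun w hw hwr hws => by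
    have hwx := meetOn_iff.1 ((hKK w hw x hx).meetOn_of_not_has hwr hxr hws)
    have hwy := meetOn_iff.1 ((hKK w hw y hy).meetOn_of_not_has hwr hyr hws)
    have hsep : ¬ (x.lo r ≤ y.hi r ∧ y.lo r ≤ x.hi r) := fun h => hxy ⟨hxr.1, hyr.1, h⟩
    have := x.lo_le_hi r
    have := y.lo_le_hi r
    omega
  rcases Int.emod_two_eq_zero_or_one (min (x.hi r) (y.hi r)) with hpar | hpar
  · exact ⟨min (x.hi r) (y.hi r) + 1, by omega, fun w hw hwr hws => by
      have := hgap w hw hwr hws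
      omega⟩
  · exact ⟨min (x.hi r) (y.hi r), hpar, fun w hw hwr hws => by
      have := hgap w hw hwr hws
      omega⟩

theorem Apart.meetOn (h : Apart K r s) (hKK : ∀ u ∈ K, ∀ v ∈ K, Share u v) {u v : ZShape}
    (hu : u ∈ K) (hv : v ∈ K) (hur : u.Has r) (hvr : v.Has r) (hus : ¬ u.Has s)
    (hvs : ¬ v.Has s) : MeetOn r u v := by
  obtain ⟨o, -, ho⟩ := h.exists_odd_mem hKK
  have huo := ho u hu hur hus
  have hvo := ho v hv hvr hvs
  exact meetOn_iff.2 ⟨hur, hvr, huo.1.trans hvo.2, hvo.1.trans huo.2⟩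

/-- An interval of the row `r` that lies in the paths with the rows `r` and `t` and meets the paths
with the rows `r` and `s`, so that the former share edges with the latter. Its ends are positions
of edges if `r` is between `s` and `t`. -/
structure Hinge (K : Finset ZShape) (r s t α β : ℤ) : Prop where
  valid : (row r α β).Valid K
  le : α ≤ β
  odd : Between r s t → α % 2 = 1 ∧ β % 2 = 1
  containedIn : ∀ z ∈ K, z.HasRows r t → (row r α β).ContainedIn z
  touches : ∀ z ∈ K, z.HasRows r s → (row r α β).Touches z

theorem exists_hinge_of_ends {a b : ZShape → ℤ} {o : ℤ} (hne : ∃ z ∈ K, z.HasRows r t)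
    (ha : ∀ z ∈ K, z.HasRows r t → z.lo r ≤ a z ∧ a z ≤ o ∧ IsVal K (a z))
    (hb : ∀ z ∈ K, z.HasRows r t → b z ≤ z.hi r ∧ o ≤ b z ∧ IsVal K (b z))
    (hodd : Between r s t → ∀ z, a z % 2 = 1 ∧ b z % 2 = 1)
    (htouch : ∀ z ∈ K, z.HasRows r t → ∀ u ∈ K, u.HasRows r s → u.lo r ≤ b z ∧ a z ≤ u.hi r) :
    ∃ α β, Hinge K r s t α β := by
  classical
  obtain ⟨w, hw, hwr⟩ := hne
  have hF : (K.filter fun z => z.HasRows r t).Nonempty := ⟨w, Finset.mem_filter.2 ⟨hw, hwr⟩⟩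
  obtain ⟨x, hx, hmax⟩ := Finset.exists_max_image _ a hF
  obtain ⟨y, hy, hmin⟩ := Finset.exists_min_image _ b hF
  simp only [Finset.mem_filter, and_imp] at hx hy hmax hmin
  obtain ⟨-, hxo, hxval⟩ := ha x hx.1 hx.2
  obtain ⟨-, hyo, hyval⟩ := hb y hy.1 hy.2
  exact ⟨a x, b y,
    { valid := ⟨.inl rfl, isVal_two_mul (hwr.1.mem_coords hw), hxval, hyval⟩
      le := hxo.trans hyo
      odd := fun h => ⟨(hodd h x).1, (hodd h y).2⟩
      containedIn := fun z hz hzr => row_containedIn_iff.2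
        ⟨hzr.1, (ha z hz hzr).1.trans (hmax z hz hzr), (hmin z hz hzr).trans (hb z hz hzr).1⟩
      touches := fun u hu hur => row_touches_iff.2
        ⟨hur.1, (htouch y hy.1 hy.2 u hu hur).1, (htouch x hx.1 hx.2 u hu hur).2⟩ }⟩

theorem isVal_lo {z : ZShape} (hz : z ∈ K) (r : ℤ) : IsVal K (z.lo r) := by
  rcases min_choice (2 * z.c) (2 * z.tip r + 1) with h | h <;> rw [lo, h]
  exacts [isVal_two_mul (c_mem_coords hz), isVal_two_mul_add_one (.inl (tip_mem_coords hz r))]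

theorem isVal_hi {z : ZShape} (hz : z ∈ K) (r : ℤ) : IsVal K (z.hi r) := by
  rcases max_choice (2 * z.c) (2 * z.tip r - 1) with h | h <;> rw [hi, h]
  exacts [isVal_two_mul (c_mem_coords hz), ⟨_, tip_mem_coords hz r, by omega⟩]

theorem isVal_loEdge {z : ZShape} (hz : z ∈ K) (r : ℤ) : IsVal K (z.loEdge r) := by
  rcases min_choice z.c (z.tip r) with h | h <;> rw [loEdge, h]
  exacts [⟨_, c_mem_coords hz, by omega⟩, ⟨_, tip_mem_coords hz r, by omega⟩]

theorem isVal_hiEdge {z : ZShape} (hz : z ∈ K) (r : ℤ) : IsVal K (z.hiEdge r) := by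
  rcases max_choice z.c (z.tip r) with h | h <;> rw [hiEdge, h]
  exacts [⟨_, c_mem_coords hz, by omega⟩, ⟨_, tip_mem_coords hz r, by omega⟩]

theorem Apart.exists_hinge (h : Apart K r s) (hKK : ∀ u ∈ K, ∀ v ∈ K, Share u v) (hst : s ≠ t)
    (hne : ∃ z ∈ K, z.HasRows r t) : ∃ α β, Hinge K r s t α β := by
  obtain ⟨o, ho, hmem⟩ := h.exists_odd_mem hKK
  have hnot : ∀ z : ZShape, z.HasRows r t → ∀ u : ZShape, u.HasRows r s → ¬ z.Has s :=
    fun z hz u hu hs => (hz.has_iff.1 hs).elim hu.2.2.symm hst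
  obtain ⟨u₀, -, -, -, hu₀, -⟩ := h
  have hmem_t : ∀ z ∈ K, z.HasRows r t → z.lo r ≤ o ∧ o ≤ z.hi r :=
    fun z hz hzr => hmem z hz hzr.1 (hnot z hzr u₀ hu₀)
  by_cases hb : Between r s t
  · refine exists_hinge_of_ends (a := fun z => z.loEdge r) (b := fun z => z.hiEdge r) (o := o) hne
      (fun z hz hzr => ⟨z.lo_le_loEdge r, loEdge_le ho (hmem_t z hz hzr).1, isVal_loEdge hz r⟩)
      (fun z hz hzr => ⟨z.hiEdge_le_hi r, le_hiEdge ho (hmem_t z hz hzr).2, isVal_hiEdge hz r⟩)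
      (fun _ z => by unfold loEdge hiEdge; omega) fun z hz hzr u hu hur => ?_
    have hov := (hKK u hu z hz).ov_of_between hur hzr hb
    unfold Ov at hov
    unfold lo hi loEdge hiEdge
    omega
  · refine exists_hinge_of_ends (a := fun z => z.lo r) (b := fun z => z.hi r) (o := o) hne
      (fun z hz hzr => ⟨le_rfl, (hmem_t z hz hzr).1, isVal_lo hz r⟩)
      (fun z hz hzr => ⟨le_rfl, (hmem_t z hz hzr).2, isVal_hi hz r⟩)
      (fun h => (hb h).elim) fun z hz hzr u hu hur => ?_
    exact (meetOn_iff.1 ((hKK z hz u hu).meetOn_of_not_has hzr.1 hur (hnot z hzr u hur))).2.2.symm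

theorem share_of_hinges {α₁ β₁ α₂ β₂ α₃ β₃ : ℤ} (h₁ : Hinge K r s t α₁ β₁)
    (h₂ : Hinge K s t r α₂ β₂) (h₃ : Hinge K t r s α₃ β₃) (hrs : r ≠ s) (hst : s ≠ t) (htr : t ≠ r)
    {u v : ZShape} (hu : Cand (row s α₂ β₂) (row r α₁ β₁) (row t α₃ β₃) u)
    (hv : Cand (row s α₂ β₂) (row r α₁ β₁) (row t α₃ β₃) v) : Share u v := by
  rcases hu with ⟨hu, hu'⟩ | ⟨hu, hu'⟩ | ⟨hu, hu'⟩ <;>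
    rcases hv with ⟨hv, hv'⟩ | ⟨hv, hv'⟩ | ⟨hv, hv'⟩ <;>
    have hur := (row_containedIn_iff.1 hu).1 <;> have hur' := (row_touches_iff.1 hu').1 <;>
    have hvr := (row_containedIn_iff.1 hv).1 <;> have hvr' := (row_touches_iff.1 hv').1
  · exact share_of_containedIn h₂.le ⟨hur, hur', hrs.symm⟩ ⟨hvr, hvr', hrs.symm⟩ hu hv
  · exact share_of_touches_of_containedIn ⟨hur', hur, hrs⟩ ⟨hvr, hvr', htr.symm⟩ h₁.odd hu' hv
  · exact .symm <|
      share_of_touches_of_containedIn ⟨hvr', hvr, hst⟩ ⟨hur, hur', hrs.symm⟩ h₂.odd hv' hu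
  · exact .symm <|
      share_of_touches_of_containedIn ⟨hvr', hvr, hrs⟩ ⟨hur, hur', htr.symm⟩ h₁.odd hv' hu
  · exact share_of_containedIn h₁.le ⟨hur, hur', htr.symm⟩ ⟨hvr, hvr', htr.symm⟩ hu hv
  · exact share_of_touches_of_containedIn ⟨hur', hur, htr⟩ ⟨hvr, hvr', hst.symm⟩ h₃.odd hu' hv
  · exact share_of_touches_of_containedIn ⟨hur', hur, hst⟩ ⟨hvr, hvr', hrs.symm⟩ h₂.odd hu' hv
  · exact .symm <|
      share_of_touches_of_containedIn ⟨hvr', hvr, htr⟩ ⟨hur, hur', hst.symm⟩ h₃.odd hv' hu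
  · exact share_of_containedIn h₃.le ⟨hur, hur', hst.symm⟩ ⟨hvr, hvr', hst.symm⟩ hu hv

theorem covered_of_triangle (hKK : ∀ u ∈ K, ∀ v ∈ K, Share u v) (h₁ : Apart K r s)
    (h₂ : Apart K s t) (h₃ : Apart K t r) : Covered K := by
  have hrs := h₁.ne
  have hst := h₂.ne
  have htr := h₃.ne
  obtain ⟨α₁, β₁, g₁⟩ := h₁.exists_hinge hKK hst h₃.exists_hasRows
  obtain ⟨α₂, β₂, g₂⟩ := h₂.exists_hinge hKK htr h₁.exists_hasRows
  obtain ⟨α₃, β₃, g₃⟩ := h₃.exists_hinge hKK hrs h₂.exists_hasRows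
  have hcand : ∀ z ∈ K, Cand (row s α₂ β₂) (row r α₁ β₁) (row t α₃ β₃) z := fun z hz => by
    by_cases hr : z.Has r
    · by_cases hs : z.Has s
      · exact .inl ⟨g₂.containedIn z hz ⟨hs, hr, hrs.symm⟩, g₁.touches z hz ⟨hr, hs, hrs⟩⟩
      · have ht := (h₂.has_or_has hKK hz).resolve_left hs
        exact .inr (.inl
          ⟨g₁.containedIn z hz ⟨hr, ht, htr.symm⟩, g₃.touches z hz ⟨ht, hr, htr⟩⟩)
    · have hs := (h₁.has_or_has hKK hz).resolve_left hr
      have ht := (h₃.has_or_has hKK hz).resolve_right hr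
      exact .inr (.inr
        ⟨g₃.containedIn z hz ⟨ht, hs, hst.symm⟩, g₂.touches z hz ⟨hs, ht, hst⟩⟩)
  have hcap : Captured K fun _ => True := ⟨_, _, _, g₂.valid, g₁.valid, g₃.valid,
    fun z hz _ => hcand z hz,
    fun u v hu hv => share_of_hinges g₁ g₂ g₃ hrs hst htr hu hv⟩
  exact ⟨_, _, hcap, hcap, fun _ _ => .inl trivial⟩

theorem covered_of_apart_of_forall_not (hK : K.Nonempty) (hKK : ∀ u ∈ K, ∀ v ∈ K, Share u v)
    (h : Apart K r s) (hnot : ∀ t ≠ r, ¬ Apart K s t) : Covered K := by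
  refine covered_of_two_rows hK hKK h.ne (fun z hz => h.has_or_has hKK hz)
    (fun u hu v hv hur hvr hus hvs => h.meetOn hKK hu hv hur hvr hus hvs)
    fun u hu v hv hus hvs hur _ => ?_
  by_contra hm
  obtain ⟨t, hut, ht⟩ := exists_apart hKK hu hv hus hvs hm
  exact hnot t (fun htr => hur (htr ▸ hut.2.1)) ht

theorem covered_of_apart (hK : K.Nonempty) (hKK : ∀ u ∈ K, ∀ v ∈ K, Share u v)
    (h : Apart K r s) : Covered K := by
  by_contra hcov
  have exists_next : ∀ {r s}, Apart K r s → ∃ t ≠ r, Apart K s t := fun h => by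
    by_contra hnot
    push Not at hnot
    exact hcov (covered_of_apart_of_forall_not hK hKK h hnot)
  obtain ⟨t, htr, h'⟩ := exists_next h
  obtain ⟨r', hrs', h''⟩ := exists_next h'
  obtain ⟨x, hx, -, -, hxrs, -⟩ := id h
  have := (h''.has_or_has hKK hx).imp hxrs.has_iff.1 hxrs.has_iff.1
  obtain rfl : r' = r := by
    have := h'.ne
    omega
  exact hcov (covered_of_triangle hKK h h' h'')

theorem exists_two_rows_of_three_columns (hKK : ∀ u ∈ K, ∀ v ∈ K, Share u v) {u v w w' : ZShape}
    (hu : u ∈ K) (hv : v ∈ K) (hw : w ∈ K) (hw' : w' ∈ K) (huv : ∀ r, u.Has r → ¬ v.Has r)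
    (hwu : w.c ≠ u.c) (hwu' : w'.c ≠ u.c) (hww' : w.c ≠ w'.c) :
    ∃ p q, p ≠ q ∧ ∀ z ∈ K, z.Has p ∨ z.Has q := by
  obtain ⟨hc, hov_uv⟩ := (hKK u hu v hv).ov_of_disjoint huv
  by_contra! hnot
  obtain ⟨p, hwp, hup⟩ := (hKK w hw u hu).exists_has hwu
  obtain ⟨q, hwq, hvq⟩ := (hKK w hw v hv).exists_has (hc ▸ hwu)
  obtain ⟨p', hup⟩ := hup.exists_hasRows
  obtain ⟨q', hvq⟩ := hvq.exists_hasRows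
  have hpq : p ≠ q := fun h => huv p hup.1 (h ▸ hvq.1)
  have hpq' : p ≠ q' := fun h => huv p hup.1 (h ▸ hvq.2.1)
  have hp'q : p' ≠ q := fun h => huv p' hup.2.1 (h ▸ hvq.1)
  have hp'q' : p' ≠ q' := fun h => huv p' hup.2.1 (h ▸ hvq.2.1)
  rw [hup.ov_iff hvq] at hov_uv
  obtain ⟨k, hk, hkc, hkr, hov_wk⟩ := exists_opposite hKK hu hv hw hup hvq ⟨hwp, hwq, hpq⟩ hp'q'
    hc hwu (hnot p q hpq)
  have hw'u := (hKK w' hw' u hu).has_or_has hwu' hup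
  have hw'v := (hKK w' hw' v hv).has_or_has (hc ▸ hwu') hvq
  have hw'w := (hKK w' hw' w hw).has_or_has hww'.symm ⟨hwp, hwq, hpq⟩
  have hw'k := (hKK w' hw' k hk).has_or_has (hkc ▸ hww'.symm) hkr
  have hw'rows : (w'.Has p ∧ w'.Has q') ∨ (w'.Has p' ∧ w'.Has q) := by
    have := hup.2.2
    have := hvq.2.2
    unfold Has at hw'u hw'v hw'w hw'k ⊢
    omega
  rcases hw'rows with ⟨hp, hq'⟩ | ⟨hp', hq⟩
  · obtain ⟨-, -, -, -, hov⟩ := exists_opposite hKK hu hv hw' hup hvq.symm ⟨hp, hq', hpq'⟩ hp'q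
      hc hwu' (hnot p q' hpq')
    exact not_ov_of_ov_of_ov hov_uv hov_wk hov
  · obtain ⟨-, -, -, -, hov⟩ := exists_opposite hKK hu hv hw' hup.symm hvq ⟨hp', hq, hp'q⟩ hpq'
      hc hwu' (hnot p' q hp'q)
    exact not_ov_of_ov_of_ov hov_uv hov_wk hov.symm

theorem covered_of_two_columns (hK : K.Nonempty) (hKK : ∀ u ∈ K, ∀ v ∈ K, Share u v) (c c' : ℤ)
    (h : ∀ z ∈ K, z.c = c ∨ z.c = c') : Covered K :=
  ⟨_, _, captured_of_column hK hKK c, captured_of_column hK hKK c', h⟩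

theorem covered (hK : K.Nonempty) (hKK : ∀ u ∈ K, ∀ v ∈ K, Share u v) : Covered K := by
  by_cases hap : ∃ r s, Apart K r s
  · obtain ⟨r, s, h⟩ := hap
    exact covered_of_apart hK hKK h
  have meetOn_of_has : ∀ r, ∀ u ∈ K, ∀ v ∈ K, u.Has r → v.Has r → MeetOn r u v := by
    intro r u hu v hv hur hvr
    by_contra h
    obtain ⟨s, -, hs⟩ := exists_apart hKK hu hv hur hvr h
    exact hap ⟨r, s, hs⟩
  have covered_of_rows : ∀ p q, p ≠ q → (∀ z ∈ K, z.Has p ∨ z.Has q) → Covered K :=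
    fun p q hpq h =>
    covered_of_two_rows hK hKK hpq h
      (fun u hu v hv hup hvp _ _ => meetOn_of_has p u hu v hv hup hvp)
      fun u hu v hv huq hvq _ _ => meetOn_of_has q u hu v hv huq hvq
  by_cases hrow : ∀ u ∈ K, ∀ v ∈ K, ∃ r, u.Has r ∧ v.Has r
  · obtain ⟨w, hw⟩ := hK
    refine covered_of_rows w.a w.b w.hab fun z hz => ?_
    obtain ⟨r, rfl | rfl, hr⟩ := hrow w hw z hz
    exacts [.inl hr, .inr hr]
  push Not at hrow
  obtain ⟨u, hu, v, hv, huv⟩ := hrow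
  by_cases hcol : ∃ w ∈ K, ∃ w' ∈ K, w.c ≠ u.c ∧ w'.c ≠ u.c ∧ w.c ≠ w'.c
  · obtain ⟨w, hw, w', hw', hwu, hwu', hww'⟩ := hcol
    obtain ⟨p, q, hpq, hrows⟩ :=
      exists_two_rows_of_three_columns hKK hu hv hw hw' huv hwu hwu' hww'
    exact covered_of_rows p q hpq hrows
  push Not at hcol
  by_cases hne : ∃ w ∈ K, w.c ≠ u.c
  · obtain ⟨w, hw, hwu⟩ := hne
    exact covered_of_two_columns hK hKK u.c w.c fun z hz =>
      or_iff_not_imp_left.2 fun hzu => (hcol w hw z hz hwu hzu).symm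
  · push Not at hne
    exact covered_of_two_columns hK hKK u.c u.c fun z hz => .inl (hne z hz)

end Track

/-! ### Independent sets in bipartite graphs by an auction -/

namespace Auction

variable {n : ℕ} {A B : ℕ → Prop} {R : ℕ → ℕ → Prop} {X Y : ℕ → ℤ}

/-- The element `a` owns the element `b`. The entry `0` of `Y` means that nobody does. -/
def Owns (Y : ℕ → ℤ) (a b : ℕ) : Prop := Y b = a + 1

/-- The state of an auction in which the elements of `A` bid for those of `B` along the edges `R`.
The price of `b` is `X b`, and `Y` records the owners. An owner had no much cheaper choice. -/
structure Inv (n : ℕ) (A B : ℕ → Prop) (R : ℕ → ℕ → Prop) (X Y : ℕ → ℤ) : Prop where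
  nonneg : ∀ b < n, 0 ≤ X b
  le : ∀ b < n, X b ≤ n + 1
  owner : ∀ b < n, 0 < X b → B b ∧ ∃ a < n, A a ∧ R a b ∧ Owns Y a b ∧
    ∀ b' < n, B b' → R a b' → X b ≤ X b' + 1
  free : ∀ b < n, X b = 0 → Y b = 0
  unique : ∀ b < n, ∀ b' < n, Y b = Y b' → 0 < Y b → b = b'

/-- The element `a` does not want to bid: it owns something, or it finds all its choices too
expensive. -/
def Content (n : ℕ) (A B : ℕ → Prop) (R : ℕ → ℕ → Prop) (X Y : ℕ → ℤ) (a : ℕ) : Prop :=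
  A a → (∃ b < n, B b ∧ Owns Y a b) ∨ ∀ b < n, B b → R a b → (n : ℤ) + 1 ≤ X b

theorem not_content {a : ℕ} : ¬ Content n A B R X Y a ↔ A a ∧
    (¬ ∃ b < n, B b ∧ Owns Y a b) ∧ ¬ ∀ b < n, B b → R a b → (n : ℤ) + 1 ≤ X b := by
  rw [Content, Classical.not_imp, not_or]

/-- Nobody wants to bid. -/
def Stable (n : ℕ) (A B : ℕ → Prop) (R : ℕ → ℕ → Prop) (X Y : ℕ → ℤ) : Prop :=
  ∀ a < n, Content n A B R X Y a

theorem Inv.start (hX : ∀ b < n, X b = 0) (hY : ∀ b < n, Y b = 0) : Inv n A B R X Y where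
  nonneg b hb := (hX b hb).ge
  le b hb := by
    rw [hX b hb]
    positivity
  owner b hb h := absurd (hX b hb) h.ne'
  free b hb _ := hY b hb
  unique b hb _ _ _ h := absurd (hY b hb) h.ne'

theorem Inv.pos_of_pos (h : Inv n A B R X Y) {b : ℕ} (hb : b < n) (hY : 0 < Y b) : 0 < X b :=
  (h.nonneg b hb).lt_of_ne fun hX => hY.ne' (h.free b hb hX.symm)

theorem Owns.pos {a b : ℕ} (h : Owns Y a b) : 0 < Y b := by
  unfold Owns at h
  omega

theorem Inv.bid (h : Inv n A B R X Y) {a b : ℕ} (ha : a < n) (hA : A a)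
    (hown : ¬ ∃ b < n, B b ∧ Owns Y a b) (hb : b < n) (hB : B b) (hR : R a b) (hX : X b < n + 1)
    (hmin : ∀ b' < n, B b' → R a b' → X b ≤ X b') :
    Inv n A B R (Function.update X b (X b + 1)) (Function.update Y b (a + 1)) := by
  have le_update : ∀ c, X c ≤ Function.update X b (X b + 1) c := fun c => by
    rw [Function.update_apply]
    split_ifs with hc
    exacts [hc ▸ (lt_add_one _).le, le_rfl]
  have ne_bidder : ∀ c < n, Y c ≠ a + 1 := fun c hc hYc =>
    hown ⟨c, hc, (h.owner c hc (h.pos_of_pos hc (Owns.pos hYc))).1, hYc⟩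
  refine ⟨fun c hc => (h.nonneg c hc).trans (le_update c), fun c hc => ?_, fun c hc hpos => ?_,
    fun c hc h0 => ?_, fun c hc d hd hcd hpos => ?_⟩
  · rw [Function.update_apply]
    split_ifs
    exacts [hX, h.le c hc]
  · rcases eq_or_ne c b with rfl | hcb
    · refine ⟨hB, a, ha, hA, hR, by simp [Owns], fun b' hb' hBb' hRb' => ?_⟩
      rw [Function.update_self]
      exact add_le_add_left ((hmin b' hb' hBb' hRb').trans (le_update b')) 1
    · rw [Function.update_of_ne hcb] at hpos ⊢
      obtain ⟨hBc, a', ha', hA', hR', hown', hmin'⟩ := h.owner c hc hpos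
      refine ⟨hBc, a', ha', hA', hR', by rwa [Owns, Function.update_of_ne hcb],
        fun b' hb' hBb' hRb' => (hmin' b' hb' hBb' hRb').trans ?_⟩
      exact add_le_add_left (le_update b') 1
  · have := h.nonneg b hb
    have := h.free c hc
    grind [Function.update_apply]
  · have := ne_bidder c hc
    have := ne_bidder d hd
    have := h.unique c hc d hd
    grind [Function.update_apply]

theorem sum_update {b : ℕ} (hb : b < n) :
    ∑ i ∈ Finset.range n, Function.update X b (X b + 1) i = ∑ i ∈ Finset.range n, X i + 1 := by
  rw [Finset.sum_update_of_mem (Finset.mem_range.2 hb),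
    ← Finset.add_sum_erase _ _ (Finset.mem_range.2 hb), Finset.sdiff_singleton_eq_erase]
  ring

theorem Inv.sum_le (h : Inv n A B R X Y) : ∑ i ∈ Finset.range n, X i ≤ n * (n + 1) := by
  have := Finset.sum_le_card_nsmul (Finset.range n) X (n + 1)
    fun i hi => h.le i (Finset.mem_range.1 hi)
  simpa using this

/-- A set of elements of `A` and `B` without edges between them. -/
def Independent (n : ℕ) (A B : ℕ → Prop) (R : ℕ → ℕ → Prop) (s : Finset ℕ) : Prop :=
  (∀ v ∈ s, v < n ∧ (A v ∨ B v)) ∧ ∀ a ∈ s, ∀ b ∈ s, A a → B b → ¬ R a b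

/-- The owner of the element `b`, if there is one. -/
def ownerOf (Y : ℕ → ℤ) (b : ℕ) : ℕ := (Y b - 1).toNat

theorem Owns.ownerOf_eq {a b : ℕ} (h : Owns Y a b) : ownerOf Y b = a := by
  unfold Owns at h
  unfold ownerOf
  omega

theorem Inv.ownerOf_injOn (h : Inv n A B R X Y) : Set.InjOn (ownerOf Y) {b | b < n ∧ 0 < X b} := by
  rintro v ⟨hv, hvX⟩ w ⟨hw, hwX⟩ hvw
  obtain ⟨-, a, -, -, -, hva, -⟩ := h.owner v hv hvX
  obtain ⟨-, a', -, -, -, hwa, -⟩ := h.owner w hw hwX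
  rw [hva.ownerOf_eq, hwa.ownerOf_eq] at hvw
  exact h.unique v hv w hw (hva.trans (hvw ▸ hwa.symm)) hva.pos

open Classical in
/-- The number of elements of `A` and of elements of `B` without an owner. -/
noncomputable def value (n : ℕ) (A B : ℕ → Prop) (X : ℕ → ℤ) : ℕ :=
  ((Finset.range n).filter A).card + ((Finset.range n).filter (fun b => B b ∧ ¬ 0 < X b)).card

/-- Replacing the owned elements of the set by their owners gives an injection. -/
theorem Inv.card_le_value (h : Inv n A B R X Y) {s : Finset ℕ} (hs : Independent n A B R s)
    (hAB : ∀ v, A v → ¬ B v) : s.card ≤ value n A B X := by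
  classical
  obtain ⟨hs, hind⟩ := hs
  have owner_of_not : ∀ v ∈ s, ¬ (A v ∨ ¬ 0 < X v) → ownerOf Y v < n ∧ A (ownerOf Y v) ∧
      ownerOf Y v ∉ s := by
    intro v hv hvA
    push Not at hvA
    obtain ⟨hB, a, ha, hA, hR, hown, -⟩ := h.owner v (hs v hv).1 hvA.2
    rw [hown.ownerOf_eq]
    exact ⟨ha, hA, fun has => hind a has v hv hA hB hR⟩
  rw [value, ← Finset.card_union_of_disjoint (Finset.disjoint_filter.2
    fun v _ hA hB => hAB v hA hB.1)]
  refine Finset.card_le_card_of_injOn (fun v => if A v ∨ ¬ 0 < X v then v else ownerOf Y v)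
    (fun v hv => ?_) fun v hv w hw hvw => ?_
  · simp only [Finset.coe_union, Finset.coe_filter, Finset.mem_range, Set.mem_union,
      Set.mem_ofPred_eq]
    split_ifs with hvA
    · by_cases hA : A v
      · exact .inl ⟨(hs v hv).1, hA⟩
      · exact .inr ⟨(hs v hv).1, (hs v hv).2.resolve_left hA, hvA.resolve_left hA⟩
    · exact .inl ⟨(owner_of_not v hv hvA).1, (owner_of_not v hv hvA).2.1⟩
  · dsimp only at hvw
    split_ifs at hvw with hvA hwA hwA
    · exact hvw
    · exact absurd (hvw ▸ hv) (owner_of_not w hw hwA).2.2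
    · exact absurd (hvw ▸ hw) (owner_of_not v hv hvA).2.2
    · push Not at hvA hwA
      exact h.ownerOf_injOn ⟨(hs v hv).1, hvA.2⟩ ⟨(hs w hw).1, hwA.2⟩ hvw

theorem exists_price_ne (X : ℕ → ℤ) (n : ℕ) :
    ∃ k : ℤ, 0 < k ∧ k ≤ n + 1 ∧ ∀ b < n, X b ≠ k := by
  obtain ⟨k, hk, hkX⟩ : ∃ k ∈ Finset.Icc (1 : ℤ) (n + 1), k ∉ (Finset.range n).image X := by
    refine Finset.exists_mem_notMem_of_card_lt_card ?_
    calc ((Finset.range n).image X).card ≤ n := by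
          simpa using Finset.card_image_le (s := Finset.range n) (f := X)
      _ < _ := by simp
  rw [Finset.mem_Icc] at hk
  exact ⟨k, by omega, hk.2, fun b hb hbk =>
    hkX (Finset.mem_image.2 ⟨b, Finset.mem_range.2 hb, hbk⟩)⟩

open Classical in
/-- The elements of `B` that cost less than `k`, and the elements of `A` that own none of them. -/
noncomputable def cheapSet (n : ℕ) (A B : ℕ → Prop) (X Y : ℕ → ℤ) (k : ℤ) : Finset ℕ :=
  ((Finset.range n).filter fun a => A a ∧ ∀ b < n, X b < k → ¬ Owns Y a b) ∪
    (Finset.range n).filter fun b => B b ∧ X b < k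

theorem mem_cheapSet {k : ℤ} {v : ℕ} : v ∈ cheapSet n A B X Y k ↔
    v < n ∧ ((A v ∧ ∀ b < n, X b < k → ¬ Owns Y v b) ∨ (B v ∧ X v < k)) := by
  simp only [cheapSet, Finset.mem_union, Finset.mem_filter, Finset.mem_range, ← and_or_left]

open Classical in
theorem Inv.image_ownerOf (h : Inv n A B R X Y) (k : ℤ) :
    ((Finset.range n).filter fun b => 0 < X b ∧ X b < k).image (ownerOf Y) =
      (Finset.range n).filter fun a => A a ∧ ¬ ∀ b < n, X b < k → ¬ Owns Y a b := by
  ext a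
  simp only [Finset.mem_filter, Finset.mem_image, Finset.mem_range]
  constructor
  · rintro ⟨b, ⟨hb, hpos, hbk⟩, rfl⟩
    obtain ⟨-, a, ha, hA, -, hown, -⟩ := h.owner b hb hpos
    rw [hown.ownerOf_eq]
    exact ⟨ha, hA, fun hnot => hnot b hb hbk hown⟩
  · rintro ⟨-, -, ha⟩
    push Not at ha
    obtain ⟨b, hb, hbk, hown⟩ := ha
    exact ⟨b, ⟨hb, h.pos_of_pos hb hown.pos, hbk⟩, hown.ownerOf_eq⟩

/-- The cheap owned elements of `B` are as many as their owners. -/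
theorem Inv.card_cheapSet (h : Inv n A B R X Y) (hAB : ∀ v, A v → ¬ B v) {k : ℤ} (hk : 0 < k) :
    (cheapSet n A B X Y k).card = value n A B X := by
  classical
  have hB : (Finset.range n).filter (fun b => (B b ∧ X b < k) ∧ 0 < X b) =
      (Finset.range n).filter fun b => 0 < X b ∧ X b < k := by
    ext b
    have := h.owner b
    grind
  have hfree : (Finset.range n).filter (fun b => (B b ∧ X b < k) ∧ ¬ 0 < X b) =
      (Finset.range n).filter fun b => B b ∧ ¬ 0 < X b := by
    ext b
    grind
  have card_owners := Finset.card_image_of_injOn (f := ownerOf Y)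
    (s := (Finset.range n).filter fun b => 0 < X b ∧ X b < k) <| h.ownerOf_injOn.mono fun b hb => by
      simp only [Finset.coe_filter, Finset.mem_range, Set.mem_ofPred_eq] at hb
      exact ⟨hb.1, hb.2.1⟩
  have hA_split := Finset.card_filter_add_card_filter_not (s := (Finset.range n).filter A)
    fun a => ∀ b < n, X b < k → ¬ Owns Y a b
  have hB_split := Finset.card_filter_add_card_filter_not
    (s := (Finset.range n).filter fun b => B b ∧ X b < k) fun b => 0 < X b
  rw [Finset.filter_filter, Finset.filter_filter, ← h.image_ownerOf, card_owners] at hA_split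
  rw [Finset.filter_filter, Finset.filter_filter, hB, hfree] at hB_split
  rw [cheapSet, Finset.card_union_of_disjoint
    (Finset.disjoint_filter.2 fun v _ hA hB => hAB v hA.1 hB.1), value]
  omega

theorem Inv.independent_cheapSet (h : Inv n A B R X Y) (hst : Stable n A B R X Y)
    (hAB : ∀ v, A v → ¬ B v) {k : ℤ} (hkn : k ≤ n + 1) (hk : ∀ b < n, X b ≠ k) :
    Independent n A B R (cheapSet n A B X Y k) := by
  refine ⟨fun v hv => ?_, fun a ha b hb hA hB hR => ?_⟩
  · rw [mem_cheapSet] at hv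
    exact ⟨hv.1, hv.2.imp And.left And.left⟩
  · rw [mem_cheapSet] at ha hb
    have hown := (ha.2.resolve_right fun h => hAB a hA h.1).2
    have hbk := (hb.2.resolve_left fun h => hAB b h.1 hB).2
    rcases hst a ha.1 hA with ⟨c, hc, -, hac⟩ | hall
    · obtain ⟨-, a', -, -, -, hac', hmin⟩ := h.owner c hc (h.pos_of_pos hc hac.pos)
      obtain rfl : a' = a := hac'.ownerOf_eq.symm.trans hac.ownerOf_eq
      have := hmin b hb.1 hB hR
      have := hk c hc
      exact hown c hc (by omega) hac
    · have := hall b hb.1 hB hR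
      omega

theorem Inv.exists_card_eq_value (h : Inv n A B R X Y) (hst : Stable n A B R X Y)
    (hAB : ∀ v, A v → ¬ B v) : ∃ s, Independent n A B R s ∧ s.card = value n A B X := by
  obtain ⟨k, hk, hkn, hkX⟩ := exists_price_ne X n
  exact ⟨_, h.independent_cheapSet hst hAB hkn hkX, h.card_cheapSet hAB hk⟩

end Auction

/-! ### A structured language with bounded loops -/

/-- The product of an expression with a numeral. -/
def Expr.nmul : ℕ → Expr → Expr
  | 0, _ => const 0
  | k + 1, e => add (nmul k e) e

@[simp] theorem Expr.eval_nmul (M : Mem) (k : ℕ) (e : Expr) :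
    (nmul k e).eval M = k * e.eval M := by
  induction k with
  | zero => simp [nmul, eval]
  | succ k ih =>
    simp only [nmul, eval, ih]
    push_cast
    ring

/-- Boolean combinations of comparisons, used as the conditions of commands. -/
inductive Test where
  | lt (e f : Expr)
  | and (φ ψ : Test)
  | or (φ ψ : Test)
  | not (φ : Test)

namespace Test

/-- The truth of a test in a memory. -/
def Sat (M : Mem) : Test → Prop
  | lt e f => e.eval M < f.eval M
  | and φ ψ => Sat M φ ∧ Sat M ψ
  | or φ ψ => Sat M φ ∨ Sat M ψ
  | not φ => ¬ Sat M φ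

/-- The expression with value `1` if the test succeeds and `0` if it fails. -/
def toExpr : Test → Expr
  | lt e f => .lt e f
  | and φ ψ => .lt (.const 1) (.add φ.toExpr ψ.toExpr)
  | or φ ψ => .lt (.const 0) (.add φ.toExpr ψ.toExpr)
  | not φ => .sub (.const 1) φ.toExpr

open Classical in
theorem eval_toExpr (M : Mem) (φ : Test) : φ.toExpr.eval M = if φ.Sat M then 1 else 0 := by
  induction φ with
  | lt e f =>
    simp only [toExpr, Expr.eval, Sat]
    congr
  | and φ ψ hφ hψ =>
    simp only [toExpr, Expr.eval, Sat, hφ, hψ]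
    split_ifs <;> simp_all
  | or φ ψ hφ hψ =>
    simp only [toExpr, Expr.eval, Sat, hφ, hψ]
    split_ifs <;> simp_all
  | not φ hφ =>
    simp only [toExpr, Expr.eval, Sat, hφ]
    split_ifs <;> simp_all

theorem eval_toExpr_pos {M : Mem} {φ : Test} : 0 < φ.toExpr.eval M ↔ φ.Sat M := by
  classical
  rw [eval_toExpr]
  split_ifs <;> simp_all

/-- The test `e ≤ f`. -/
def le (e f : Expr) : Test := not (lt f e)

/-- The test `e = f`. -/
def eq (e f : Expr) : Test := and (le e f) (le f e)

@[simp] theorem sat_lt {M : Mem} {e f : Expr} : (lt e f).Sat M ↔ e.eval M < f.eval M := Iff.rfl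

@[simp] theorem sat_and {M : Mem} {φ ψ : Test} : (and φ ψ).Sat M ↔ φ.Sat M ∧ ψ.Sat M := Iff.rfl

@[simp] theorem sat_or {M : Mem} {φ ψ : Test} : (or φ ψ).Sat M ↔ φ.Sat M ∨ ψ.Sat M := Iff.rfl

@[simp] theorem sat_not {M : Mem} {φ : Test} : (not φ).Sat M ↔ ¬ φ.Sat M := Iff.rfl

@[simp] theorem sat_le {M : Mem} {e f : Expr} : (le e f).Sat M ↔ e.eval M ≤ f.eval M := by
  simp [le]

@[simp] theorem sat_eq {M : Mem} {e f : Expr} : (eq e f).Sat M ↔ e.eval M = f.eval M := by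
  simp [eq, le_antisymm_iff]

end Test

/-- The address of the variable number `i`. The input is at the nonnegative addresses, variables
are at the odd negative ones, and an array is at the even negative ones. -/
def var (i : ℕ) : ℤ := -(2 * i + 1)

/-- The address of the entry number `m` of the array, for `0 ≤ m`. -/
def cell (m : ℤ) : ℤ := -(2 * m + 2)

@[simp] theorem var_inj {i j : ℕ} : var i = var j ↔ i = j := by
  unfold var
  omega

theorem var_neg (i : ℕ) : var i < 0 := by
  unfold var
  omega

theorem cell_neg {m : ℤ} (hm : 0 ≤ m) : cell m < 0 := by
  unfold cell
  omega

@[simp] theorem cell_inj {m m' : ℤ} : cell m = cell m' ↔ m = m' := by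
  unfold cell
  omega

@[simp] theorem var_ne_cell (i : ℕ) (m : ℤ) : var i ≠ cell m := by
  unfold var cell
  omega

@[simp] theorem cell_ne_var (i : ℕ) (m : ℤ) : cell m ≠ var i := (var_ne_cell i m).symm

/-- The addresses of the array. -/
def array : Set ℤ := cell '' Set.Ici 0

theorem neg_of_mem_array {x : ℤ} (hx : x ∈ array) : x < 0 := by
  obtain ⟨m, hm, rfl⟩ := hx
  exact cell_neg hm

@[simp] theorem var_notMem_array (i : ℕ) : var i ∉ array := fun ⟨m, _, hm⟩ => cell_ne_var i m hm

/-- The value of the variable number `i`. -/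
def Expr.var (i : ℕ) : Expr := .load (.const (EPG.var i))

@[simp] theorem Expr.eval_var (M : Mem) (i : ℕ) : (Expr.var i).eval M = M (EPG.var i) := rfl

/-- The expression `a * n + b`, where `n` is the content of the cell `0`. -/
def Expr.bound (a b : ℕ) : Expr := .add (.nmul a (.load (.const 0))) (.const b)

theorem Expr.eval_bound {M : Mem} {n : ℕ} (hn : M 0 = n) (a b : ℕ) :
    (Expr.bound a b).eval M = ((a * n + b : ℕ) : ℤ) := by
  simp [Expr.bound, Expr.eval, hn]

/-- Structured programs: `set i e` assigns to a variable, `put e f` to an entry of the array, and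
`rep i a b c` carries out `c` for the values `0, …, a * n + b - 1` of the variable `i`, where `n` is
the content of the cell `0`. -/
inductive Cmd where
  | nop
  | set (i : ℕ) (e : Expr)
  | put (e f : Expr)
  | seq (c d : Cmd)
  | cond (φ : Test) (c d : Cmd)
  | rep (i a b : ℕ) (c : Cmd)

namespace Cmd

/-- One round of a loop with the counter `i` and a body that transforms the memory by `f`. -/
def round (i : ℕ) (f : Mem → Mem) (M : Mem) : Mem :=
  Function.update (f M) (var i) (f M (var i) + 1)

open Classical in
/-- The memory after the execution of a command. -/
noncomputable def den : Cmd → Mem → Mem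
  | nop, M => M
  | set i e, M => Function.update M (var i) (e.eval M)
  | put e f, M => if 0 ≤ e.eval M then Function.update M (cell (e.eval M)) (f.eval M) else M
  | seq c d, M => den d (den c M)
  | cond φ c d, M => if φ.Sat M then den c M else den d M
  | rep i a b c, M => (round i (den c))^[a * (M 0).toNat + b] (Function.update M (var i) 0)

/-- The addresses at which a command may change the memory. -/
def writes : Cmd → Set ℤ
  | nop => ∅
  | set i _ => {var i}
  | put _ _ => array
  | seq c d => writes c ∪ writes d
  | cond _ c d => writes c ∪ writes d
  | rep i _ _ c => {var i} ∪ writes c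

/-- Loop counters are assigned to by their loops only. -/
def Ok : Cmd → Prop
  | nop => True
  | set _ _ => True
  | put _ _ => True
  | seq c d => Ok c ∧ Ok d
  | cond _ c d => Ok c ∧ Ok d
  | rep i _ _ c => var i ∉ writes c ∧ Ok c

theorem neg_of_mem_writes {c : Cmd} {x : ℤ} (hx : x ∈ c.writes) : x < 0 := by
  induction c with
  | nop => exact hx.elim
  | set i e => exact hx ▸ var_neg i
  | put e f => exact neg_of_mem_array hx
  | seq c d ihc ihd => exact hx.elim ihc ihd
  | cond φ c d ihc ihd => exact hx.elim ihc ihd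
  | rep i a b c ih => exact hx.elim (fun h => h ▸ var_neg i) ih

theorem eqOn_den (c : Cmd) (M : Mem) : Set.EqOn (den c M) M c.writesᶜ := by
  induction c generalizing M with
  | nop => exact fun _ _ => rfl
  | set i e => exact fun x hx => Function.update_of_ne hx _ _
  | put e f =>
    rw [den]
    split_ifs with h
    · exact fun x hx => Function.update_of_ne (fun hxe => hx ⟨_, h, hxe.symm⟩) _ _
    · exact fun _ _ => rfl
  | seq c d ihc ihd =>
    exact fun x hx => (ihd _ fun h => hx (.inr h)).trans (ihc _ fun h => hx (.inl h))
  | cond φ c d ihc ihd =>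
    rw [den]
    split_ifs
    exacts [fun x hx => ihc M fun h => hx (.inl h), fun x hx => ihd M fun h => hx (.inr h)]
  | rep i a b c ih =>
    intro x hx
    have iterate_round : ∀ (N : ℕ) (M : Mem), (round i (den c))^[N] M x = M x := by
      intro N
      induction N with
      | zero => exact fun _ => rfl
      | succ N ihN =>
        intro M
        rw [Function.iterate_succ_apply, ihN, round, Function.update_of_ne fun h => hx (.inl h),
          ih _ fun h => hx (.inr h)]
    rw [den, iterate_round, Function.update_of_ne fun h => hx (.inl h)]

theorem den_nonneg (c : Cmd) {x : ℤ} (hx : 0 ≤ x) (M : Mem) : den c M x = M x :=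
  eqOn_den c M fun h => (neg_of_mem_writes h).not_ge hx

theorem round_den_nonneg (c : Cmd) (i : ℕ) {x : ℤ} (hx : 0 ≤ x) (M : Mem) :
    round i (den c) M x = M x := by
  rw [round, Function.update_of_ne ((var_neg i).trans_le hx).ne', den_nonneg c hx]

theorem round_den_var {c : Cmd} {i : ℕ} (hi : var i ∉ c.writes) (M : Mem) :
    round i (den c) M (var i) = M (var i) + 1 := by
  rw [round, Function.update_self, eqOn_den c M hi]

theorem rep_induction {i a b : ℕ} {c : Cmd} (hi : var i ∉ c.writes) {n : ℕ} {M : Mem}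
    (hn : M 0 = n) {I : ℕ → Mem → Prop} (zero : I 0 (Function.update M (var i) 0))
    (succ : ∀ k < a * n + b, ∀ M', Set.EqOn M' M (rep i a b c).writesᶜ → M' (var i) = k →
      I k M' → I (k + 1) (Function.update (den c M') (var i) (k + 1))) :
    I (a * n + b) (den (rep i a b c) M) := by
  suffices H : ∀ k ≤ a * n + b, ∀ M', M' = (round i (den c))^[k] (Function.update M (var i) 0) →
      I k M' ∧ M' (var i) = k ∧ Set.EqOn M' M (rep i a b c).writesᶜ by
    rw [den, hn, Int.toNat_natCast]
    exact (H _ le_rfl _ rfl).1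
  intro k
  induction k with
  | zero =>
    rintro - _ rfl
    exact ⟨zero, Function.update_self .., fun x hx => Function.update_of_ne (hx <| .inl ·) _ _⟩
  | succ k ih =>
    rintro hk _ rfl
    obtain ⟨hI, hik, heq⟩ := ih (by omega) _ rfl
    rw [Function.iterate_succ_apply']
    generalize (round i (den c))^[k] (Function.update M (var i) 0) = M' at hI hik heq ⊢
    refine ⟨?_, by rw [round_den_var hi, hik, Nat.cast_succ], fun x hx => ?_⟩
    · rw [round, eqOn_den c M' hi, hik]
      exact succ k (by omega) M' heq hik hI
    · rw [round, Function.update_of_ne (hx <| .inl ·), eqOn_den c M' (hx <| .inr ·), heq hx]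

theorem rep_range_induction {i : ℕ} {c : Cmd} (hi : var i ∉ c.writes) {n : ℕ} {M : Mem}
    (hn : M 0 = n) {I : ℕ → Mem → Prop} (zero : I 0 (Function.update M (var i) 0))
    (succ : ∀ k < n, ∀ M', Set.EqOn M' M (rep i 1 0 c).writesᶜ → M' (var i) = k →
      I k M' → I (k + 1) (Function.update (den c M') (var i) (k + 1))) :
    I n (den (rep i 1 0 c) M) := by
  have := rep_induction (a := 1) (b := 0) hi hn zero
  rw [one_mul, add_zero] at this
  exact this succ

/-- The test that the counter `i` has not reached the bound `a * n + b` of its loop. -/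
def counterTest (i a b : ℕ) : Expr := .lt (.var i) (.bound a b)

/-- The assignment that increases the counter `i`. -/
def increment (i : ℕ) : Program := .store (.const (var i)) (.add (.var i) (.const 1))

/-- The program that carries out a command. -/
def compile : Cmd → Program
  | nop => .skip
  | set i e => .store (.const (var i)) e
  | put e f => .ite (Test.le (.const 0) e).toExpr (.store (.sub (.const (-2)) (.add e e)) f) .skip
  | seq c d => .seq c.compile d.compile
  | cond φ c d => .ite φ.toExpr c.compile d.compile
  | rep i a b c => .seq (.store (.const (var i)) (.const 0))
      (.loop (counterTest i a b) (.seq c.compile (increment i)))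

open Polynomial in
/-- A bound for the running time of a command in terms of the content of the cell `0`. -/
noncomputable def time : Cmd → ℕ[X]
  | nop => 1
  | set _ e => C (e.cost + 2)
  | put e f => C ((Test.le (.const 0) e).toExpr.cost + 2 * e.cost + f.cost + 5)
  | seq c d => time c + time d
  | cond φ c d => C (φ.toExpr.cost + 1) + (time c + time d)
  | rep i a b c => C 3 + (C a * X + C b) * (time c + C ((counterTest i a b).cost + 7)) +
      C ((counterTest i a b).cost + 1)

theorem runs_loop {i a b : ℕ} {c : Cmd} (hi : var i ∉ c.writes) {n s : ℕ}
    (hc : ∀ M : Mem, M 0 = n → ∃ t ≤ s, Runs c.compile M t (den c M)) (m : ℕ) :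
    ∀ M : Mem, M 0 = n → M (var i) + m = ((a * n + b : ℕ) : ℤ) →
      ∃ t ≤ m * (s + ((counterTest i a b).cost + 7)) + ((counterTest i a b).cost + 1),
        Runs (.loop (counterTest i a b) (.seq c.compile (increment i))) M t
          ((round i (den c))^[m] M) := by
  have eval_test : ∀ {M : Mem}, M 0 = n → (counterTest i a b).eval M =
      if M (var i) < ((a * n + b : ℕ) : ℤ) then 1 else 0 := fun h0 => by
    rw [counterTest, Expr.eval, Expr.eval_var, Expr.eval_bound h0]
  induction m with
  | zero =>
    intro M h0 hm
    refine ⟨_, by omega, .loop_neg _ ?_⟩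
    rw [eval_test h0, if_neg (by omega)]
    exact lt_irrefl _
  | succ m ihm =>
    intro M h0 hm
    obtain ⟨t, ht, hr⟩ := hc M h0
    obtain ⟨t', ht', hr'⟩ := ihm (round i (den c) M)
      (by rw [round_den_nonneg c i le_rfl, h0])
      (by rw [round_den_var hi]; push_cast at hm ⊢; omega)
    refine ⟨_, ?_, .loop_pos ?_ (.seq hr (.store _ _ _)) hr'⟩
    · rw [add_mul]
      simp only [Expr.cost, Expr.var]
      omega
    · rw [eval_test h0, if_pos (by omega)]
      exact one_pos

theorem runs_put (e f : Expr) (n : ℕ) (M : Mem) :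
    ∃ t ≤ (put e f).time.eval n, Runs (put e f).compile M t (den (put e f) M) := by
  have address : (Expr.sub (.const (-2)) (.add e e)).eval M = cell (e.eval M) := by
    simp only [Expr.eval, cell]
    ring
  rw [den, compile, ← address, time, Polynomial.eval_C]
  split_ifs with h
  · refine ⟨_, ?_, .ite_pos _ (Test.eval_toExpr_pos.2 (Test.sat_le.2 h)) (.store _ _ M)⟩
    simp only [Expr.cost]
    omega
  · refine ⟨_, ?_, .ite_neg _ (fun h' => h (Test.sat_le.1 (Test.eval_toExpr_pos.1 h'))) (.skip M)⟩
    omega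

theorem runs_compile {c : Cmd} (hc : c.Ok) {n : ℕ} {M : Mem} (hn : M 0 = n) :
    ∃ t ≤ c.time.eval n, Runs c.compile M t (den c M) := by
  induction c generalizing M with
  | nop => exact ⟨1, by simp [time], .skip M⟩
  | set i e => exact ⟨_, by simp [time, Expr.cost]; omega, .store _ _ M⟩
  | put e f => exact runs_put e f n M
  | seq c d ihc ihd =>
    obtain ⟨t, ht, hr⟩ := ihc hc.1 hn
    obtain ⟨t', ht', hr'⟩ := ihd hc.2 (M := den c M) (by rw [den_nonneg c le_rfl, hn])
    exact ⟨t + t', by simp only [time, Polynomial.eval_add]; omega, .seq hr hr'⟩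
  | cond φ c d ihc ihd =>
    rw [den, compile]
    split_ifs with h
    · obtain ⟨t, ht, hr⟩ := ihc hc.1 hn
      refine ⟨_, ?_, .ite_pos _ (Test.eval_toExpr_pos.2 h) hr⟩
      simp only [time, Polynomial.eval_add, Polynomial.eval_C]
      omega
    · obtain ⟨t, ht, hr⟩ := ihd hc.2 hn
      refine ⟨_, ?_, .ite_neg _ (fun h' => h (Test.eval_toExpr_pos.1 h')) hr⟩
      simp only [time, Polynomial.eval_add, Polynomial.eval_C]
      omega
  | rep i a b c ih =>
    obtain ⟨t, ht, hr⟩ := runs_loop (a := a) (b := b) hc.1 (fun _ => ih hc.2) (a * n + b)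
      (Function.update M (var i) 0) (by rwa [Function.update_of_ne (var_neg i).ne'])
      (by rw [Function.update_self, zero_add])
    rw [den, hn, Int.toNat_natCast, compile]
    refine ⟨3 + t, ?_, .seq (.store _ _ M) hr⟩
    simp only [time, Polynomial.eval_add, Polynomial.eval_mul, Polynomial.eval_C, Polynomial.eval_X]
    omega

end Cmd

/-! ### The auction as a command -/

namespace Auction

open Cmd

/-- The prices stored in a memory, at the even entries of the array. -/
def price (M : Mem) (b : ℕ) : ℤ := M (cell (2 * b))

/-- The owners stored in a memory, at the odd entries of the array. -/
def owner (M : Mem) (b : ℕ) : ℤ := M (cell (2 * b + 1))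

/-- The price of the element whose number is the value of `e`. -/
def priceExpr (e : Expr) : Expr := .load (.sub (.const (-2)) (.nmul 4 e))

/-- The owner of the element whose number is the value of `e`. -/
def ownerExpr (e : Expr) : Expr := .load (.sub (.const (-4)) (.nmul 4 e))

/-- The command that sets the price of the element whose number is the value of `e`. -/
def putPrice (e f : Expr) : Cmd := .put (.nmul 2 e) f

/-- The command that sets the owner of the element whose number is the value of `e`. -/
def putOwner (e f : Expr) : Cmd := .put (.add (.nmul 2 e) (.const 1)) f

section Memory

variable {M M' : Mem} {b i j : ℕ} {m x : ℤ} {e f : Expr}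

theorem eval_priceExpr (h : e.eval M = b) : (priceExpr e).eval M = price M b := by
  simp only [priceExpr, Expr.eval, Expr.eval_nmul, h, price, cell]
  congr 1
  push_cast
  ring

theorem eval_ownerExpr (h : e.eval M = b) : (ownerExpr e).eval M = owner M b := by
  simp only [ownerExpr, Expr.eval, Expr.eval_nmul, h, owner, cell]
  congr 1
  push_cast
  ring

theorem den_putPrice (h : e.eval M = b) :
    den (putPrice e f) M = Function.update M (cell (2 * b)) (f.eval M) := by
  rw [putPrice, den, Expr.eval_nmul, h, if_pos (by positivity), Nat.cast_ofNat]

theorem den_putOwner (h : e.eval M = b) :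
    den (putOwner e f) M = Function.update M (cell (2 * b + 1)) (f.eval M) := by
  rw [putOwner, den, Expr.eval, Expr.eval_nmul, h, Expr.eval, if_pos (by positivity),
    Nat.cast_ofNat]

@[simp] theorem update_var_apply : Function.update M (var i) x (var j) =
    if j = i then x else M (var j) := by
  simp only [Function.update_apply, var_inj]

@[simp] theorem update_cell_apply_var : Function.update M (cell m) x (var j) = M (var j) :=
  Function.update_of_ne (var_ne_cell j m) _ _

@[simp] theorem price_update_var : price (Function.update M (var i) x) = price M :=
  funext fun _ => Function.update_of_ne (cell_ne_var _ _) _ _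

@[simp] theorem owner_update_var : owner (Function.update M (var i) x) = owner M :=
  funext fun _ => Function.update_of_ne (cell_ne_var _ _) _ _

@[simp] theorem price_update_price :
    price (Function.update M (cell (2 * b)) x) = Function.update (price M) b x := by
  funext c
  simp [price, Function.update_apply]

@[simp] theorem owner_update_owner :
    owner (Function.update M (cell (2 * b + 1)) x) = Function.update (owner M) b x := by
  funext c
  simp [owner, Function.update_apply]

@[simp] theorem price_update_owner : price (Function.update M (cell (2 * b + 1)) x) = price M :=
  funext fun _ => Function.update_of_ne (by rw [Ne, cell_inj]; omega) _ _

@[simp] theorem owner_update_price : owner (Function.update M (cell (2 * b)) x) = owner M :=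
  funext fun _ => Function.update_of_ne (by rw [Ne, cell_inj]; omega) _ _

theorem price_congr {W : Set ℤ} (h : Set.EqOn M' M Wᶜ) (hW : W ⊆ Set.range var) :
    price M' = price M :=
  funext fun _ => h fun hc => (hW hc).elim fun i hi => var_ne_cell i _ hi

theorem owner_congr {W : Set ℤ} (h : Set.EqOn M' M Wᶜ) (hW : W ⊆ Set.range var) :
    owner M' = owner M :=
  funext fun _ => h fun hc => (hW hc).elim fun i hi => var_ne_cell i _ hi

end Memory

/-- The addresses that the auction uses: the array and the variables `0`, …, `9`, with the
following contents. `0`: the size of the best clique so far; `1`: positive if `A` and `B` are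
cliques; `2`: the value of the auction; `3`: the bidding element; `4`: the element under inspection;
`5`: positive if the bidder owns an element; `6` and `7`: the choice of the bidder, with `-1` for
none, and its price; `8` and `9`: counters. -/
def locals : Set ℤ := var '' Set.Iio 10 ∪ array

@[simp] theorem var_mem_locals {i : ℕ} : var i ∈ locals ↔ i < 10 := by
  simp [locals]

@[simp] theorem array_subset_locals : array ⊆ locals := Set.subset_union_right

theorem neg_of_mem_locals {x : ℤ} (hx : x ∈ locals) : x < 0 := by
  rcases hx with ⟨i, -, rfl⟩ | hx
  exacts [var_neg i, neg_of_mem_array hx]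

/-- The memories agree outside of the addresses that the auction uses. -/
def Agree (M₀ M : Mem) : Prop := Set.EqOn M M₀ localsᶜ

section Agree

variable {M₀ M M' : Mem}

theorem Agree.refl (M : Mem) : Agree M M := fun _ _ => rfl

theorem Agree.of_eqOn (h : Agree M₀ M) {W : Set ℤ} (hM' : Set.EqOn M' M Wᶜ) (hW : W ⊆ locals) :
    Agree M₀ M' :=
  (hM'.mono (Set.compl_subset_compl.2 hW)).trans h

theorem Agree.den (h : Agree M₀ M) {c : Cmd} (hc : c.writes ⊆ locals) : Agree M₀ (c.den M) :=
  h.of_eqOn (eqOn_den c M) hc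

theorem Agree.update (h : Agree M₀ M) {i : ℕ} (hi : i < 10) (x : ℤ) :
    Agree M₀ (Function.update M (var i) x) :=
  h.of_eqOn (fun _ hy => Function.update_of_ne hy _ _)
    (Set.singleton_subset_iff.2 (var_mem_locals.2 hi))

theorem Agree.apply_of_nonneg (h : Agree M₀ M) {x : ℤ} (hx : 0 ≤ x) : M x = M₀ x :=
  h fun hx' => (neg_of_mem_locals hx').not_ge hx

theorem Agree.apply_var (h : Agree M₀ M) {i : ℕ} (hi : 10 ≤ i) : M (var i) = M₀ (var i) :=
  h fun hi' => (var_mem_locals.1 hi').not_ge hi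

end Agree

/-- The tests decide the predicates `A` and `B` and the relation `R` for the elements stored in
given variables, even while the auction is running. -/
structure Decides (n : ℕ) (M₀ : Mem) (φA φB : ℕ → Test) (φR : ℕ → ℕ → Test) (A B : ℕ → Prop)
    (R : ℕ → ℕ → Prop) : Prop where
  size : M₀ 0 = n
  sat_A : ∀ M, Agree M₀ M → ∀ i, ∀ v < n, M (var i) = v → ((φA i).Sat M ↔ A v)
  sat_B : ∀ M, Agree M₀ M → ∀ i, ∀ v < n, M (var i) = v → ((φB i).Sat M ↔ B v)
  sat_R : ∀ M, Agree M₀ M → ∀ i j, ∀ v < n, ∀ w < n, M (var i) = v → M (var j) = w →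
    ((φR i j).Sat M ↔ R v w)

theorem Decides.zero_eq {n : ℕ} {M₀ : Mem} {φA φB : ℕ → Test} {φR : ℕ → ℕ → Test} {A B : ℕ → Prop}
    {R : ℕ → ℕ → Prop} (D : Decides n M₀ φA φB φR A B R) {M : Mem} (h : Agree M₀ M) : M 0 = n :=
  (h.apply_of_nonneg le_rfl).trans D.size

section Commands

variable (φ : Test) (φA φB : ℕ → Test) (φR : ℕ → ℕ → Test)

/-- Set all prices and owners to `0`. -/
def reset : Cmd :=
  .rep 3 1 0 (.seq (putPrice (.var 3) (.const 0)) (putOwner (.var 3) (.const 0)))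

/-- Clear the flag `1` if the element in the variable `3` has a neighbour in its own class. -/
def checkRow : Cmd :=
  .rep 4 1 0 (.cond (.and (φR 3 4) (.or (.and (φA 3) (φA 4)) (.and (φB 3) (φB 4))))
    (.set 1 (.const 0)) .nop)

/-- Record in the flag `1` whether neither `A` nor `B` contains an edge. -/
def check : Cmd := .seq (.set 1 (.const 1)) (.rep 3 1 0 (checkRow φA φB φR))

/-- Record in the flag `5` whether the element in the variable `3` owns an element. -/
def findOwned : Cmd :=
  .seq (.set 5 (.const 0)) (.rep 4 1 0
    (.cond (.and (φB 4) (.eq (ownerExpr (.var 4)) (.add (.var 3) (.const 1))))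
      (.set 5 (.const 1)) .nop))

/-- Find the cheapest choice of the element in the variable `3`, among those of price at most
`n`. -/
def findChoice : Cmd :=
  .seq (.set 6 (.const (-1))) (.seq (.set 7 (.bound 1 1)) (.rep 4 1 0
    (.cond (.and (φB 4) (.and (φR 3 4) (.lt (priceExpr (.var 4)) (.var 7))))
      (.seq (.set 6 (.var 4)) (.set 7 (priceExpr (.var 4)))) .nop)))

/-- Find out what the element in the variable `3` owns and chooses. -/
def scan : Cmd := .seq (findOwned φB) (findChoice φB φR)

/-- The test that the element in the variable `3` wants to bid, according to a scan. -/
def wantsToBid : Test := .and (φA 3) (.and (.le (.var 5) (.const 0)) (.lt (.const (-1)) (.var 6)))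

/-- Let the element in the variable `3` raise the price of its choice. -/
def raise : Cmd :=
  .seq (putPrice (.var 6) (.add (.var 7) (.const 1))) (putOwner (.var 6) (.add (.var 3) (.const 1)))

/-- Let the element in the variable `3` bid if it wants to. -/
def bid : Cmd := .seq (scan φB φR) (.cond (wantsToBid φA) raise .nop)

/-- Let every element bid once. -/
def pass : Cmd := .rep 3 1 0 (bid φA φB φR)

/-- Let every element bid `n + 1` times. -/
def passes : Cmd := .rep 9 1 1 (pass φA φB φR)

/-- All rounds of the auction. -/
def auction : Cmd := .rep 8 1 1 (passes φA φB φR)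

/-- Add to the variable `2` the number of elements with the property that the test `φ` decides for
the variable `3`. -/
def tally : Cmd := .rep 3 1 0 (.cond φ (.set 2 (.add (.var 2) (.const 1))) .nop)

/-- Compute the value of the auction in the variable `2`. -/
def count : Cmd :=
  .seq (.set 2 (.const 0))
    (.seq (tally (φA 3)) (tally (.and (φB 3) (.le (priceExpr (.var 3)) (.const 0)))))

/-- Raise the variable `0` to the value of the auction if neither `A` nor `B` contains an edge. -/
def improve : Cmd :=
  .seq (check φA φB φR) (.seq reset (.seq (auction φA φB φR) (.seq (count φA φB)
    (.cond (.and (.lt (.const 0) (.var 1)) (.lt (.var 0) (.var 2))) (.set 0 (.var 2)) .nop))))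

theorem writes_scan_subset : (scan φB φR).writes ⊆ var '' Set.Icc 4 7 := by
  simp [scan, findOwned, findChoice, writes, Set.insert_subset_iff]

theorem writes_bid_subset : (bid φA φB φR).writes ⊆ var '' Set.Icc 4 7 ∪ array :=
  Set.union_subset_union (writes_scan_subset φB φR)
    (Set.union_subset (Set.union_subset subset_rfl subset_rfl) (Set.empty_subset _))

theorem ok_improve : (improve φA φB φR).Ok := by
  simp [improve, check, checkRow, reset, auction, passes, pass, bid, scan, raise, findOwned,
    findChoice, count, tally, putPrice, putOwner, Ok, writes]

theorem writes_improve_subset : (improve φA φB φR).writes ⊆ locals := by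
  simp [improve, check, checkRow, reset, auction, passes, pass, bid, scan, raise, findOwned,
    findChoice, count, tally, putPrice, putOwner, writes, Set.insert_subset_iff]

end Commands

theorem den_reset {n : ℕ} {M : Mem} (hn : M 0 = n) :
    ∀ b < n, price (den reset M) b = 0 ∧ owner (den reset M) b = 0 := by
  refine rep_range_induction (I := fun k M' => ∀ b < k, price M' b = 0 ∧ owner M' b = 0)
    (by simp [writes, putPrice, putOwner]) hn (by simp) fun k _ M' _ hk hI b hb => ?_
  rw [den, den_putPrice (e := .var 3) hk, den_putOwner (e := .var 3) (by simpa using hk)]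
  simp only [Expr.eval, price_update_var, owner_update_var, price_update_owner, price_update_price,
    owner_update_owner, owner_update_price, Function.update_apply]
  grind

/-- The elements `a` and `b` are joined by an edge within one of the classes `A` and `B`. -/
def Clash (A B : ℕ → Prop) (R : ℕ → ℕ → Prop) (a b : ℕ) : Prop :=
  R a b ∧ (A a ∧ A b ∨ B a ∧ B b)

/-- Among the elements below `k`, `x` is the cheapest choice of `a` of price at most `n`, and `y` is
its price. If there is none, then `x` is `-1` and `y` is `n + 1`. -/
structure Found (n : ℕ) (B : ℕ → Prop) (R : ℕ → ℕ → Prop) (X : ℕ → ℤ) (a k : ℕ) (x y : ℤ) :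
    Prop where
  le : ∀ b < k, B b → R a b → y ≤ X b
  choice : x = -1 ∧ y = n + 1 ∨ ∃ b < k, B b ∧ R a b ∧ x = b ∧ y = X b ∧ y < n + 1

namespace Found

variable {n : ℕ} {B : ℕ → Prop} {R : ℕ → ℕ → Prop} {X : ℕ → ℤ} {a k : ℕ} {x y : ℤ}

theorem zero : Found n B R X a 0 (-1) (n + 1) := ⟨by simp, .inl ⟨rfl, rfl⟩⟩

theorem skip (h : Found n B R X a k x y) (hk : B k → R a k → y ≤ X k) :
    Found n B R X a (k + 1) x y where
  le := Nat.forall_lt_succ_right.2 ⟨h.le, hk⟩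
  choice := h.choice.imp_right fun ⟨b, hb, hb'⟩ => ⟨b, hb.trans k.lt_succ_self, hb'⟩

theorem take (h : Found n B R X a k x y) (hB : B k) (hR : R a k) (hX : X k < y) :
    Found n B R X a (k + 1) k (X k) where
  le := Nat.forall_lt_succ_right.2 ⟨fun b hb hBb hRb => hX.le.trans (h.le b hb hBb hRb),
    fun _ _ => le_rfl⟩
  choice := .inr ⟨k, k.lt_succ_self, hB, hR, rfl, rfl, by
    rcases h.choice with ⟨-, rfl⟩ | ⟨-, -, -, -, -, -, hy⟩
    exacts [hX, hX.trans hy]⟩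

theorem neg_one_lt_iff (h : Found n B R X a n x y) :
    -1 < x ↔ ¬ ∀ b < n, B b → R a b → (n : ℤ) + 1 ≤ X b := by
  rcases h.choice with ⟨rfl, rfl⟩ | ⟨b, hb, hB, hR, rfl, rfl, hX⟩
  · simpa using h.le
  · exact iff_of_true (by omega) fun hall => hX.not_ge (hall b hb hB hR)

end Found

namespace Decides

variable {n : ℕ} {M₀ M : Mem} {φA φB : ℕ → Test} {φR : ℕ → ℕ → Test} {A B : ℕ → Prop}
  {R : ℕ → ℕ → Prop}

theorem den_checkRow (D : Decides n M₀ φA φB φR A B R) (h : Agree M₀ M) {a : ℕ} (ha : a < n)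
    (h3 : M (var 3) = a) : 0 < den (checkRow φA φB φR) M (var 1) ↔
      0 < M (var 1) ∧ ∀ b < n, ¬ Clash A B R a b := by
  refine rep_range_induction (I := fun k M' => 0 < M' (var 1) ↔
    0 < M (var 1) ∧ ∀ b < k, ¬ Clash A B R a b) (by simp [writes]) (D.zero_eq h) (by simp)
    fun b hb M' hM' h4 hI => ?_
  have hA : Agree M₀ M' := h.of_eqOn hM' (by simp [writes, Set.insert_subset_iff])
  have h3' : M' (var 3) = a := (hM' (by simp [writes])).trans h3
  have hsat : (Test.and (φR 3 4) (.or (.and (φA 3) (φA 4)) (.and (φB 3) (φB 4)))).Sat M' ↔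
      Clash A B R a b := by
    simp only [Test.sat_and, Test.sat_or, Clash, D.sat_R _ hA 3 4 a ha b hb h3' h4,
      D.sat_A _ hA 3 a ha h3', D.sat_A _ hA 4 b hb h4, D.sat_B _ hA 3 a ha h3',
      D.sat_B _ hA 4 b hb h4]
  rw [update_var_apply, if_neg (by decide), Nat.forall_lt_succ_right, ← and_assoc, ← hI, den, hsat]
  split_ifs with hc <;> simp [den, Expr.eval, hc]

theorem den_check (D : Decides n M₀ φA φB φR A B R) (h : Agree M₀ M) :
    0 < den (check φA φB φR) M (var 1) ↔ ∀ a < n, ∀ b < n, ¬ Clash A B R a b := by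
  have h1 := h.update (i := 1) (by norm_num) 1
  refine rep_range_induction (I := fun k M' => 0 < M' (var 1) ↔
    ∀ a < k, ∀ b < n, ¬ Clash A B R a b) (by simp [writes, checkRow]) (D.zero_eq h1) ?_
    fun a ha M' hM' h3 hI => ?_
  · simp
  · have hA : Agree M₀ M' :=
      h1.of_eqOn hM' (by simp [writes, checkRow, Set.insert_subset_iff])
    rw [update_var_apply, if_neg (by decide), D.den_checkRow hA ha h3, hI,
      Nat.forall_lt_succ_right]

theorem den_findOwned (D : Decides n M₀ φA φB φR A B R) (h : Agree M₀ M) {a : ℕ}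
    (h3 : M (var 3) = a) :
    0 < den (findOwned φB) M (var 5) ↔ ∃ b < n, B b ∧ Owns (owner M) a b := by
  have h5 := h.update (i := 5) (by norm_num) 0
  refine rep_range_induction (I := fun k M' => 0 < M' (var 5) ↔
    ∃ b < k, B b ∧ Owns (owner M) a b) (by simp [writes]) (D.zero_eq h5) (by simp)
    fun b hb M' hM' h4 hI => ?_
  have hA : Agree M₀ M' := h5.of_eqOn hM' (by simp [writes, Set.insert_subset_iff])
  have h3' : M' (var 3) = a := (hM' (by simp [writes])).trans (by simpa using h3)
  have howner : owner M' = owner M :=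
    (owner_congr hM' (by simp [writes, Set.insert_subset_iff])).trans owner_update_var
  have hsat : (Test.and (φB 4) (.eq (ownerExpr (.var 4)) (.add (.var 3) (.const 1)))).Sat M' ↔
      B b ∧ Owns (owner M) a b := by
    simp only [Test.sat_and, Test.sat_eq, D.sat_B _ hA 4 b hb h4, eval_ownerExpr (e := .var 4) h4,
      howner, Expr.eval, Expr.eval_var, h3', Owns]
  rw [update_var_apply, if_neg (by decide), Nat.exists_lt_succ_right, ← hI, den, hsat]
  split_ifs with hc <;> simp [den, Expr.eval, hc]

theorem den_findChoice (D : Decides n M₀ φA φB φR A B R) (h : Agree M₀ M) {a : ℕ} (ha : a < n)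
    (h3 : M (var 3) = a) : Found n B R (price M) a n (den (findChoice φB φR) M (var 6))
      (den (findChoice φB φR) M (var 7)) := by
  rw [findChoice, den, den, den, den]
  set M₁ := Function.update (Function.update M (var 6) (Expr.eval M (.const (-1)))) (var 7) _
    with hM₁
  have h67 : Agree M₀ M₁ := (h.update (by norm_num) _).update (by norm_num) _
  refine rep_range_induction (I := fun k M' => Found n B R (price M) a k (M' (var 6)) (M' (var 7)))
    (by simp [writes]) (D.zero_eq h67) ?_ fun b hb M' hM' h4 hI => ?_
  · have h6 := D.zero_eq (h.update (i := 6) (by norm_num) (-1))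
    simpa [hM₁, Expr.eval, Expr.eval_bound h6] using Found.zero
  have hA : Agree M₀ M' := h67.of_eqOn hM' (by simp [writes, Set.insert_subset_iff])
  have h3' : M' (var 3) = a := (hM' (by simp [writes])).trans (by simpa [hM₁] using h3)
  have hprice : price M' = price M :=
    (price_congr hM' (by simp [writes, Set.insert_subset_iff])).trans (by simp [hM₁])
  have eval_price : ∀ {M'' : Mem}, price M'' = price M → M'' (var 4) = b →
      (priceExpr (.var 4)).eval M'' = price M b := fun hp h4 => by
    rw [eval_priceExpr (e := .var 4) h4, hp]
  have hsat : (Test.and (φB 4) (.and (φR 3 4) (.lt (priceExpr (.var 4)) (.var 7)))).Sat M' ↔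
      B b ∧ R a b ∧ price M b < M' (var 7) := by
    simp only [Test.sat_and, Test.sat_lt, D.sat_B _ hA 4 b hb h4,
      D.sat_R _ hA 3 4 a ha b hb h3' h4, eval_price hprice h4, Expr.eval_var]
  rw [update_var_apply, if_neg (by decide), update_var_apply, if_neg (by decide), den, hsat]
  split_ifs with hc
  · rw [den, den, den, eval_price (by simpa using hprice) (by simpa using h4)]
    simpa [h4] using hI.take hc.1 hc.2.1 hc.2.2
  · exact hI.skip fun hB hR => not_lt.1 fun hX => hc ⟨hB, hR, hX⟩

theorem den_scan (D : Decides n M₀ φA φB φR A B R) (h : Agree M₀ M) {a : ℕ} (ha : a < n)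
    (h3 : M (var 3) = a) :
    (0 < den (scan φB φR) M (var 5) ↔ ∃ b < n, B b ∧ Owns (owner M) a b) ∧
      Found n B R (price M) a n (den (scan φB φR) M (var 6)) (den (scan φB φR) M (var 7)) := by
  have hM' := eqOn_den (findOwned φB) M
  have h5 := eqOn_den (findChoice φB φR) (den (findOwned φB) M)
  have := D.den_findChoice (h.den (c := findOwned φB)
    (by simp [findOwned, writes, Set.insert_subset_iff])) ha
    ((hM' (by simp [findOwned, writes])).trans h3)
  rw [price_congr hM' (by simp [findOwned, writes, Set.insert_subset_iff])] at this
  exact ⟨by rw [scan, den, h5 (by simp [findChoice, writes]), D.den_findOwned h h3], this⟩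

theorem sat_wantsToBid (D : Decides n M₀ φA φB φR A B R) (h : Agree M₀ M) {a : ℕ} (ha : a < n)
    (h3 : M (var 3) = a) : (wantsToBid φA).Sat (den (scan φB φR) M) ↔
      ¬ Content n A B R (price M) (owner M) a := by
  obtain ⟨h5, hf⟩ := D.den_scan h ha h3
  have hA := h.den (c := scan φB φR) ((writes_scan_subset φB φR).trans fun x => by
    rintro ⟨i, hi, rfl⟩
    exact var_mem_locals.2 (hi.2.trans_lt (by norm_num)))
  have h3' := (eqOn_den (scan φB φR) M fun hw => by
    simpa using writes_scan_subset φB φR hw).trans h3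
  rw [not_content, ← h5, ← hf.neg_one_lt_iff, not_lt, ← D.sat_A _ hA 3 a ha h3', wantsToBid]
  simp only [Test.sat_and, Test.sat_le, Test.sat_lt, Expr.eval, Expr.eval_var]

theorem den_bid_of_content (D : Decides n M₀ φA φB φR A B R) (h : Agree M₀ M) {a : ℕ} (ha : a < n)
    (h3 : M (var 3) = a) (hc : Content n A B R (price M) (owner M) a) :
    price (den (bid φA φB φR) M) = price M ∧ owner (den (bid φA φB φR) M) = owner M := by
  have hw : (scan φB φR).writes ⊆ Set.range var :=
    (writes_scan_subset φB φR).trans (Set.image_subset_range _ _)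
  rw [bid, den, den, if_neg fun hs => (D.sat_wantsToBid h ha h3).1 hs hc]
  exact ⟨price_congr (eqOn_den _ M) hw, owner_congr (eqOn_den _ M) hw⟩

theorem den_bid_of_not_content (D : Decides n M₀ φA φB φR A B R) (h : Agree M₀ M) {a : ℕ}
    (ha : a < n) (h3 : M (var 3) = a) (hI : Inv n A B R (price M) (owner M))
    (hc : ¬ Content n A B R (price M) (owner M) a) :
    Inv n A B R (price (den (bid φA φB φR) M)) (owner (den (bid φA φB φR) M)) ∧
      ∑ b ∈ Finset.range n, price (den (bid φA φB φR) M) b =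
        ∑ b ∈ Finset.range n, price M b + 1 := by
  have hw : (scan φB φR).writes ⊆ Set.range var :=
    (writes_scan_subset φB φR).trans (Set.image_subset_range _ _)
  have hX := price_congr (eqOn_den (scan φB φR) M) hw
  have hY := owner_congr (eqOn_den (scan φB φR) M) hw
  have h3' := (eqOn_den (scan φB φR) M fun hw => by
    simpa using writes_scan_subset φB φR hw).trans h3
  obtain ⟨-, hf⟩ := D.den_scan h ha h3
  rw [bid, den, den, if_pos ((D.sat_wantsToBid h ha h3).2 hc)]
  generalize den (scan φB φR) M = M' at hX hY h3' hf ⊢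
  obtain ⟨hA, hown, hall⟩ := not_content.1 hc
  obtain ⟨h6, -⟩ | ⟨b, hb, hB, hR, h6, h7, hlt⟩ := hf.choice
  · exact absurd (hf.neg_one_lt_iff.2 hall) (by omega)
  rw [raise, den, den_putPrice (e := .var 6) h6, den_putOwner (e := .var 6) (by simpa using h6),
    price_update_owner, price_update_price, owner_update_owner, owner_update_price]
  simp only [Expr.eval, Expr.eval_var, update_cell_apply_var, h3', h7, hX, hY]
  exact ⟨hI.bid ha hA hown hb hB hR (h7 ▸ hlt) (h7 ▸ hf.le), sum_update hb⟩

theorem den_pass (D : Decides n M₀ φA φB φR A B R) (h : Agree M₀ M)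
    (hI : Inv n A B R (price M) (owner M)) :
    Inv n A B R (price (den (pass φA φB φR) M)) (owner (den (pass φA φB φR) M)) ∧
      (Stable n A B R (price (den (pass φA φB φR) M)) (owner (den (pass φA φB φR) M)) ∨
        ¬ Stable n A B R (price M) (owner M) ∧ ∑ b ∈ Finset.range n, price M b + 1 ≤
          ∑ b ∈ Finset.range n, price (den (pass φA φB φR) M) b) := by
  suffices H : Inv n A B R (price (den (pass φA φB φR) M)) (owner (den (pass φA φB φR) M)) ∧
      (price (den (pass φA φB φR) M) = price M ∧ owner (den (pass φA φB φR) M) = owner M ∧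
          (∀ a < n, Content n A B R (price M) (owner M) a) ∨
        ¬ Stable n A B R (price M) (owner M) ∧ ∑ b ∈ Finset.range n, price M b + 1 ≤
          ∑ b ∈ Finset.range n, price (den (pass φA φB φR) M) b) from
    H.imp_right <| .imp_left fun ⟨hX, hY, hc⟩ => by rwa [hX, hY]
  refine rep_range_induction (I := fun k M' => Inv n A B R (price M') (owner M') ∧
    (price M' = price M ∧ owner M' = owner M ∧
        (∀ a < k, Content n A B R (price M) (owner M) a) ∨
      ¬ Stable n A B R (price M) (owner M) ∧ ∑ b ∈ Finset.range n, price M b + 1 ≤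
        ∑ b ∈ Finset.range n, price M' b))
    (fun hw => by simpa using writes_bid_subset φA φB φR hw) (D.zero_eq h) (by simp [hI])
    fun a ha M' hM' h3 ⟨hI', hor⟩ => ?_
  have hA : Agree M₀ M' := h.of_eqOn hM' (by
    simp [writes, bid, scan, raise, putPrice, putOwner, findOwned, findChoice,
      Set.insert_subset_iff])
  rw [price_update_var, owner_update_var]
  by_cases hc : Content n A B R (price M') (owner M') a
  · obtain ⟨hX, hY⟩ := D.den_bid_of_content hA ha h3 hc
    rw [hX, hY]
    refine ⟨hI', hor.imp_left fun ⟨hXM, hYM, hall⟩ => ⟨hXM, hYM, ?_⟩⟩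
    exact Nat.forall_lt_succ_right.2 ⟨hall, by rwa [hXM, hYM] at hc⟩
  · obtain ⟨hI'', hsum⟩ := D.den_bid_of_not_content hA ha h3 hI' hc
    refine ⟨hI'', .inr ?_⟩
    rw [hsum]
    rcases hor with ⟨hXM, hYM, -⟩ | ⟨hst, hle⟩
    · rw [hXM, hYM] at hc
      exact ⟨fun hst => hc (hst a ha), by rw [hXM]⟩
    · exact ⟨hst, hle.trans (lt_add_one _).le⟩

end Decides

/-- The state of the auction is stable or has made at least `m` steps. -/
def Progress (n : ℕ) (A B : ℕ → Prop) (R : ℕ → ℕ → Prop) (m : ℕ) (M : Mem) : Prop :=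
  Inv n A B R (price M) (owner M) ∧
    (Stable n A B R (price M) (owner M) ∨ (m : ℤ) ≤ ∑ b ∈ Finset.range n, price M b)

theorem progress_update_var {n m : ℕ} {A B : ℕ → Prop} {R : ℕ → ℕ → Prop} {M : Mem} {i : ℕ}
    {x : ℤ} : Progress n A B R m (Function.update M (var i) x) ↔ Progress n A B R m M := by
  simp only [Progress, price_update_var, owner_update_var]

namespace Decides

variable {n : ℕ} {M₀ M : Mem} {φA φB : ℕ → Test} {φR : ℕ → ℕ → Test} {A B : ℕ → Prop}
  {R : ℕ → ℕ → Prop}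

theorem progress_pass (D : Decides n M₀ φA φB φR A B R) (h : Agree M₀ M) {m : ℕ}
    (hM : Progress n A B R m M) : Progress n A B R (m + 1) (den (pass φA φB φR) M) := by
  obtain ⟨hI, hor⟩ := D.den_pass h hM.1
  refine ⟨hI, hor.imp_right fun ⟨hst, hle⟩ => ?_⟩
  rw [Nat.cast_succ]
  linarith [hM.2.resolve_left hst, hle]

theorem progress_passes (D : Decides n M₀ φA φB φR A B R) (h : Agree M₀ M) {m : ℕ}
    (hM : Progress n A B R m M) :
    Progress n A B R (m + (n + 1)) (den (passes φA φB φR) M) := by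
  have := rep_induction (i := 9) (a := 1) (b := 1) (c := pass φA φB φR) (M := M)
    (I := fun k M' => Progress n A B R (m + k) M') (by
      simp [pass, bid, scan, raise, putPrice, putOwner, findOwned, findChoice, writes])
    (D.zero_eq h) (progress_update_var.2 hM) fun k _ M' hM' _ hI => progress_update_var.2 ?_
  · rwa [one_mul] at this
  · exact D.progress_pass (h.of_eqOn hM' (by
      simp [pass, bid, scan, raise, putPrice, putOwner, findOwned, findChoice, writes,
        Set.insert_subset_iff])) hI

theorem progress_auction (D : Decides n M₀ φA φB φR A B R) (h : Agree M₀ M)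
    (hM : Progress n A B R 0 M) :
    Progress n A B R ((n + 1) * (n + 1)) (den (auction φA φB φR) M) := by
  have := rep_induction (i := 8) (a := 1) (b := 1) (c := passes φA φB φR) (M := M)
    (I := fun k M' => Progress n A B R (k * (n + 1)) M') (by
      simp [passes, pass, bid, scan, raise, putPrice, putOwner, findOwned, findChoice, writes])
    (D.zero_eq h) (progress_update_var.2 (by rwa [zero_mul])) fun k _ M' hM' _ hI =>
      progress_update_var.2 ?_
  · rwa [one_mul] at this
  · rw [Nat.succ_mul]
    exact D.progress_passes (h.of_eqOn hM' (by
      simp [passes, pass, bid, scan, raise, putPrice, putOwner, findOwned, findChoice, writes,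
        Set.insert_subset_iff])) hI

theorem inv_auction_and_stable_auction (D : Decides n M₀ φA φB φR A B R) (h : Agree M₀ M)
    (hX : ∀ b < n, price M b = 0) (hY : ∀ b < n, owner M b = 0) :
    Inv n A B R (price (den (auction φA φB φR) M)) (owner (den (auction φA φB φR) M)) ∧
      Stable n A B R (price (den (auction φA φB φR) M)) (owner (den (auction φA φB φR) M)) := by
  obtain ⟨hI, hor⟩ := D.progress_auction h ⟨.start hX hY, .inr (by
    rw [Finset.sum_eq_zero fun b hb => hX b (Finset.mem_range.1 hb), Nat.cast_zero])⟩
  refine ⟨hI, hor.resolve_right fun hle => ?_⟩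
  have := hI.sum_le
  push_cast at hle
  linarith

end Decides

open Classical in
theorem den_tally {φ : Test} {n : ℕ} {M : Mem} {P : ℕ → Prop} (hn : M 0 = n)
    (hφ : ∀ M', Set.EqOn M' M (tally φ).writesᶜ → ∀ v < n, M' (var 3) = v → (φ.Sat M' ↔ P v)) :
    den (tally φ) M (var 2) = M (var 2) + ((Finset.range n).filter P).card := by
  refine rep_range_induction (I := fun k M' =>
    M' (var 2) = M (var 2) + ((Finset.range k).filter P).card) (by simp [writes]) hn (by simp)
    fun v hv M' hM' h3 hI => ?_
  rw [update_var_apply, if_neg (by decide), den, hφ M' hM' v hv h3, Finset.range_add_one,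
    Finset.filter_insert]
  split_ifs with hP
  · rw [Finset.card_insert_of_notMem (by simp), den]
    simp [Expr.eval, hI, add_assoc]
  · rw [den, hI]

namespace Decides

variable {n : ℕ} {M₀ M : Mem} {φA φB : ℕ → Test} {φR : ℕ → ℕ → Test} {A B : ℕ → Prop}
  {R : ℕ → ℕ → Prop}

theorem den_count (D : Decides n M₀ φA φB φR A B R) (h : Agree M₀ M) :
    den (count φA φB) M (var 2) = value n A B (price M) := by
  have writes_tally : ∀ φ, (tally φ).writes ⊆ var '' Set.Iio 10 := fun φ => by
    simp [tally, writes, Set.insert_subset_iff]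
  have tally_agree : ∀ {φ M' M''}, Agree M₀ M' → Set.EqOn M'' M' (tally φ).writesᶜ →
      Agree M₀ M'' := fun hA hM'' => hA.of_eqOn hM'' ((writes_tally _).trans Set.subset_union_left)
  have tally_price : ∀ {φ M' M''}, Set.EqOn M'' M' (tally φ).writesᶜ → price M'' = price M' :=
    fun hM'' => price_congr hM'' ((writes_tally _).trans (Set.image_subset_range _ _))
  rw [count, den, den, den]
  have h2 := h.update (i := 2) (by norm_num) (Expr.eval M (.const 0))
  have hX2 : price (Function.update M (var 2) (Expr.eval M (.const 0))) = price M :=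
    price_update_var
  have hA := tally_agree h2 (eqOn_den (tally (φA 3)) _)
  rw [den_tally (P := fun b => B b ∧ ¬ 0 < price M b) (D.zero_eq hA) fun M' hM' b hb h3 => ?_,
    den_tally (P := A) (D.zero_eq h2) fun M' hM' a ha h3 =>
      D.sat_A _ (tally_agree h2 hM') 3 a ha h3]
  · simp only [Expr.eval, update_var_apply, if_true, zero_add, value, not_lt, Nat.cast_add]
    congr
  · rw [Test.sat_and, Test.sat_le, eval_priceExpr (e := .var 3) h3, tally_price hM',
      tally_price (eqOn_den _ _), hX2, D.sat_B _ (tally_agree hA hM') 3 b hb h3, not_lt, Expr.eval]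

open Classical in
theorem den_improve (D : Decides n M φA φB φR A B R) (hAB : ∀ v, A v → ¬ B v) :
    ∃ m : ℕ, IsGreatest (Finset.card '' {s | Independent n A B R s}) m ∧
      den (improve φA φB φR) M (var 0) =
        if ∀ a < n, ∀ b < n, ¬ Clash A B R a b then max (M (var 0)) m else M (var 0) := by
  have hcheck := (Agree.refl M).den (c := check φA φB φR) (by
    simp [check, checkRow, writes, Set.insert_subset_iff])
  have hreset := hcheck.den (c := reset) (by
    simp [reset, putPrice, putOwner, writes, Set.insert_subset_iff])
  have hauction := hreset.den (c := auction φA φB φR) (by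
    simp [auction, passes, pass, bid, scan, raise, putPrice, putOwner, findOwned, findChoice,
      writes, Set.insert_subset_iff])
  have hzero := den_reset (D.zero_eq hcheck)
  obtain ⟨hI, hst⟩ := D.inv_auction_and_stable_auction hreset (fun b hb => (hzero b hb).1)
    fun b hb => (hzero b hb).2
  have hvalue := D.den_count hauction
  have hflag := D.den_check (Agree.refl M)
  have preserved : ∀ i < 2, den (count φA φB) (den (auction φA φB φR) (den reset
      (den (check φA φB φR) M))) (var i) = den (check φA φB φR) M (var i) := fun i hi => by
    rw [eqOn_den _ _, eqOn_den _ _, eqOn_den _ _] <;>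
      simp [count, tally, auction, passes, pass, bid, scan, raise, putPrice, putOwner, findOwned,
        findChoice, reset, writes] <;> omega
  have hsize : den (check φA φB φR) M (var 0) = M (var 0) :=
    eqOn_den _ _ (by simp [check, checkRow, writes])
  obtain ⟨s, hs, hcard⟩ := hI.exists_card_eq_value hst hAB
  refine ⟨_, ⟨⟨s, hs, hcard⟩, fun _ ⟨s', hs', h⟩ => h ▸ hI.card_le_value hs' hAB⟩, ?_⟩
  rw [improve, den, den, den, den, den]
  simp only [Test.sat_and, Test.sat_lt, Expr.eval_var, Expr.eval, preserved _ one_lt_two,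
    preserved _ two_pos, hsize, hvalue, hflag, ite_and, den]
  split_ifs with hclash hlt
  · exact (max_eq_right hlt.le).symm
  · exact (preserved 0 two_pos).trans (hsize.trans (max_eq_left (not_lt.1 hlt)).symm)
  · exact (preserved 0 two_pos).trans hsize

theorem le_den_improve (D : Decides n M φA φB φR A B R) (hAB : ∀ v, A v → ¬ B v) :
    M (var 0) ≤ den (improve φA φB φR) M (var 0) := by
  obtain ⟨m, -, h⟩ := D.den_improve hAB
  rw [h]
  split_ifs
  exacts [le_max_left _ _, le_rfl]

theorem card_le_den_improve (D : Decides n M φA φB φR A B R) (hAB : ∀ v, A v → ¬ B v)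
    (hclash : ∀ a < n, ∀ b < n, ¬ Clash A B R a b) {s : Finset ℕ} (hs : Independent n A B R s) :
    s.card ≤ den (improve φA φB φR) M (var 0) := by
  obtain ⟨m, hm, h⟩ := D.den_improve hAB
  rw [h, if_pos hclash]
  exact le_max_of_le_right (Nat.cast_le.2 (hm.2 ⟨s, hs, rfl⟩))

theorem den_improve_le (D : Decides n M φA φB φR A B R) (hAB : ∀ v, A v → ¬ B v)
    (hR : ∀ a b, R a b → R b a) {ω : ℕ}
    (hω : ∀ s : Finset ℕ, (∀ v ∈ s, v < n) → (∀ a ∈ s, ∀ b ∈ s, ¬ R a b) → s.card ≤ ω)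
    (hM : M (var 0) ≤ ω) : den (improve φA φB φR) M (var 0) ≤ ω := by
  obtain ⟨m, ⟨⟨s, ⟨hs, hsR⟩, rfl⟩, -⟩, h⟩ := D.den_improve hAB
  rw [h]
  split_ifs with hclash
  · refine max_le hM (Nat.cast_le.2 (hω s (fun v hv => (hs v hv).1) fun a ha b hb hab => ?_))
    have hno := hclash a (hs a ha).1 b (hs b hb).1
    rcases (hs a ha).2 with hAa | hBa <;> rcases (hs b hb).2 with hAb | hBb
    · exact hno ⟨hab, .inl ⟨hAa, hAb⟩⟩
    · exact hsR a ha b hb hAa hBb hab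
    · exact hsR b hb a ha hAb hBa (hR a b hab)
    · exact hno ⟨hab, .inr ⟨hBa, hBb⟩⟩
  · exact hM

end Decides

end Auction

/-! ### Exhaustive search by nested loops -/

namespace Cmd

/-- The command preserves the property `P` of the memory. -/
def Preserves (c : Cmd) (P : Mem → Prop) : Prop := ∀ M, P M → P (den c M)

/-- The property `P` of the memory survives assignments of natural numbers to the variable `i`. -/
def Ignores (i : ℕ) (P : Mem → Prop) : Prop := ∀ (k : ℕ) M, P M → P (Function.update M (var i) k)

section Rep

variable {i a b n : ℕ} {c : Cmd} {P Q : Mem → Prop}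

theorem Preserves.rep (hi : var i ∉ c.writes) (hn : ∀ M, P M → M 0 = n) (hP : Ignores i P)
    (hc : c.Preserves P) : (rep i a b c).Preserves P := fun M hM =>
  rep_induction (I := fun _ => P) hi (hn M hM) (hP 0 M hM) fun k _ _ _ _ h => by
    exact_mod_cast hP (k + 1) _ (hc _ h)

theorem rep_reaches (hi : var i ∉ c.writes) (hn : ∀ M, P M → M 0 = n) (hP : Ignores i P)
    (hQ : Ignores i Q) (hcP : c.Preserves P) (hcQ : c.Preserves Q) {k : ℕ} (hk : k < a * n + b)
    (reach : ∀ M, P M → M (var i) = k → Q (den c M)) {M : Mem} (hM : P M) :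
    Q (den (rep i a b c) M) := by
  refine (rep_induction (I := fun l M' => P M' ∧ (k < l → Q M')) hi (hn M hM)
    ⟨hP 0 M hM, by simp⟩ fun l _ M' _ hl ⟨hPM', hQM'⟩ => ?_).2 hk
  rw [← Nat.cast_succ]
  refine ⟨hP _ _ (hcP M' hPM'), fun hkl => hQ _ _ ?_⟩
  rcases Nat.lt_succ_iff_lt_or_eq.1 hkl with hkl | rfl
  exacts [hcQ M' (hQM' hkl), reach M' hPM' hl]

end Rep

/-- Run a command for all values of `m` pairs of variables, the first of which runs through the
addresses of the input and the second through `0`, `1`, `2`. -/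
def nest : ℕ → Cmd → Cmd
  | 0, c => c
  | t + 1, c => .rep (10 + 2 * t) 8 1 (.rep (11 + 2 * t) 0 3 (nest t c))

section Nest

variable {n m i : ℕ} {c : Cmd} {P Q : Mem → Prop}

theorem lt_of_var_mem_writes_nest (hc : c.writes ⊆ Auction.locals)
    (hi : var i ∈ (nest m c).writes) : i < 10 + 2 * m := by
  induction m with
  | zero => exact Auction.var_mem_locals.1 (hc hi)
  | succ m ih =>
    rcases hi with hi | hi | hi
    · have := var_inj.1 hi
      omega
    · have := var_inj.1 hi
      omega
    · have := ih hi
      omega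

theorem var_notMem_writes_nest (hc : c.writes ⊆ Auction.locals) (hi : 10 + 2 * m ≤ i) :
    var i ∉ (nest m c).writes := fun h => (lt_of_var_mem_writes_nest hc h).not_ge hi

theorem var_notMem_writes_rep_nest (hc : c.writes ⊆ Auction.locals) :
    var (10 + 2 * m) ∉ (rep (11 + 2 * m) 0 3 (nest m c)).writes := by
  rintro (h | h)
  · have := var_inj.1 h
    omega
  · exact var_notMem_writes_nest hc le_rfl h

theorem Ok.nest (hok : c.Ok) (hc : c.writes ⊆ Auction.locals) : (nest m c).Ok := by
  induction m with
  | zero => exact hok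
  | succ m ih =>
    exact ⟨var_notMem_writes_rep_nest hc, var_notMem_writes_nest hc (by omega), ih⟩

theorem Preserves.nest (hc : c.writes ⊆ Auction.locals) (hn : ∀ M, P M → M 0 = n)
    (hP : ∀ i, 10 ≤ i → i < 10 + 2 * m → Ignores i P) (hcP : c.Preserves P) :
    (nest m c).Preserves P := by
  induction m with
  | zero => exact hcP
  | succ m ih =>
    exact .rep (var_notMem_writes_rep_nest hc) hn (hP _ (by omega) (by omega)) <|
      .rep (var_notMem_writes_nest hc (by omega)) hn (hP _ (by omega) (by omega)) <|
        ih fun i hi hi' => hP i hi (by omega)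

theorem Ignores.and_var_eq {j : ℕ} {x : ℤ} (hP : Ignores i P) (hj : j ≠ i) :
    Ignores i fun M => P M ∧ M (var j) = x := fun k M hM =>
  ⟨hP k M hM.1, (Function.update_of_ne (var_inj.not.2 hj) _ _).trans hM.2⟩

theorem Preserves.and_var_eq {j : ℕ} {x : ℤ} (hP : c.Preserves P) (hj : var j ∉ c.writes) :
    c.Preserves fun M => P M ∧ M (var j) = x := fun M hM =>
  ⟨hP M hM.1, (eqOn_den c M hj).trans hM.2⟩

theorem nest_reaches {J D : ℕ → ℕ} (hJ : ∀ t, J t < 8 * n + 1) (hD : ∀ t, D t < 3)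
    (hc : c.writes ⊆ Auction.locals) (hn : ∀ M, P M → M 0 = n) (hnQ : ∀ M, Q M → M 0 = n)
    (hP : ∀ i, 10 ≤ i → i < 10 + 2 * m → Ignores i P)
    (hQ : ∀ i, 10 ≤ i → i < 10 + 2 * m → Ignores i Q) (hcP : c.Preserves P) (hcQ : c.Preserves Q)
    (reach : ∀ M, P M →
      (∀ t < m, M (var (10 + 2 * t)) = J t ∧ M (var (11 + 2 * t)) = D t) → Q (den c M))
    {M : Mem} (hM : P M) : Q (den (nest m c) M) := by
  induction m generalizing P M with
  | zero => exact reach M hM (by simp)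
  | succ m ih =>
    have outer := var_notMem_writes_nest (m := m) hc (le_refl (10 + 2 * m))
    have inner := var_notMem_writes_nest (m := m) hc (show 10 + 2 * m ≤ 11 + 2 * m by omega)
    have nest_P : (nest m c).Preserves P := .nest hc hn (fun i hi hi' => hP i hi (by omega)) hcP
    have nest_Q : (nest m c).Preserves Q := .nest hc hnQ (fun i hi hi' => hQ i hi (by omega)) hcQ
    have P_inner := hP (11 + 2 * m) (by omega) (by omega)
    have Q_inner := hQ (11 + 2 * m) (by omega) (by omega)
    refine rep_reaches (var_notMem_writes_rep_nest hc) hn (hP _ (by omega) (by omega))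
      (hQ _ (by omega) (by omega)) (.rep inner hn P_inner nest_P)
      (.rep inner hnQ Q_inner nest_Q) (hJ m) (fun M₁ h₁ hJ₁ => ?_) hM
    refine rep_reaches inner (P := fun M => P M ∧ M (var (10 + 2 * m)) = J m)
      (fun M h => hn M h.1) (P_inner.and_var_eq (by omega)) Q_inner (nest_P.and_var_eq outer)
      nest_Q (by simpa using hD m) (fun M₂ h₂ hD₂ => ?_) ⟨h₁, hJ₁⟩
    refine ih (P := fun M => (P M ∧ M (var (10 + 2 * m)) = J m) ∧ M (var (11 + 2 * m)) = D m)
      (fun M h => hn M h.1.1) (fun i hi hi' =>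
        ((hP i hi (by omega)).and_var_eq (by omega)).and_var_eq (by omega))
      (fun i hi hi' => hQ i hi (by omega))
      ((hcP.and_var_eq fun h => ?_).and_var_eq fun h => ?_)
      (fun M₃ h₃ hlt => reach M₃ h₃.1.1 (Nat.forall_lt_succ_right.2 ⟨hlt, h₃.1.2, h₃.2⟩))
      ⟨h₂, hD₂⟩
    all_goals
      have := Auction.var_mem_locals.1 (hc h)
      omega

end Nest

end Cmd

/-! ### Tests on the input -/

namespace ZShape

theorem spans_iff {k r α β : ℤ} {z : ZShape} : z.Spans k r α β ↔
    (k = 0 ∧ (2 * z.a = r ∧ z.lo z.a ≤ α ∧ β ≤ z.hi z.a ∨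
      2 * z.b = r ∧ z.lo z.b ≤ α ∧ β ≤ z.hi z.b)) ∨
    (k ≠ 0 ∧ 2 * z.c = r ∧ 2 * min z.a z.b ≤ α ∧ β ≤ 2 * max z.a z.b) := by
  refine or_congr_left (and_congr_right fun _ => ⟨?_, ?_⟩)
  · rintro ⟨s, hs, rfl | rfl, h⟩
    exacts [.inl ⟨hs, h⟩, .inr ⟨hs, h⟩]
  · rintro (⟨hs, h⟩ | ⟨hs, h⟩)
    exacts [⟨_, hs, .inl rfl, h⟩, ⟨_, hs, .inr rfl, h⟩]

theorem share_iff_corners {u v : ZShape} : Share u v ↔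
    (u.a = v.a ∧ Ov u.e u.c v.e v.c) ∨ (u.a = v.b ∧ Ov u.e u.c v.f v.c) ∨
      (u.b = v.a ∧ Ov u.f u.c v.e v.c) ∨ (u.b = v.b ∧ Ov u.f u.c v.f v.c) ∨
        (u.c = v.c ∧ Ov u.a u.b v.a v.b) := by
  simp only [share_iff, ← or_assoc]
  refine or_congr_left ⟨?_, ?_⟩
  · rintro ⟨r, hu | hu, hv | hv, h⟩ <;> rw [hu] at hv h
    · rw [tip_a, hv, tip_a] at h
      exact .inl (.inl (.inl ⟨hv, h⟩))
    · rw [tip_a, hv, tip_b] at h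
      exact .inl (.inl (.inr ⟨hv, h⟩))
    · rw [tip_b, hv, tip_a] at h
      exact .inl (.inr ⟨hv, h⟩)
    · rw [tip_b, hv, tip_b] at h
      exact .inr ⟨hv, h⟩
  · rintro (((⟨h, hov⟩ | ⟨h, hov⟩) | ⟨h, hov⟩) | ⟨h, hov⟩)
    · exact ⟨u.a, .inl rfl, .inl h, by rwa [tip_a, h, tip_a]⟩
    · exact ⟨u.a, .inl rfl, .inr h, by rwa [tip_a, h, tip_b]⟩
    · exact ⟨u.b, .inr rfl, .inl h, by rwa [tip_b, h, tip_a]⟩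
    · exact ⟨u.b, .inr rfl, .inr h, by rwa [tip_b, h, tip_b]⟩

theorem share_self (z : ZShape) : Share z z := by
  have hab := z.hab
  exact share_iff_corners.2 (.inr (.inr (.inr (.inr ⟨rfl, by unfold Ov; omega⟩))))

end ZShape

/-- The memory holds the paths of the vertices `0, …, n - 1` in the encoding of a representation:
eight cells for the four corners of each path, which repeat `a`, `b` and `c`. -/
structure Input (n : ℕ) (z : ℕ → ZShape) (M : Mem) : Prop where
  size : M 0 = n
  cell_e : ∀ v < n, M (8 * v + 1) = (z v).e
  cell_a : ∀ v < n, M (8 * v + 2) = (z v).a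
  cell_c : ∀ v < n, M (8 * v + 3) = (z v).c
  cell_b : ∀ v < n, M (8 * v + 6) = (z v).b
  cell_f : ∀ v < n, M (8 * v + 7) = (z v).f

/-- The content of the cell with the offset `o` in the block of the vertex in the variable `i`. The
offsets of `e`, `a`, `c`, `b`, `f` are `1`, `2`, `3`, `6`, `7`. -/
def Expr.entry (o i : ℕ) : Expr := .load (.add (.nmul 8 (.var i)) (.const o))

theorem Expr.eval_entry {M : Mem} {i v : ℕ} (hi : M (EPG.var i) = v) (o : ℕ) :
    (Expr.entry o i).eval M = M (8 * v + o) := by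
  simp [entry, eval, hi]

/-- A number given by two variables: a neighbour of the double of an input number, or the double
itself. -/
def Expr.param (t : ℕ) : Expr :=
  .sub (.add (.nmul 2 (.load (.var (10 + 2 * t)))) (.var (11 + 2 * t))) (.const 1)

theorem Expr.eval_param (M : Mem) (t : ℕ) : (Expr.param t).eval M =
    2 * M (M (EPG.var (10 + 2 * t))) + M (EPG.var (11 + 2 * t)) - 1 := by
  simp [param, eval]

/-- The interval number `s`, which is given by the variables of the parameters `4 * s, …,
4 * s + 3`. -/
def track (M : Mem) (s : ℕ) : Track where
  k := M (var (11 + 2 * (4 * s)))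
  r := (Expr.param (4 * s + 1)).eval M
  α := (Expr.param (4 * s + 2)).eval M
  β := (Expr.param (4 * s + 3)).eval M

namespace Test

/-- The part of `spans` on the row with the offset `y`, where the path ends at the offset `x`. -/
def spansRow (r α β : Expr) (y x i : ℕ) : Test :=
  .and (.eq (.nmul 2 (.entry y i)) r) (.and
    (.or (.le (.nmul 2 (.entry 3 i)) α) (.le (.add (.nmul 2 (.entry x i)) (.const 1)) α))
    (.or (.le β (.nmul 2 (.entry 3 i))) (.le β (.sub (.nmul 2 (.entry x i)) (.const 1)))))

/-- The test for `ZShape.Spans`. -/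
def spans (k r α β : Expr) (i : ℕ) : Test :=
  .or (.and (.eq k (.const 0)) (.or (spansRow r α β 2 1 i) (spansRow r α β 6 7 i)))
    (.and (.not (.eq k (.const 0))) (.and (.eq (.nmul 2 (.entry 3 i)) r) (.and
      (.or (.le (.nmul 2 (.entry 2 i)) α) (.le (.nmul 2 (.entry 6 i)) α))
      (.or (.le β (.nmul 2 (.entry 2 i))) (.le β (.nmul 2 (.entry 6 i)))))))

/-- The test for `ZShape.Ov`. -/
def ov (p q p' q' : Expr) : Test :=
  .and (.or (.or (.lt p p') (.lt q p')) (.or (.lt p q') (.lt q q')))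
    (.or (.or (.lt p' p) (.lt q' p)) (.or (.lt p' q) (.lt q' q)))

theorem sat_ov {M : Mem} {p q p' q' : Expr} : (ov p q p' q').Sat M ↔
    ZShape.Ov (p.eval M) (q.eval M) (p'.eval M) (q'.eval M) := by
  simp only [ov, sat_and, sat_or, sat_lt, ZShape.Ov, min_lt_iff, lt_max_iff]

/-- The test for a common edge on the rows with the offsets `y` and `y'`, where the paths end at the
offsets `x` and `x'`. -/
def shareRow (y x y' x' i j : ℕ) : Test :=
  .and (.eq (.entry y i) (.entry y' j)) (ov (.entry x i) (.entry 3 i) (.entry x' j) (.entry 3 j))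

/-- The test for `ZShape.Share`. -/
def share (i j : ℕ) : Test :=
  .or (shareRow 2 1 2 1 i j) (.or (shareRow 2 1 6 7 i j) (.or (shareRow 6 7 2 1 i j)
    (.or (shareRow 6 7 6 7 i j) (.and (.eq (.entry 3 i) (.entry 3 j))
      (ov (.entry 2 i) (.entry 6 i) (.entry 2 j) (.entry 6 j))))))

/-- The test for two distinct vertices whose paths do not share an edge. -/
def apart (i j : ℕ) : Test := .and (.not (.eq (.var i) (.var j))) (.not (share i j))

/-- The test for `Track.ContainedIn`. -/
def contained (s i : ℕ) : Test :=
  spans (.var (11 + 2 * (4 * s))) (.param (4 * s + 1)) (.param (4 * s + 2)) (.param (4 * s + 3)) i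

/-- The test for `Track.Touches`. -/
def touches (s i : ℕ) : Test :=
  spans (.var (11 + 2 * (4 * s))) (.param (4 * s + 1)) (.param (4 * s + 3)) (.param (4 * s + 2)) i

/-- The test for `Track.Cand` with the intervals `s`, `s + 1`, `s + 2`. -/
def cand (s i : ℕ) : Test :=
  .or (.and (contained s i) (touches (s + 1) i)) (.or
    (.and (contained (s + 1) i) (touches (s + 2) i)) (.and (contained (s + 2) i) (touches s i)))

/-- The test for the first clique. -/
def first (i : ℕ) : Test := cand 0 i

/-- The test for the second clique without the first one. -/
def second (i : ℕ) : Test := .and (cand 3 i) (.not (cand 0 i))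

end Test

/-- The path is a candidate for the three intervals from number `s` on. -/
def Candidate (M : Mem) (s : ℕ) (u : ZShape) : Prop :=
  Track.Cand (track M s) (track M (s + 1)) (track M (s + 2)) u

section Sat

open Test

variable {n i j v w : ℕ} {z : ℕ → ZShape} {M : Mem}

theorem Input.eval_entry (hM : Input n z M) (hv : v < n) (hi : M (var i) = v) :
    (Expr.entry 1 i).eval M = (z v).e ∧ (Expr.entry 2 i).eval M = (z v).a ∧
      (Expr.entry 3 i).eval M = (z v).c ∧ (Expr.entry 6 i).eval M = (z v).b ∧
        (Expr.entry 7 i).eval M = (z v).f := by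
  simp only [Expr.eval_entry hi]
  exact ⟨hM.cell_e v hv, hM.cell_a v hv, hM.cell_c v hv, hM.cell_b v hv, hM.cell_f v hv⟩

theorem Input.sat_spans (hM : Input n z M) (hv : v < n) (hi : M (var i) = v) {k r α β : Expr} :
    (spans k r α β i).Sat M ↔ (z v).Spans (k.eval M) (r.eval M) (α.eval M) (β.eval M) := by
  obtain ⟨he, ha, hc, hb, hf⟩ := hM.eval_entry hv hi
  rw [ZShape.spans_iff, mul_min_of_nonneg _ _ zero_le_two, mul_max_of_nonneg _ _ zero_le_two]
  simp only [spans, spansRow, sat_or, sat_and, sat_not, sat_eq, sat_le, Expr.eval, Expr.eval_nmul,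
    he, ha, hc, hb, hf, ZShape.lo, ZShape.hi, ZShape.tip_a, ZShape.tip_b, min_le_iff, le_max_iff,
    Nat.cast_ofNat, ne_eq]

theorem Input.sat_apart (hM : Input n z M) (hv : v < n) (hw : w < n) (hi : M (var i) = v)
    (hj : M (var j) = w) : (apart i j).Sat M ↔ v ≠ w ∧ ¬ ZShape.Share (z v) (z w) := by
  obtain ⟨he, ha, hc, hb, hf⟩ := hM.eval_entry hv hi
  obtain ⟨he', ha', hc', hb', hf'⟩ := hM.eval_entry hw hj
  simp only [apart, share, shareRow, sat_or, sat_and, sat_not, sat_eq, sat_ov, Expr.eval_var, hi,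
    hj, he, ha, hc, hb, hf, he', ha', hc', hb', hf', ZShape.share_iff_corners, Nat.cast_inj, ne_eq]

theorem Input.sat_cand (hM : Input n z M) (hv : v < n) (hi : M (var i) = v) {s : ℕ} :
    (cand s i).Sat M ↔ Candidate M s (z v) := by
  simp only [cand, contained, touches, sat_or, sat_and, hM.sat_spans hv hi]
  rfl

end Sat

section Decides

open Auction

variable {n : ℕ} {z : ℕ → ZShape} {M M' : Mem}

theorem Input.congr (hM : Input n z M) (h : ∀ x, 0 ≤ x → M' x = M x) : Input n z M' where
  size := (h _ (by positivity)).trans hM.size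
  cell_e v hv := (h _ (by positivity)).trans (hM.cell_e v hv)
  cell_a v hv := (h _ (by positivity)).trans (hM.cell_a v hv)
  cell_c v hv := (h _ (by positivity)).trans (hM.cell_c v hv)
  cell_b v hv := (h _ (by positivity)).trans (hM.cell_b v hv)
  cell_f v hv := (h _ (by positivity)).trans (hM.cell_f v hv)

theorem track_eq_of_agree (hpos : ∀ t, 0 ≤ M (var (10 + 2 * t))) (h : Agree M M') :
    track M' = track M := by
  have eval_param (t : ℕ) : (Expr.param t).eval M' = (Expr.param t).eval M := by
    rw [Expr.eval_param, Expr.eval_param, h.apply_var (by omega), h.apply_var (by omega),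
      h.apply_of_nonneg (hpos t)]
  funext s
  simp only [track, eval_param, h.apply_var (show 10 ≤ 11 + 2 * (4 * s) by omega)]

theorem Input.decides (hM : Input n z M) (hpos : ∀ t, 0 ≤ M (var (10 + 2 * t))) :
    Decides n M Test.first Test.second Test.apart (fun v => Candidate M 0 (z v))
      (fun v => Candidate M 3 (z v) ∧ ¬ Candidate M 0 (z v))
      (fun v w => v ≠ w ∧ ¬ ZShape.Share (z v) (z w)) := by
  have input (M' : Mem) (h : Agree M M') : Input n z M' := hM.congr fun _ => h.apply_of_nonneg
  have sat_cand (M' : Mem) (h : Agree M M') (s i v : ℕ) (hv : v < n) (hi : M' (var i) = v) :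
      (Test.cand s i).Sat M' ↔ Candidate M s (z v) := by
    rw [(input M' h).sat_cand hv hi, Candidate, track_eq_of_agree hpos h, Candidate]
  exact {
    size := hM.size
    sat_A := fun M' h i v hv hi => sat_cand M' h 0 i v hv hi
    sat_B := fun M' h i v hv hi =>
      and_congr (sat_cand M' h 3 i v hv hi) (not_congr (sat_cand M' h 0 i v hv hi))
    sat_R := fun M' h i j v hv w hw hi hj => (input M' h).sat_apart hv hw hi hj }

end Decides

/-! ### The program for maximum cliques -/

open Cmd Auction

section Params

variable {n : ℕ} {z : ℕ → ZShape} {K : Finset ZShape}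

theorem exists_cell {v : ℕ} (hv : v < n) {x : ℤ} (hx : (z v).IsCoord x) :
    ∃ j < 8 * n + 1, ∀ M, Input n z M → M (j : ℕ) = x := by
  rcases hx with rfl | rfl | rfl | rfl | rfl
  · exact ⟨8 * v + 1, by omega, fun M hM => hM.cell_e v hv⟩
  · exact ⟨8 * v + 3, by omega, fun M hM => hM.cell_c v hv⟩
  · exact ⟨8 * v + 7, by omega, fun M hM => hM.cell_f v hv⟩
  · exact ⟨8 * v + 2, by omega, fun M hM => hM.cell_a v hv⟩
  · exact ⟨8 * v + 6, by omega, fun M hM => hM.cell_b v hv⟩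

theorem exists_param (hK : ∀ u ∈ K, ∃ v < n, z v = u) {x : ℤ} (hx : Track.IsVal K x) :
    ∃ j < 8 * n + 1, ∃ d < 3, ∀ M, Input n z M → 2 * M (j : ℕ) + (d : ℕ) - 1 = x := by
  obtain ⟨y, ⟨u, hu, hy⟩, hlo, hhi⟩ := hx
  obtain ⟨v, hv, rfl⟩ := hK u hu
  obtain ⟨j, hj, hM⟩ := exists_cell hv hy
  exact ⟨j, hj, (x - (2 * y - 1)).toNat, by omega, fun M h => by rw [hM M h]; omega⟩

theorem exists_track_params (hK : ∀ u ∈ K, ∃ v < n, z v = u) {T : Track} (hT : T.Valid K) :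
    ∃ J D : ℕ → ℕ, (∀ i, J i < 8 * n + 1) ∧ (∀ i, D i < 3) ∧ D 0 = T.k ∧
      ∀ M, Input n z M → 2 * M (J 1) + D 1 - 1 = T.r ∧ 2 * M (J 2) + D 2 - 1 = T.α ∧
        2 * M (J 3) + D 3 - 1 = T.β := by
  obtain ⟨hk, hr, hα, hβ⟩ := hT
  obtain ⟨j₁, hj₁, d₁, hd₁, h₁⟩ := exists_param hK hr
  obtain ⟨j₂, hj₂, d₂, hd₂, h₂⟩ := exists_param hK hα
  obtain ⟨j₃, hj₃, d₃, hd₃, h₃⟩ := exists_param hK hβ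
  refine ⟨fun | 1 => j₁ | 2 => j₂ | 3 => j₃ | _ => 0,
    fun | 0 => T.k.toNat | 1 => d₁ | 2 => d₂ | 3 => d₃ | _ => 0, fun i => ?_, fun i => ?_,
    by simp only; omega, fun M hM => ⟨h₁ M hM, h₂ M hM, h₃ M hM⟩⟩
  all_goals
    simp only
    split <;> omega

theorem exists_params (hK : ∀ u ∈ K, ∃ v < n, z v = u) {T : ℕ → Track} (hT : ∀ s, (T s).Valid K)
    (m : ℕ) : ∃ J D : ℕ → ℕ, (∀ t, J t < 8 * n + 1) ∧ (∀ t, D t < 3) ∧ ∀ M, Input n z M →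
      (∀ t < 4 * m, M (var (10 + 2 * t)) = J t ∧ M (var (11 + 2 * t)) = D t) →
        ∀ s < m, track M s = T s := by
  choose J D hJ hD hk hval using fun s => exists_track_params hK (hT s)
  refine ⟨fun t => J (t / 4) (t % 4), fun t => D (t / 4) (t % 4), fun t => hJ _ _,
    fun t => hD _ _, fun M hM hcount s hs => ?_⟩
  have counters (i : ℕ) (hi : i < 4) :
      M (var (10 + 2 * (4 * s + i))) = J s i ∧ M (var (11 + 2 * (4 * s + i))) = D s i := by
    simpa only [show (4 * s + i) / 4 = s by omega, show (4 * s + i) % 4 = i by omega] using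
      hcount (4 * s + i) (by omega)
  have eval_param (i : ℕ) (hi : i < 4) :
      (Expr.param (4 * s + i)).eval M = 2 * M (J s i) + D s i - 1 := by
    rw [Expr.eval_param, (counters i hi).1, (counters i hi).2]
  obtain ⟨hr, hα, hβ⟩ := hval s M hM
  have hk' : M (var (11 + 2 * (4 * s))) = (T s).k := (counters 0 (by omega)).2.trans (hk s)
  rw [track, hk', eval_param 1 (by omega), eval_param 2 (by omega), eval_param 3 (by omega), hr, hα,
    hβ]

end Params

/-- The command that improves the best clique so far by a clique that is the union of two cliques,
each of them given by three intervals. -/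
def step : Cmd := improve Test.first Test.second Test.apart

/-- The command that computes the clique number in the variable `0`. -/
def cliqueCmd : Cmd := nest 24 step

theorem writes_step_subset : step.writes ⊆ locals := writes_improve_subset _ _ _

theorem ok_cliqueCmd : cliqueCmd.Ok := (ok_improve _ _ _).nest writes_step_subset

/-- The sets of vertices below `n` whose paths pairwise share an edge. -/
def cliques (n : ℕ) (z : ℕ → ZShape) : Set (Finset ℕ) :=
  {s | (∀ v ∈ s, v < n) ∧ ∀ a ∈ s, ∀ b ∈ s, a ≠ b → ZShape.Share (z a) (z b)}

/-- The invariant of the search for a clique of size `ω`: the input is intact, the counters are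
addresses, and the best size so far is at most `ω`. -/
structure Searching (n : ℕ) (z : ℕ → ZShape) (ω : ℕ) (M : Mem) : Prop where
  input : Input n z M
  counter_nonneg : ∀ t, 0 ≤ M (var (10 + 2 * t))
  best_le : M (var 0) ≤ ω

section Search

variable {n ω : ℕ} {z : ℕ → ZShape} {M : Mem}

theorem ignores_searching {i : ℕ} (hi : 10 ≤ i) : Ignores i (Searching n z ω) := fun k M hM => by
  refine ⟨hM.input.congr fun x hx => Function.update_of_ne ?_ _ _, fun t => ?_, ?_⟩
  · exact ((var_neg i).trans_le hx).ne'
  · rw [update_var_apply]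
    split_ifs
    exacts [k.cast_nonneg, hM.counter_nonneg t]
  · rw [update_var_apply, if_neg (by omega)]
    exact hM.best_le

theorem not_candidate_of_candidate (v : ℕ) (h : Candidate M 0 (z v)) :
    ¬ (Candidate M 3 (z v) ∧ ¬ Candidate M 0 (z v)) := fun h' => h'.2 h

theorem Searching.decides (hM : Searching n z ω M) :
    Decides n M Test.first Test.second Test.apart (fun v => Candidate M 0 (z v))
      (fun v => Candidate M 3 (z v) ∧ ¬ Candidate M 0 (z v))
      (fun v w => v ≠ w ∧ ¬ ZShape.Share (z v) (z w)) :=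
  hM.input.decides hM.counter_nonneg

theorem preserves_searching (hω : ∀ s ∈ cliques n z, s.card ≤ ω) :
    step.Preserves (Searching n z ω) := fun M hM => by
  have agree : Agree M (den step M) := (Agree.refl M).den writes_step_subset
  refine ⟨hM.input.congr fun _ => agree.apply_of_nonneg, fun t => ?_, ?_⟩
  · rw [agree.apply_var (by omega)]
    exact hM.counter_nonneg t
  · refine hM.decides.den_improve_le not_candidate_of_candidate
      (fun a b hab => ⟨hab.1.symm, fun h => hab.2 h.symm⟩) (fun s hs hsR => hω s ⟨hs, ?_⟩)
      hM.best_le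
    exact fun a ha b hb hab => not_not.1 fun h => hsR a ha b hb ⟨hab, h⟩

theorem Searching.best_le_den_step (hM : Searching n z ω M) : M (var 0) ≤ den step M (var 0) :=
  hM.decides.le_den_improve not_candidate_of_candidate

theorem Searching.card_le_den_step (hM : Searching n z ω M)
    (hfirst : ∀ u v, Candidate M 0 u → Candidate M 0 v → ZShape.Share u v)
    (hsecond : ∀ u v, Candidate M 3 u → Candidate M 3 v → ZShape.Share u v) {s : Finset ℕ}
    (hs : s ∈ cliques n z) (hcover : ∀ v ∈ s, Candidate M 0 (z v) ∨ Candidate M 3 (z v)) :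
    s.card ≤ den step M (var 0) := by
  refine hM.decides.card_le_den_improve not_candidate_of_candidate ?_
    ⟨fun v hv => ⟨hs.1 v hv, ?_⟩, fun a ha b hb _ _ hab => hab.2 (hs.2 a ha b hb hab.1)⟩
  · rintro a - b - ⟨⟨-, hab⟩, h | h⟩
    exacts [hab (hfirst _ _ h.1 h.2), hab (hsecond _ _ h.1.1 h.2.1)]
  · have := hcover v hv
    tauto

theorem exists_counters {s : Finset ℕ} (hs : s ∈ cliques n z) (hne : s.Nonempty) :
    ∃ J D : ℕ → ℕ, (∀ t, J t < 8 * n + 1) ∧ (∀ t, D t < 3) ∧ ∀ M, Searching n z ω M →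
      (∀ t < 24, M (var (10 + 2 * t)) = J t ∧ M (var (11 + 2 * t)) = D t) →
        s.card ≤ den step M (var 0) := by
  classical
  have hshare : ∀ u ∈ s.image z, ∀ v ∈ s.image z, ZShape.Share u v := by
    simp only [Finset.forall_mem_image]
    intro a ha b hb
    by_cases hab : a = b
    exacts [hab ▸ ZShape.share_self _, hs.2 a ha b hb hab]
  obtain ⟨P, Q, ⟨T₀, T₁, T₂, v₀, v₁, v₂, hP, hPshare⟩, ⟨T₃, T₄, T₅, v₃, v₄, v₅, hQ, hQshare⟩,
    hcover⟩ := Track.covered (hne.image z) hshare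
  obtain ⟨J, D, hJ, hD, htrack⟩ := exists_params (n := n) (z := z) (K := s.image z)
    (T := fun | 0 => T₀ | 1 => T₁ | 2 => T₂ | 3 => T₃ | 4 => T₄ | _ => T₅)
    (Finset.forall_mem_image.2 fun v hv => ⟨v, hs.1 v hv, rfl⟩)
    (fun i => by split <;> assumption) 6
  refine ⟨J, D, hJ, hD, fun M hM hcount => ?_⟩
  have track_eq := htrack M hM.input hcount
  have first_iff : Candidate M 0 = Track.Cand T₀ T₁ T₂ := by
    ext u
    rw [Candidate, track_eq 0 (by omega), track_eq 1 (by omega), track_eq 2 (by omega)]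
    rfl
  have second_iff : Candidate M 3 = Track.Cand T₃ T₄ T₅ := by
    ext u
    rw [Candidate, track_eq 3 (by omega), track_eq 4 (by omega), track_eq 5 (by omega)]
    rfl
  refine hM.card_le_den_step (by rwa [first_iff]) (by rwa [second_iff]) hs fun v hv => ?_
  have hz := Finset.mem_image_of_mem z hv
  rw [first_iff, second_iff]
  exact (hcover (z v) hz).imp (hP (z v) hz) (hQ (z v) hz)

theorem den_cliqueCmd (hM : Input n z M) (h0 : ∀ i, M (var i) = 0)
    (hω : IsGreatest (Finset.card '' cliques n z) ω) : den cliqueCmd M (var 0) = ω := by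
  obtain ⟨⟨s, hs, hsω⟩, hle⟩ := hω
  have hP : step.Preserves (Searching n z ω) :=
    preserves_searching fun s hs => hle ⟨s, hs, rfl⟩
  have hstart : Searching n z ω M :=
    ⟨hM, fun t => (h0 _).ge, (h0 0).trans_le (Nat.cast_nonneg _)⟩
  let Done (M : Mem) : Prop := Searching n z ω M ∧ (ω : ℤ) ≤ M (var 0)
  have ignores_done (i : ℕ) (hi : 10 ≤ i) : Ignores i Done := fun k M hM =>
    ⟨ignores_searching hi k M hM.1, by rw [update_var_apply, if_neg (by omega)]; exact hM.2⟩
  have preserves_done : step.Preserves Done := fun M hM =>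
    ⟨hP M hM.1, hM.2.trans hM.1.best_le_den_step⟩
  suffices h : Done (den cliqueCmd M) from le_antisymm h.1.best_le h.2
  rcases s.eq_empty_or_nonempty with rfl | hne
  · refine Preserves.nest writes_step_subset (fun M hM => hM.1.input.size)
      (fun i hi _ => ignores_done i hi) preserves_done M ⟨hstart, ?_⟩
    rw [h0, ← hsω, Finset.card_empty, Nat.cast_zero]
  · obtain ⟨J, D, hJ, hD, reach⟩ := exists_counters (ω := ω) hs hne
    exact nest_reaches hJ hD writes_step_subset (fun M hM => hM.input.size)
      (fun M hM => hM.1.input.size) (fun i hi _ => ignores_searching hi)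
      (fun i hi _ => ignores_done i hi) hP preserves_done
      (fun M hM hcount => ⟨hP M hM, hsω ▸ reach M hM hcount⟩) hstart

end Search

/-! ### Reading the representation -/

theorem getD_flatMap {α β : Type*} (f : α → List β) (d : β) {m : ℕ} {l : List α}
    (hf : ∀ a ∈ l, (f a).length = m) {v o : ℕ} (hv : v < l.length) (ho : o < m) :
    (l.flatMap f).getD (m * v + o) d = (f l[v]).getD o d := by
  induction l generalizing v with
  | nil => simp at hv
  | cons a l ih =>
    have ha := hf a (by simp)
    rw [List.flatMap_cons]
    cases v with
    | zero =>
      rw [mul_zero, zero_add, List.getD_append _ _ _ _ (by omega)]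
      rfl
    | succ v =>
      rw [List.getD_append_right _ _ _ _ (by rw [ha, mul_add]; omega), ha,
        show m * (v + 1) + o - m = m * v + o by rw [mul_add]; omega]
      exact ih (fun a ha => hf a (by simp [ha])) (by simpa using hv)

namespace BendRep

variable {k n : ℕ} {G : SimpleGraph (Fin n)}

theorem ofList_encode_apply (R : BendRep k G) (h : ∀ v, (R.path v).corners.length = 4)
    (v : Fin n) {o : ℕ} (ho : o < 8) : Mem.ofList R.encode (8 * (v : ℕ) + (o + 1 : ℕ)) =
      ((R.path v).corners.flatMap fun p => [p.1, p.2]).getD o 0 := by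
  rw [Mem.ofList, if_pos (by positivity), encode,
    show (8 * ((v : ℕ) : ℤ) + (o + 1 : ℕ)).toNat = (8 * v + o) + 1 by omega, List.getD_cons_succ,
    getD_flatMap _ _ (fun w _ => by simp [h]) (by simp) ho, List.getElem_finRange]
  rfl

theorem input_ofList_encode (R : BendRep k G) {z : ℕ → ZShape}
    (hz : ∀ v : Fin n, (R.path v).corners = (z v).corners) :
    Input n z (Mem.ofList R.encode) := by
  have block (v : ℕ) (hv : v < n) (o : ℕ) (ho : o < 8) :
      Mem.ofList R.encode (8 * v + (o + 1 : ℕ)) =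
        ((z v).corners.flatMap fun p => [p.1, p.2]).getD o 0 := by
    rw [← hz ⟨v, hv⟩]
    exact R.ofList_encode_apply (fun v => by rw [hz]; rfl) ⟨v, hv⟩ ho
  exact ⟨rfl, fun v hv => block v hv 0 (by omega), fun v hv => block v hv 1 (by omega),
    fun v hv => block v hv 2 (by omega), fun v hv => block v hv 5 (by omega),
    fun v hv => block v hv 6 (by omega)⟩

theorem exists_shapes (R : BendRep 2 G) (hR : ∀ v, (R.path v).rows.ncard = 2) :
    ∃ z : ℕ → ZShape, Input n z (Mem.ofList R.encode) ∧
      ∀ u v : Fin n, G.Adj u v ↔ u ≠ v ∧ ZShape.Share (z u) (z v) := by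
  choose z hcorners hedges using fun v => (R.path v).exists_zShape (R.bends_le v) (hR v)
  let arbitrary : ZShape := ⟨0, 1, 0, 0, 1, by norm_num, by norm_num, by norm_num⟩
  refine ⟨fun v => if h : v < n then z ⟨v, h⟩ else arbitrary,
    R.input_ofList_encode fun v => by simp [hcorners], fun u v => ?_⟩
  simp only [R.adj_iff, ZShape.Share, Fin.is_lt, dif_pos, Fin.eta, ← hedges]
  rfl

end BendRep

theorem isGreatest_cliqueNum {n : ℕ} {G : SimpleGraph (Fin n)} {z : ℕ → ZShape}
    (hadj : ∀ u v : Fin n, G.Adj u v ↔ u ≠ v ∧ ZShape.Share (z u) (z v)) :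
    IsGreatest (Finset.card '' cliques n z) G.cliqueNum := by
  constructor
  · obtain ⟨s, hs⟩ := G.exists_isNClique_cliqueNum
    refine ⟨s.map Fin.valEmbedding, ⟨?_, ?_⟩, by rw [Finset.card_map, hs.card_eq]⟩
    · simp
    · simp only [Finset.forall_mem_map, Fin.valEmbedding_apply]
      exact fun a ha b hb hab => ((hadj a b).1 (hs.isClique ha hb fun h => hab (by rw [h]))).2
  · rintro _ ⟨s, ⟨hs, hshare⟩, rfl⟩
    rw [← Finset.card_attachFin s hs]
    refine SimpleGraph.IsClique.card_le_cliqueNum (tc := fun a ha b hb hab => ?_)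
    exact (hadj a b).2 ⟨hab, hshare a (Finset.mem_attachFin hs |>.1 ha) b
      (Finset.mem_attachFin hs |>.1 hb) (Fin.val_ne_of_ne hab)⟩

end EPG

theorem mainTheorem2 :
    ∃ (c : EPG.Program) (p : Polynomial ℕ),
      ∀ (n : ℕ) (G : SimpleGraph (Fin n)) (R : EPG.BendRep 2 G),
        (∀ v, (R.path v).IsZ) →
          ∃ (t : ℕ) (M : EPG.Mem),
            EPG.Runs c (EPG.Mem.ofList R.encode) t M ∧ t ≤ p.eval n ∧ M 0 = (G.cliqueNum : ℤ) := by
  refine ⟨.seq EPG.cliqueCmd.compile (.store (.const 0) (.var 0)),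
    EPG.cliqueCmd.time + Polynomial.C 4, fun n G R hR => ?_⟩
  obtain ⟨z, hinput, hadj⟩ := R.exists_shapes fun v => (hR v).1
  obtain ⟨t, ht, hruns⟩ := EPG.Cmd.runs_compile EPG.ok_cliqueCmd hinput.size
  have hvars (i : ℕ) : EPG.Mem.ofList R.encode (EPG.var i) = 0 := if_neg (EPG.var_neg i).not_ge
  refine ⟨t + 4, _, .seq hruns (.store _ _ _), ?_, ?_⟩
  · rw [Polynomial.eval_add, Polynomial.eval_C]
    exact Nat.add_le_add_right ht 4
  · rw [EPG.Expr.eval_var, EPG.den_cliqueCmd hinput hvars (EPG.isGreatest_cliqueNum hadj)]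
    exact Function.update_self _ _ _
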